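/- Let $p$ be a prime, $q=p^n$ with $n\ge 1$ and $q\equiv 1\pmod 3$, and let $\delta\in\mathbb F_q$ be a cubic nonresidue. Write each $\alpha\in\mathbb F_q(\delta^{1/3})\cong\mathbb F_{q^3}$ as $\alpha=\alpha_1+\alpha_2\delta^{1/3}+\alpha_3\delta^{2/3}$ with $\alpha_i\in\mathbb F_q$, and put $$\mathbb H_q=\{(\alpha,\beta)\in\mathbb F_q(\delta^{1/3})^2:\ \alpha_2\beta_3-\alpha_3\beta_2\ne 0\}.$$ The group $G=\mathrm{GL}_3(\mathbb F_q)$ acts transitively on $\mathbb H_q$: if $g$ has rows $(a,b,c),(d,e,f),(r,s,t)$, then $g(\alpha,\beta)=\left(\frac{a\alpha+b\beta+c}{r\alpha+s\beta+t},\frac{d\alpha+e\beta+f}{r\alpha+s\beta+t}\right)$. Let $p_0=(\delta^{2/3},\delta^{1/3})$ and let $K\cong\mathbb F_q(\delta^{1/3})^\times$ be its stabilizer, whose elements are the matrices $$\begin{pmatrix}a&c\delta&b\delta\\ b&a&c\delta\\ c&b&a\end{pmatrix},\qquad a+b\delta^{1/3}+c\delta^{2/3}\ne 0 .$$ Let $\Gamma=\mathrm{GL}_3(\mathbb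 F_p)\le G$ and $\rho=\mathrm{Ind}_\Gamma^G 1$, realized on $\{\varphi:G\to\mathbb C:\ \varphi(\gamma g)=\varphi(g)\text{ for all }\gamma\in\Gamma,\ g\in G\}$ by right translation. Let $f:G\to\mathbb C$ be $K$-bi-invariant, that is, $f(kxh)=f(x)$ for $k,h\in K$, $x\in G$; regard $f$ as a function on $\mathbb H_q\cong G/K$ by $f(gp_0)=f(g)$. For $\kappa\in\mathrm{GL}_2(\mathbb F_q)$ define the horocycle transform $$Hf(\kappa)=\sum_{x,y\in\mathbb F_q}\ \sum_{\xi\in\{\kappa\}}f\left(\begin{pmatrix}\xi_{11}&\xi_{12}&x\\ \xi_{21}&\xi_{22}&y\\ 0&0&1\end{pmatrix}p_0\right),$$ where $\xi$ runs over the conjugacy class of $\kappa$ in $\mathrm{GL}_2(\mathbb F_q)$. For a representation $\pi$ of $G$ put $\hat f(\pi)=\sum_{g\in G}f(g)\pi(g^{-1})$, and let $m(\pi,\rho)$ be the multiplicity of $\pi$ in $\rho$. Let $\hat G$ be the (finite) set of isomorphism classes of irreducible complex representations of $G$. For $\gamma\in\Gamma$, let $G_\gamma$ and $\Gamma_\gamma$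 be its centralizers in $G$ and $\Gamma$, and put $I_G(f,\gamma)=\sum_{s\in G_\gamma\backslash G}f(s^{-1}\gamma s)$. Then $$\sum_{\pi\in\hat G}m(\pi,\rho)\,\mathrm{Tr}\,\hat f(\pi)=\sum_{\{\gamma\}}\frac{|G_\gamma|}{|\Gamma_\gamma|}I_G(f,\gamma)=Z+H_1+H_2+P_1+P_2+P_3+E_1+E_2,$$ where $\{\gamma\}$ runs over the conjugacy classes of $\Gamma$ and the eight terms on the right are the contributions $\sum\frac{|G_\gamma|}{|\Gamma_\gamma|}I_G(f,\gamma)$ of the classes of the following types (throughout, $a,b,c,e\in\mathbb F_p^\times$). * Central, $\gamma=aI$: $$Z=\frac{(q^3-1)(q^2-1)(q-1)q^3}{(p^3-1)(p^2-1)p^3}\,f(p_0).$$ * Hyperbolic of the first kind, $\gamma\sim\mathrm{diag}(a,a,b)$ with $a\ne b$: $$H_1=\frac{(q^3-1)(q^2-1)(q^2-q)}{(p^2-1)(p^2-p)}\sum_{a\in\mathbb F_p^\times,\ a\ne1}Hf(aI).$$ * Hyperbolic of the second kind, $\gamma\sim\mathrm{diag}(a,b,c)$ with $a,b,c$ distinct: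 $$H_2=\frac16(q^2+q+1)\frac{(q-1)^3}{(p-1)^2}\sum_{\substack{a,b\in\mathbb F_p^\times\setminus\{1\}\\ a\ne b}}Hf\begin{pmatrix}a&0\\0&b\end{pmatrix}.$$ * Parabolic of the first kind, $\gamma\sim\begin{pmatrix}a&0&a\\0&a&0\\0&0&a\end{pmatrix}$: $$P_1=\frac{q^3(q^3-1)(q-1)}{p^3(p-1)}\bigl(Hf(I)-f(p_0)\bigr).$$ * Parabolic of the second kind, $\gamma\sim\begin{pmatrix}a&a&0\\0&a&a\\0&0&a\end{pmatrix}$: $$P_2=\frac{q^2(q-1)}{p^2}\,\tilde I_G(f),$$ where $$\begin{aligned}\tilde I_G(f)=(q^2+q+1)\sum_{r,s\in\mathbb F_q^\times}\sum_{t\in\mathbb F_q}\Bigl(&f\bigl(\delta^{2/3}+r\delta^{1/3}+t,\ \delta^{1/3}+s\bigr)\\&+\sum_{v\in\mathbb F_q}f\bigl((1-rv)\delta^{2/3}-rv^2\delta^{1/3}+s-tv,\ r\delta^{2/3}+(1+rv)\delta^{1/3}+t\bigr)\Bigr).\end{aligned}$$ * Parabolic of the third kind, $\gamma\sim\begin{pmatrix}a&0&0\\a&a&0\\0&0&b\end{pmatrix}$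 with $a\ne b$: $$P_3=\frac{q(q-1)(q^3-1)}{p(p-1)}\sum_{c\in\mathbb F_p^\times,\ c\ne1}Hf\begin{pmatrix}c&1\\0&c\end{pmatrix}.$$ * Elliptic of the first kind, $\gamma$ with irreducible characteristic polynomial over $\mathbb F_p$. If $3\mid n$, $$E_1=\frac13\cdot\frac{(q-1)^3}{p^3-1}\cdot\frac{q^3-1}{q-1}\sum_{\xi\in\mathbb F_{p^3}\setminus\mathbb F_p}Hf\begin{pmatrix}\xi^{p-1}&0\\0&\xi^{p^2-1}\end{pmatrix};$$ if $3\nmid n$, $$E_1=\frac13\cdot\frac{q^3-1}{p^3-1}\sum_{k}\ \sum_{y}f\bigl(y^{-1}k\,y\,p_0\bigr),$$ where $k$ runs over the elements of $K$ that correspond to $\mathbb F_{p^3}\setminus\mathbb F_p\subset\mathbb F_q(\delta^{1/3})$ and $y$ over the invertible $3\times3$ matrices over $\mathbb F_q$ with last row $(0,0,1)$. * Elliptic of the second kind, $\gamma\sim\begin{pmatrix}g&0\\0&e\end{pmatrix}$ with $g\in\mathrm{GL}_2(\mathbb F_p)$ of irreducible characteristic polynomial. If $n$ is even, $$E_2=\frac12\cdot\frac{(q-1)^3}{p^2-1}\cdot\frac{q^3-1}{q-1}\sum_{\eta\in\mathbb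 F_{p^2}\setminus\mathbb F_p}Hf\begin{pmatrix}\eta&0\\0&\eta^p\end{pmatrix};$$ if $n$ is odd (so that $p$ is odd), for any nonsquare $\xi\in\mathbb F_p$, $$E_2=\frac12\cdot\frac{(q^3-1)(q^2-1)}{p^2-1}\sum_{s\in\mathbb F_p}\sum_{t\in\mathbb F_p^\times}Hf\begin{pmatrix}s&t\xi\\t&s\end{pmatrix}.$$ -/

import Mathlib

open scoped MatrixGroups
open Polynomial

noncomputable section

/-! ### Spectral side: irreducible representations of a finite group -/

namespace SpectralSide

variable (G : Type*) [Group G]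

/-- A finite-dimensional complex representation of `G` that is irreducible, realized on some
coordinate space `ℂᵈ`. -/
structure IrrepModel where
  dim : ℕ
  rep : Representation ℂ G (Fin dim → ℂ)
  irreducible : rep.IsIrreducible

/-- Isomorphism of irreducible representations. -/
def irrepSetoid : Setoid (IrrepModel G) where
  r π σ := Nonempty (π.rep.Equiv σ.rep)
  iseqv :=
    { refl := fun π => ⟨Representation.Equiv.refl π.rep⟩
      symm := fun ⟨e⟩ => ⟨e.symm⟩
      trans := fun ⟨e⟩ ⟨e'⟩ => ⟨e.trans e'⟩ }

/-- The set `Ĝ` of isomorphism classes of irreducible complex representations of `G`. -/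
def Irrep := Quotient (irrepSetoid G)

variable {G}

/-- A chosen representative of an isomorphism class of irreducible representations. -/
def Irrep.out (π : Irrep G) : IrrepModel G := Quotient.out (s := irrepSetoid G) π

/-- The Fourier transform `f̂(κ) = ∑ g, f(g) κ(g⁻¹)` of `f : G → ℂ` at a representation `κ`. -/
def fourier [Fintype G] {V : Type*} [AddCommGroup V] [Module ℂ V] (f : G → ℂ)
    (κ : Representation ℂ G V) : V →ₗ[ℂ] V :=
  ∑ g : G, f g • κ g⁻¹

/-- The multiplicity of an irreducible representation `π` in `ρ`, as the dimension of the space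
of intertwining maps `π → ρ`. -/
def multiplicity {V W : Type*} [AddCommGroup V] [Module ℂ V] [AddCommGroup W] [Module ℂ W]
    (π : Representation ℂ G V) (ρ : Representation ℂ G W) : ℕ :=
  Module.finrank ℂ (π.IntertwiningMap ρ)

/-- The induced representation of the trivial representation along `ι : Γ → G`: the space of
functions `φ : G → ℂ` with `φ (ι γ * g) = φ g`, on which `G` acts by right translation. -/
abbrev inducedTrivial {Γ : Type*} [Group Γ] (ι : Γ →* G) :
    Representation ℂ G (Representation.coindV ι (Representation.trivial ℂ Γ ℂ)) :=
  Representation.coind ι (Representation.trivial ℂ Γ ℂ)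

/-- The spectral side `∑_{π ∈ Ĝ} m(π, ρ) Tr f̂(π)` for `ρ = Ind_Γ^G 1`. -/
def spectralSide [Fintype G] {Γ : Type*} [Group Γ] (ι : Γ →* G) (f : G → ℂ) : ℂ :=
  ∑ᶠ π : Irrep G, (multiplicity π.out.rep (inducedTrivial ι) : ℂ) *
    LinearMap.trace ℂ _ (fourier f π.out.rep)

open Classical in
/-- The orbital sum `I_G(f, γ) = ∑_{s ∈ G_γ \ G} f(s⁻¹ γ s)`, where `G_γ` is the centralizer
of `γ`. -/
def orbitalSum [Fintype G] (f : G → ℂ) (γ : G) : ℂ :=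
  ∑ s : Quotient (QuotientGroup.rightRel (Subgroup.centralizer ({γ} : Set G))),
    f (s.out⁻¹ * γ * s.out)

open Classical in
/-- The sum of `(|G_γ| / |Γ_γ|) I_G(f, γ)` over those conjugacy classes `{γ}` of `Γ` whose members
satisfy the predicate `T`. -/
def geometricSum [Fintype G] {Γ : Type*} [Group Γ] [Fintype Γ] (ι : Γ →* G) (T : Γ → Prop)
    (f : G → ℂ) : ℂ :=
  ∑ c : ConjClasses Γ with T (Quotient.out c),
    (Nat.card (Subgroup.centralizer ({ι (Quotient.out c)} : Set G)) : ℂ) /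
      (Nat.card (Subgroup.centralizer ({Quotient.out c} : Set Γ)) : ℂ) *
      orbitalSum f (ι (Quotient.out c))

end SpectralSide

/-! ### The finite upper half-space -/

namespace UpperHalfSpace

variable {F : Type*} [Field F]

/-- The extension `F(δ^{1/3})`. -/
abbrev CubicExt (δ : F) := AdjoinRoot (X ^ 3 - C δ : F[X])

/-- If `δ` is a cubic nonresidue then `X³ - δ` is irreducible, so that `F(δ^{1/3})` is a field. -/
instance factIrreducible (δ : F) [h : Fact (∀ x : F, x ^ 3 ≠ δ)] :
    Fact (Irreducible (X ^ 3 - C δ : F[X])) :=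
  ⟨X_pow_sub_C_irreducible_of_prime Nat.prime_three h.out⟩

/-- The cube root `δ^{1/3}`. -/
def theta (δ : F) : CubicExt δ := AdjoinRoot.root _

/-- The element `a₁ + a₂ δ^{1/3} + a₃ δ^{2/3}`. -/
def ofCoords (δ : F) (a₁ a₂ a₃ : F) : CubicExt δ :=
  algebraMap F _ a₁ + algebraMap F _ a₂ * theta δ + algebraMap F _ a₃ * theta δ ^ 2

lemma monic_aux (δ : F) : (X ^ 3 - C δ : F[X]).Monic := monic_X_pow_sub_C δ three_ne_zero

/-- The coefficient of `δ^{i/3}`, `i = 0, 1, 2`, of an element of `F(δ^{1/3})` with respect to the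
basis `1, δ^{1/3}, δ^{2/3}`. -/
def coord (δ : F) (i : ℕ) : CubicExt δ →ₗ[F] F :=
  (Polynomial.lcoeff F i).comp (AdjoinRoot.modByMonicHom (monic_aux δ))

lemma ofCoords_eq_mk (δ a₁ a₂ a₃ : F) :
    ofCoords δ a₁ a₂ a₃ = AdjoinRoot.mk _ (C a₁ + C a₂ * X + C a₃ * X ^ 2) := by
  simp [ofCoords, theta, AdjoinRoot.algebraMap_eq]

lemma natDegree_aux (δ : F) : (X ^ 3 - C δ : F[X]).natDegree = 3 := by compute_degree!

lemma degree_aux (δ : F) : (X ^ 3 - C δ : F[X]).degree = 3 := by compute_degree!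

lemma modByMonicHom_ofCoords (δ a₁ a₂ a₃ : F) :
    AdjoinRoot.modByMonicHom (monic_aux δ) (ofCoords δ a₁ a₂ a₃) =
      C a₁ + C a₂ * X + C a₃ * X ^ 2 := by
  rw [ofCoords_eq_mk, AdjoinRoot.modByMonicHom_mk, Polynomial.modByMonic_eq_self_iff (monic_aux δ),
    degree_aux]
  refine lt_of_le_of_lt (b := 2) ?_ (by norm_num)
  compute_degree

@[simp] lemma coord_zero_ofCoords (δ a₁ a₂ a₃ : F) : coord δ 0 (ofCoords δ a₁ a₂ a₃) = a₁ := by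
  simp [coord, modByMonicHom_ofCoords]

@[simp] lemma coord_one_ofCoords (δ a₁ a₂ a₃ : F) : coord δ 1 (ofCoords δ a₁ a₂ a₃) = a₂ := by
  simp [coord, modByMonicHom_ofCoords, coeff_C]

@[simp] lemma coord_two_ofCoords (δ a₁ a₂ a₃ : F) : coord δ 2 (ofCoords δ a₁ a₂ a₃) = a₃ := by
  simp [coord, modByMonicHom_ofCoords]

lemma ofCoords_coord (δ : F) (α : CubicExt δ) :
    ofCoords δ (coord δ 0 α) (coord δ 1 α) (coord δ 2 α) = α := by
  have h := AdjoinRoot.mk_leftInverse (monic_aux δ) α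
  set P := AdjoinRoot.modByMonicHom (monic_aux δ) α with hP
  have hdeg : P.natDegree < 3 := by
    obtain ⟨Q, rfl⟩ := AdjoinRoot.mk_surjective α
    rw [hP, AdjoinRoot.modByMonicHom_mk]
    have := Polynomial.natDegree_modByMonic_lt Q (monic_aux δ)
      (by intro h1; have := natDegree_aux δ; rw [h1] at this; simp at this)
    rwa [natDegree_aux] at this
  rw [ofCoords_eq_mk]
  conv_rhs => rw [← h, P.as_sum_range_C_mul_X_pow' hdeg]
  simp [Finset.sum_range_succ, coord, ← hP]

/-- The finite upper half-space: pairs `(α, β)` in `F(δ^{1/3})` with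
`α₂ β₃ - α₃ β₂ ≠ 0`, where `α₂, α₃` are the coefficients of `δ^{1/3}, δ^{2/3}`. -/
@[ext] structure Hq (δ : F) where
  val : CubicExt δ × CubicExt δ
  det_ne_zero : coord δ 1 val.1 * coord δ 2 val.2 - coord δ 2 val.1 * coord δ 1 val.2 ≠ 0

/-- The point `(a₁ + a₂ δ^{1/3} + a₃ δ^{2/3}, b₁ + b₂ δ^{1/3} + b₃ δ^{2/3})`. -/
def Hq.point (δ : F) (a₁ a₂ a₃ b₁ b₂ b₃ : F) (h : a₂ * b₃ - a₃ * b₂ ≠ 0) : Hq δ :=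
  ⟨(ofCoords δ a₁ a₂ a₃, ofCoords δ b₁ b₂ b₃), by simpa using h⟩

/-- The distinguished point `p₀ = (δ^{2/3}, δ^{1/3})`. -/
def basePoint (δ : F) : Hq δ := Hq.point δ 0 0 1 0 1 0 (by simp)

/-- The affine form `a α + b β + c`, where `(a, b, c)` is the `i`-th row of `g`. -/
def rowForm {δ : F} (g : GL (Fin 3) F) (z : CubicExt δ × CubicExt δ) (i : Fin 3) : CubicExt δ :=
  algebraMap F _ (g.1 i 0) * z.1 + algebraMap F _ (g.1 i 1) * z.2 + algebraMap F _ (g.1 i 2)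

lemma coord_algebraMap (δ c : F) :
    coord δ 1 (algebraMap F (CubicExt δ) c) = 0 ∧ coord δ 2 (algebraMap F (CubicExt δ) c) = 0 := by
  have h : algebraMap F (CubicExt δ) c = ofCoords δ c 0 0 := by simp [ofCoords]
  rw [h]; simp

lemma coord_combination (δ : F) (i : ℕ) (c₀ c₁ c₂ : F) (z : CubicExt δ × CubicExt δ) :
    coord δ i (algebraMap F _ c₀ * z.1 + algebraMap F _ c₁ * z.2 + algebraMap F _ c₂) =
      c₀ * coord δ i z.1 + c₁ * coord δ i z.2 + coord δ i (algebraMap F _ c₂) := by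
  simp only [map_add, ← Algebra.smul_def, map_smul, smul_eq_mul]

lemma algebraMap_cubic_injective (δ : F) :
    Function.Injective (algebraMap F (CubicExt δ)) := by
  rw [injective_iff_map_eq_zero]
  intro c hc
  have h : algebraMap F (CubicExt δ) c = ofCoords δ c 0 0 := by simp [ofCoords]
  rw [h] at hc
  simpa using congrArg (coord δ 0) hc

/-- The determinant condition says that `α, β, 1` are linearly independent over `F`. -/
lemma det_ne_zero_iff (δ : F) (z : CubicExt δ × CubicExt δ) :
    coord δ 1 z.1 * coord δ 2 z.2 - coord δ 2 z.1 * coord δ 1 z.2 ≠ 0 ↔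
      ∀ c₀ c₁ c₂ : F, algebraMap F _ c₀ * z.1 + algebraMap F _ c₁ * z.2 + algebraMap F _ c₂ = 0 →
        c₀ = 0 ∧ c₁ = 0 ∧ c₂ = 0 := by
  constructor
  · intro hd c₀ c₁ c₂ h
    have h1 := congrArg (coord δ 1) h
    have h2 := congrArg (coord δ 2) h
    rw [coord_combination, (coord_algebraMap δ c₂).1, map_zero] at h1
    rw [coord_combination, (coord_algebraMap δ c₂).2, map_zero] at h2
    have e0 : c₀ = 0 := by
      refine (mul_eq_zero.1 (?_ : c₀ * _ = 0)).resolve_right hd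
      linear_combination coord δ 2 z.2 * h1 - coord δ 1 z.2 * h2
    have e1 : c₁ = 0 := by
      refine (mul_eq_zero.1 (?_ : c₁ * _ = 0)).resolve_right hd
      linear_combination - coord δ 2 z.1 * h1 + coord δ 1 z.1 * h2
    subst e0 e1
    refine ⟨rfl, rfl, algebraMap_cubic_injective δ ?_⟩
    simpa using h
  · intro hi hd
    obtain ⟨v, hv, hM⟩ := Matrix.exists_mulVec_eq_zero_iff.2
      (show Matrix.det !![coord δ 1 z.1, coord δ 1 z.2; coord δ 2 z.1, coord δ 2 z.2] = 0 by
        rw [Matrix.det_fin_two_of]; linear_combination hd)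
    have h1 := congrFun hM 0
    have h2 := congrFun hM 1
    simp [Matrix.mulVec, dotProduct, Fin.sum_univ_two] at h1 h2
    have key : algebraMap F (CubicExt δ) (v 0) * z.1 + algebraMap F _ (v 1) * z.2 +
        algebraMap F _ (-(v 0 * coord δ 0 z.1 + v 1 * coord δ 0 z.2)) = 0 := by
      have hz1 := ofCoords_coord δ z.1
      have hz2 := ofCoords_coord δ z.2
      have h1' := congrArg (algebraMap F (CubicExt δ)) h1
      have h2' := congrArg (algebraMap F (CubicExt δ)) h2
      simp only [ofCoords] at hz1 hz2
      simp only [map_neg, map_add, map_mul, map_zero] at h1' h2' ⊢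
      linear_combination (theta δ) * h1' + (theta δ) ^ 2 * h2' -
        algebraMap F (CubicExt δ) (v 0) * hz1 - algebraMap F (CubicExt δ) (v 1) * hz2
    obtain ⟨e0, e1, -⟩ := hi _ _ _ key
    exact hv (funext fun i => by fin_cases i <;> simp [e0, e1])

lemma rowForm_combination {δ : F} (g : GL (Fin 3) F) (z : CubicExt δ × CubicExt δ)
    (c : Fin 3 → F) :
    ∑ i, algebraMap F _ (c i) * rowForm g z i =
      algebraMap F _ (Matrix.vecMul c g.1 0) * z.1 + algebraMap F _ (Matrix.vecMul c g.1 1) * z.2 +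
        algebraMap F _ (Matrix.vecMul c g.1 2) := by
  simp only [rowForm, Matrix.vecMul, dotProduct, Fin.sum_univ_three, map_add, map_mul]
  ring

lemma rowForm_independent {δ : F} (g : GL (Fin 3) F) (z : Hq δ) (c : Fin 3 → F)
    (h : ∑ i, algebraMap F _ (c i) * rowForm g z.1 i = 0) : c = 0 := by
  rw [rowForm_combination] at h
  obtain ⟨h0, h1, h2⟩ := (det_ne_zero_iff δ z.1).1 z.2 _ _ _ h
  have hv : Matrix.vecMul c g.1 = 0 := by
    funext i; fin_cases i <;> simp [h0, h1, h2]
  have := congrArg (fun w => Matrix.vecMul w (g⁻¹).1) hv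
  simp only [Matrix.vecMul_vecMul, Matrix.zero_vecMul] at this
  rw [← Units.val_mul, mul_inv_cancel, Units.val_one, Matrix.vecMul_one] at this
  exact this

lemma rowForm_mul {δ : F} (g h : GL (Fin 3) F) (z : CubicExt δ × CubicExt δ) (i : Fin 3) :
    rowForm (g * h) z i = algebraMap F _ (g.1 i 0) * rowForm h z 0 +
      algebraMap F _ (g.1 i 1) * rowForm h z 1 + algebraMap F _ (g.1 i 2) * rowForm h z 2 := by
  simp only [rowForm, Units.val_mul, Matrix.mul_apply, Fin.sum_univ_three, map_add, map_mul]
  ring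

lemma det_affine (ξ : GL (Fin 2) F) (x y : F) :
    Matrix.det !![ξ.1 0 0, ξ.1 0 1, x; ξ.1 1 0, ξ.1 1 1, y; 0, 0, 1] ≠ 0 := by
  have h := (Matrix.isUnits_det_units ξ).ne_zero
  rw [Matrix.det_fin_two] at h
  rw [Matrix.det_fin_three]
  simpa using h

/-- The affine matrix with upper left block `ξ`, last column `(x, y, 1)` and last row
`(0, 0, 1)`. -/
def affineMat (ξ : GL (Fin 2) F) (x y : F) : GL (Fin 3) F :=
  Matrix.GeneralLinearGroup.mkOfDetNeZero _ (det_affine ξ x y)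

/-- The affine matrix which carries `p₀` to `z`. -/
def Hq.toAffine {δ : F} (z : Hq δ) : GL (Fin 3) F :=
  affineMat (Matrix.GeneralLinearGroup.mkOfDetNeZero
    !![coord δ 2 z.1.1, coord δ 1 z.1.1; coord δ 2 z.1.2, coord δ 1 z.1.2]
      (by rw [Matrix.det_fin_two_of]; intro h; exact z.2 (by linear_combination -h)))
    (coord δ 0 z.1.1) (coord δ 0 z.1.2)

lemma affineMat_val (ξ : GL (Fin 2) F) (x y : F) :
    (affineMat ξ x y).1 = !![ξ.1 0 0, ξ.1 0 1, x; ξ.1 1 0, ξ.1 1 1, y; 0, 0, 1] := rfl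

lemma Hq.toAffine_val {δ : F} (z : Hq δ) :
    z.toAffine.1 = !![coord δ 2 z.1.1, coord δ 1 z.1.1, coord δ 0 z.1.1;
      coord δ 2 z.1.2, coord δ 1 z.1.2, coord δ 0 z.1.2; 0, 0, 1] := rfl

variable {δ : F} [Fact (∀ x : F, x ^ 3 ≠ δ)]

lemma rowForm_two_ne_zero (g : GL (Fin 3) F) (z : Hq δ) : rowForm g z.1 2 ≠ 0 := by
  intro h
  have := rowForm_independent g z ![0, 0, 1] (by simp [Fin.sum_univ_three, h])
  simpa using congrFun this 2

/-- The action of `GL₃(F)` on the finite upper half-space by fractional linear transformations. -/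
instance : MulAction (GL (Fin 3) F) (Hq δ) where
  smul g z := ⟨(rowForm g z.1 0 / rowForm g z.1 2, rowForm g z.1 1 / rowForm g z.1 2), by
    rw [det_ne_zero_iff]
    intro c₀ c₁ c₂ h
    have h2 := rowForm_two_ne_zero g z
    have := rowForm_independent g z ![c₀, c₁, c₂] (by
      simp only [Fin.sum_univ_three, Matrix.cons_val]
      field_simp at h
      linear_combination h)
    exact ⟨by simpa using congrFun this 0, by simpa using congrFun this 1,
      by simpa using congrFun this 2⟩⟩
  one_smul z := Hq.ext <| by
    change (rowForm 1 z.1 0 / rowForm 1 z.1 2, rowForm 1 z.1 1 / rowForm 1 z.1 2) = z.1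
    simp [rowForm]
  mul_smul g h z := Hq.ext <| by
    have h2 := rowForm_two_ne_zero h z
    have key : ∀ i, rowForm (g * h) z.1 i / rowForm h z.1 2 =
        rowForm g (rowForm h z.1 0 / rowForm h z.1 2, rowForm h z.1 1 / rowForm h z.1 2) i := by
      intro i
      rw [rowForm_mul]
      generalize rowForm h z.1 2 = d at h2 ⊢
      generalize rowForm h z.1 0 = a
      generalize rowForm h z.1 1 = b
      simp only [rowForm]
      field_simp
    change (rowForm (g * h) z.1 0 / rowForm (g * h) z.1 2,
      rowForm (g * h) z.1 1 / rowForm (g * h) z.1 2) = (rowForm g (_, _) 0 / rowForm g (_, _) 2,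
      rowForm g (_, _) 1 / rowForm g (_, _) 2)
    rw [← key 0, ← key 1, ← key 2, div_div_div_cancel_right₀ h2, div_div_div_cancel_right₀ h2]

variable (δ) in
/-- The subgroup `K`, the stabilizer of `p₀`. -/
def K : Subgroup (GL (Fin 3) F) := MulAction.stabilizer (GL (Fin 3) F) (basePoint δ)

variable (δ) in
/-- `f(k x h) = f(x)` for all `k, h ∈ K`. -/
def BiInvariant (f : GL (Fin 3) F → ℂ) : Prop :=
  ∀ k ∈ K δ, ∀ h ∈ K δ, ∀ x, f (k * x * h) = f x

lemma Hq.toAffine_smul (z : Hq δ) : z.toAffine • basePoint δ = z := by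
  apply Hq.ext
  change (rowForm z.toAffine (basePoint δ).1 0 / rowForm z.toAffine (basePoint δ).1 2,
    rowForm z.toAffine (basePoint δ).1 1 / rowForm z.toAffine (basePoint δ).1 2) = z.1
  have h1 := ofCoords_coord δ z.1.1
  have h2 := ofCoords_coord δ z.1.2
  simp only [ofCoords] at h1 h2
  refine Prod.ext ?_ ?_
  · refine Eq.trans ?_ h1
    simp [rowForm, Hq.toAffine_val, basePoint, Hq.point, ofCoords]
    ring
  · refine Eq.trans ?_ h2
    simp [rowForm, Hq.toAffine_val, basePoint, Hq.point, ofCoords]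
    ring

/-- A right `K`-invariant function on `GL₃(F)`, regarded as a function on the upper half-space:
its value at `z` is `f(g)` for the affine matrix `g` with `g p₀ = z`. -/
def onHq (f : GL (Fin 3) F → ℂ) (z : Hq δ) : ℂ := f z.toAffine

/-- `onHq f (g p₀) = f g` for every `g`, so the choice of the affine matrix does not matter. -/
lemma onHq_smul {f : GL (Fin 3) F → ℂ} (hf : BiInvariant δ f) (g : GL (Fin 3) F) :
    onHq f (g • basePoint δ) = f g := by
  have hk : (g • basePoint δ).toAffine⁻¹ * g ∈ K δ := by
    rw [K, MulAction.mem_stabilizer_iff, mul_smul, inv_smul_eq_iff, Hq.toAffine_smul]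
  have := hf 1 (one_mem _) _ hk (g • basePoint δ).toAffine
  rw [one_mul, mul_inv_cancel_left] at this
  exact this.symm

lemma theta_cube (δ : F) : theta δ ^ 3 = algebraMap F (CubicExt δ) δ := by
  have h := AdjoinRoot.eval₂_root (X ^ 3 - C δ : F[X])
  simp only [eval₂_sub, eval₂_X_pow, eval₂_C] at h
  exact sub_eq_zero.1 h

lemma ofCoords_injective (δ : F) {a b c a' b' c' : F} (h : ofCoords δ a b c = ofCoords δ a' b' c') :
    a = a' ∧ b = b' ∧ c = c' :=
  ⟨by simpa using congrArg (coord δ 0) h, by simpa using congrArg (coord δ 1) h,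
    by simpa using congrArg (coord δ 2) h⟩

/-- `K` consists of the matrices of multiplication by the nonzero elements
`a + b δ^{1/3} + c δ^{2/3}` of `F(δ^{1/3})`. -/
lemma mem_K_iff (g : GL (Fin 3) F) :
    g ∈ K δ ↔ ∃ a b c : F, g.1 = !![a, c * δ, b * δ; b, a, c * δ; c, b, a] := by
  have hd := rowForm_two_ne_zero g (basePoint δ)
  have hrow : ∀ i, rowForm g (basePoint δ).1 i = ofCoords δ (g.1 i 2) (g.1 i 1) (g.1 i 0) := by
    intro i; simp [rowForm, basePoint, Hq.point, ofCoords]; ring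
  have h1 : ∀ a b c : F, theta δ * ofCoords δ a b c = ofCoords δ (c * δ) a b := by
    intro a b c; simp only [ofCoords, map_mul]
    linear_combination algebraMap F (CubicExt δ) c * theta_cube δ
  have hp1 : (basePoint δ).1.1 = theta δ * theta δ := by
    simp [basePoint, Hq.point, ofCoords, sq]
  have hp2 : (basePoint δ).1.2 = theta δ := by simp [basePoint, Hq.point, ofCoords]
  have key : g ∈ K δ ↔ rowForm g (basePoint δ).1 0 = theta δ * (theta δ * rowForm g (basePoint δ).1 2)
      ∧ rowForm g (basePoint δ).1 1 = theta δ * rowForm g (basePoint δ).1 2 := by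
    rw [K, MulAction.mem_stabilizer_iff, Hq.ext_iff, Prod.ext_iff]
    change rowForm g (basePoint δ).1 0 / rowForm g (basePoint δ).1 2 = (basePoint δ).1.1 ∧
      rowForm g (basePoint δ).1 1 / rowForm g (basePoint δ).1 2 = (basePoint δ).1.2 ↔ _
    rw [div_eq_iff hd, div_eq_iff hd, hp1, hp2, mul_assoc]
  rw [key, hrow, hrow, hrow, h1, h1]
  constructor
  · rintro ⟨e0, e1⟩
    obtain ⟨a0, a1, a2⟩ := ofCoords_injective δ e0
    obtain ⟨b0, b1, b2⟩ := ofCoords_injective δ e1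
    refine ⟨g.1 2 2, g.1 2 1, g.1 2 0, ?_⟩
    ext i j
    fin_cases i <;> fin_cases j <;> simp [a0, a1, a2, b0, b1, b2]
  · rintro ⟨a, b, c, h⟩
    simp [h]

end UpperHalfSpace

/-! ### The geometric terms -/

namespace GeometricSide

open UpperHalfSpace

/-! Types of conjugacy classes of `GL₃(𝔽_p)`. -/

section Types

variable {p : ℕ} [Fact p.Prime]

/-- Central elements `aI`. -/
def IsCentral (γ : GL (Fin 3) (ZMod p)) : Prop :=
  ∃ a : (ZMod p)ˣ, γ.1 = !![(a : ZMod p), 0, 0; 0, (a : ZMod p), 0; 0, 0, (a : ZMod p)]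

/-- Hyperbolic of the first kind: conjugate to `diag(a, a, b)`, `a ≠ b`. -/
def IsHyperbolic1 (γ : GL (Fin 3) (ZMod p)) : Prop :=
  ∃ a b : (ZMod p)ˣ, a ≠ b ∧
    IsConj !![(a : ZMod p), 0, 0; 0, (a : ZMod p), 0; 0, 0, (b : ZMod p)] γ.1

/-- Hyperbolic of the second kind: conjugate to `diag(a, b, c)` with `a, b, c` distinct. -/
def IsHyperbolic2 (γ : GL (Fin 3) (ZMod p)) : Prop :=
  ∃ a b c : (ZMod p)ˣ, a ≠ b ∧ b ≠ c ∧ a ≠ c ∧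
    IsConj !![(a : ZMod p), 0, 0; 0, (b : ZMod p), 0; 0, 0, (c : ZMod p)] γ.1

/-- Parabolic of the first kind. -/
def IsParabolic1 (γ : GL (Fin 3) (ZMod p)) : Prop :=
  ∃ a : (ZMod p)ˣ,
    IsConj !![(a : ZMod p), 0, (a : ZMod p); 0, (a : ZMod p), 0; 0, 0, (a : ZMod p)] γ.1

/-- Parabolic of the second kind. -/
def IsParabolic2 (γ : GL (Fin 3) (ZMod p)) : Prop :=
  ∃ a : (ZMod p)ˣ,
    IsConj !![(a : ZMod p), (a : ZMod p), 0; 0, (a : ZMod p), (a : ZMod p);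
      0, 0, (a : ZMod p)] γ.1

/-- Parabolic of the third kind. -/
def IsParabolic3 (γ : GL (Fin 3) (ZMod p)) : Prop :=
  ∃ a b : (ZMod p)ˣ, a ≠ b ∧
    IsConj !![(a : ZMod p), 0, 0; (a : ZMod p), (a : ZMod p), 0; 0, 0, (b : ZMod p)] γ.1

/-- Elliptic of the first kind: irreducible characteristic polynomial. -/
def IsElliptic1 (γ : GL (Fin 3) (ZMod p)) : Prop := Irreducible γ.1.charpoly

/-- Elliptic of the second kind: conjugate to a block matrix `diag(g, e)` with an irreducible
`2 × 2` block `g`. -/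
def IsElliptic2 (γ : GL (Fin 3) (ZMod p)) : Prop :=
  ∃ (g : Matrix (Fin 2) (Fin 2) (ZMod p)) (e : (ZMod p)ˣ), Irreducible g.charpoly ∧
    IsConj !![g 0 0, g 0 1, 0; g 1 0, g 1 1, 0; 0, 0, (e : ZMod p)] γ.1

end Types

variable {F : Type*} [Field F] [Fintype F] [DecidableEq F] (p : ℕ) [Fact p.Prime]
  [Algebra (ZMod p) F] (δ : F) [Fact (∀ x : F, x ^ 3 ≠ δ)] (f : GL (Fin 3) F → ℂ)

variable (F) in
/-- The embedding of `Γ = GL₃(𝔽_p)` into `G = GL₃(𝔽_q)`. -/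
def embed : GL (Fin 3) (ZMod p) →* GL (Fin 3) F :=
  Matrix.GeneralLinearGroup.map (algebraMap (ZMod p) F)

open Classical in
/-- The horocycle transform
`Hf(κ) = ∑_{x, y} ∑_{ξ ∈ {κ}} f([[ξ₁₁, ξ₁₂, x], [ξ₂₁, ξ₂₂, y], [0, 0, 1]] p₀)`, where `ξ` runs over
the conjugacy class of `κ` in `GL₂(F)`. -/
def horocycle (κ : Matrix (Fin 2) (Fin 2) F) : ℂ :=
  ∑ x : F, ∑ y : F, ∑ ξ : GL (Fin 2) F with IsConj κ ξ.1,
    onHq f (affineMat ξ x y • basePoint δ)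

/-- Contribution of the central elements. -/
def centralTerm : ℂ :=
  let q : ℂ := Fintype.card F
  ((q ^ 3 - 1) * (q ^ 2 - 1) * (q - 1) * q ^ 3) / ((p ^ 3 - 1) * (p ^ 2 - 1) * p ^ 3) *
    onHq f (basePoint δ)

/-- Contribution of the hyperbolic elements of the first kind. -/
def hyperbolicTerm1 : ℂ :=
  let q : ℂ := Fintype.card F
  let ι := algebraMap (ZMod p) F
  ((q ^ 3 - 1) * (q ^ 2 - 1) * (q ^ 2 - q)) / ((p ^ 2 - 1) * (p ^ 2 - p)) *
    ∑ a : (ZMod p)ˣ with a ≠ 1, horocycle δ f !![ι a, 0; 0, ι a]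

/-- Contribution of the hyperbolic elements of the second kind; the sum is over ordered pairs. -/
def hyperbolicTerm2 : ℂ :=
  let q : ℂ := Fintype.card F
  let ι := algebraMap (ZMod p) F
  1 / 6 * (q ^ 2 + q + 1) * ((q - 1) ^ 3 / (p - 1) ^ 2) *
    ∑ a : (ZMod p)ˣ with a ≠ 1, ∑ b : (ZMod p)ˣ with b ≠ 1 ∧ a ≠ b,
      horocycle δ f !![ι a, 0; 0, ι b]

/-- Contribution of the parabolic elements of the first kind. -/
def parabolicTerm1 : ℂ :=
  let q : ℂ := Fintype.card F
  (q ^ 3 * (q ^ 3 - 1) * (q - 1)) / (p ^ 3 * (p - 1)) *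
    (horocycle δ f 1 - onHq f (basePoint δ))

/-- The point `(δ^{2/3} + r δ^{1/3} + t, δ^{1/3} + s)`. -/
def parabolicPoint (r s t : F) : Hq δ :=
  Hq.point δ t r 1 s 1 0 (by simp)

/-- The point `((1 - rv) δ^{2/3} - r v² δ^{1/3} + (s - tv), r δ^{2/3} + (1 + rv) δ^{1/3} + t)`. -/
def parabolicPoint' (r s t v : F) : Hq δ :=
  Hq.point δ (s - t * v) (-(r * v ^ 2)) (1 - r * v) t (1 + r * v) r
    (by ring_nf; simp)

/-- The orbital sum of a parabolic element of the second kind, as an explicit sum over points. -/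
def parabolicOrbital2 : ℂ :=
  let q : ℂ := Fintype.card F
  (q ^ 2 + q + 1) * ∑ r : Fˣ, ∑ s : Fˣ, ∑ t : F,
    (onHq f (parabolicPoint δ r s t) + ∑ v : F, onHq f (parabolicPoint' δ r s t v))

/-- Contribution of the parabolic elements of the second kind. -/
def parabolicTerm2 : ℂ :=
  let q : ℂ := Fintype.card F
  (q ^ 2 * (q - 1)) / p ^ 2 * parabolicOrbital2 δ f

/-- Contribution of the parabolic elements of the third kind. -/
def parabolicTerm3 : ℂ :=
  let q : ℂ := Fintype.card F
  let ι := algebraMap (ZMod p) F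
  (q * (q - 1) * (q ^ 3 - 1)) / (p * (p - 1)) *
    ∑ c : (ZMod p)ˣ with c ≠ 1, horocycle δ f !![ι c, 1; 0, ι c]

open Classical in
/-- Contribution of the elliptic elements of the first kind when `3 ∣ n`, `q = pⁿ`; here `ξ` runs
over `𝔽_{p³} \ 𝔽_p` inside `𝔽_q`. -/
def ellipticTerm1Split : ℂ :=
  let q : ℂ := Fintype.card F
  1 / 3 * ((q - 1) ^ 3 / (p ^ 3 - 1)) * ((q ^ 3 - 1) / (q - 1)) *
    ∑ ξ : F with ξ ^ p ^ 3 = ξ ∧ ξ ^ p ≠ ξ,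
      horocycle δ f !![ξ ^ (p - 1), 0; 0, ξ ^ (p ^ 2 - 1)]

open Classical in
/-- Contribution of the elliptic elements of the first kind when `3 ∤ n`. Here `k` runs over the
elements of `K ≃ 𝔽_{q³}ˣ` which correspond to `𝔽_{p³} \ 𝔽_p`, and the inner sum is over the affine
matrices `y`. -/
def ellipticTerm1Nonsplit : ℂ :=
  let q : ℂ := Fintype.card F
  1 / 3 * ((q ^ 3 - 1) / (p ^ 3 - 1)) *
    ∑ k : GL (Fin 3) F with k ∈ K δ ∧ k ^ p ^ 3 = k ∧ k ^ p ≠ k,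
      ∑ ξ : GL (Fin 2) F, ∑ c : F, ∑ d : F,
        onHq f (((affineMat ξ c d)⁻¹ * k * affineMat ξ c d) • basePoint δ)

/-- Contribution of the elliptic elements of the first kind, for `q = pⁿ`. -/
def ellipticTerm1 (n : ℕ) : ℂ :=
  if 3 ∣ n then ellipticTerm1Split p δ f else ellipticTerm1Nonsplit p δ f

open Classical in
/-- Contribution of the elliptic elements of the second kind when `n` is even; here `η` runs over
`𝔽_{p²} \ 𝔽_p` inside `𝔽_q`. -/
def ellipticTerm2Even : ℂ :=
  let q : ℂ := Fintype.card F
  1 / 2 * ((q - 1) ^ 3 / (p ^ 2 - 1)) * ((q ^ 3 - 1) / (q - 1)) *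
    ∑ η : F with η ^ p ^ 2 = η ∧ η ^ p ≠ η, horocycle δ f !![η, 0; 0, η ^ p]

/-- Contribution of the elliptic elements of the second kind when `n` is odd; here `ξ` is a
nonsquare in `𝔽_p`. -/
def ellipticTerm2Odd (ξ : ZMod p) : ℂ :=
  let q : ℂ := Fintype.card F
  let ι := algebraMap (ZMod p) F
  1 / 2 * (((q ^ 3 - 1) * (q ^ 2 - 1)) / (p ^ 2 - 1)) *
    ∑ s : ZMod p, ∑ t : (ZMod p)ˣ, horocycle δ f !![ι s, ι (t * ξ); ι t, ι s]

/-- Contribution of the elliptic elements of the second kind, for `q = pⁿ`. -/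
def ellipticTerm2 (n : ℕ) (ξ : ZMod p) : ℂ :=
  if Even n then ellipticTerm2Even p δ f else ellipticTerm2Odd p δ f ξ

end GeometricSide

end

/-! The spectral side is the trace of the operator that `f` defines on `Ind_Γ^G 1`. By complete
reducibility the multiplicities reassemble the irreducible characters into the character of the
induced representation, so the sum is `∑ g, f g * χ(g⁻¹)`. Realizing the induced representation as
the image of the averaging projection on all functions on `G`, one finds that `χ(g)` is `|Γ|⁻¹`
times the number of pairs `(x, γ)` with `γ x g = x`. Interchanging sums gives the pre-trace formula
`spectralSide_eq`: the spectral side is `|Γ|⁻¹ ∑ γ, ∑ s, f(s⁻¹ γ s)`. The inner sum `conjSum f γ`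
equals `|G_γ| I_G(f, γ)`, and grouping the `γ` by `Γ`-classes of size `|Γ| / |Γ_γ|` gives the
geometric side.

For a type whose classes are parametrized `N` to one and have `Γ`-centralizers of common order `k`,
the contribution is `1 / (N k)` times the sum of `conjSum` over the parameters
(`geometricSum_of_param`). Here `N` is 6 for three distinct rational eigenvalues, 3 and 2 for
Frobenius orbits (or the sign of `t`) in the elliptic cases, and 1 otherwise.

The orbital sums rest on the unique factorization of `G` into affine matrices times `K`:
bi-invariance turns a sum over `G` into `q³ - 1` times a sum over affine matrices, and scalars,
being central and in `K`, may be discarded. For `diag(κ, 1)` with `κ - 1` invertible, conjugation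
makes the translation part run over all of `F²`, and what remains is the order of the centralizer of
`κ` times `Hf(κ)` (`conjSum_affineMat`). Transvections and regular unipotents are not of this form
and are summed over the Bruhat cells of `GL₂`. An elliptic element that splits over `F` is reduced
to a diagonal one. An irreducible cubic that stays irreducible over `F` has a conjugate inside `K`.

The eight types are exhaustive by linear algebra over `𝔽_p`. They are disjoint because the rational
roots of the characteristic polynomial, together with the question whether the matrix is scalar or
satisfies a monic quadratic, tell them apart. -/

noncomputable section

/-! ### Irreducible characters and the pre-trace formula. -/

namespace SpectralSide

variable {G : Type*} [Group G]

/-- Irreducibility is invariant under isomorphism of representations. -/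
lemma isIrreducible_of_equiv {V W : Type*} [AddCommGroup V] [Module ℂ V] [AddCommGroup W]
    [Module ℂ W] {ρ : Representation ℂ G V} {σ : Representation ℂ G W} (e : ρ.Equiv σ)
    (h : ρ.IsIrreducible) : σ.IsIrreducible := by
  have key : ∀ g v, e.toLinearEquiv (ρ g v) = σ g (e.toLinearEquiv v) :=
    fun g v => e.toIntertwiningMap.isIntertwining _ _ g v
  refine { exists_pair_ne := ⟨⊥, ⊤, fun hbt => ?_⟩, eq_bot_or_eq_top := fun S => ?_ }
  · obtain ⟨v, hv⟩ : ∃ v : V, v ≠ 0 := by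
      by_contra! h0
      obtain ⟨A, B, hAB⟩ := h.exists_pair_ne
      refine hAB (SetLike.ext fun v => ?_)
      rw [h0 v]
      exact ⟨fun _ => B.toSubmodule.zero_mem, fun _ => A.toSubmodule.zero_mem⟩
    have h1 : e.toLinearEquiv v ∈ (⊤ : Subrepresentation σ) := trivial
    rw [← hbt] at h1
    have h2 : e.toLinearEquiv v = 0 := h1
    exact hv (by simpa using h2)
  · let S' : Subrepresentation ρ :=
      ⟨S.toSubmodule.comap e.toLinearEquiv.toLinearMap, fun g v hv => by
        change e.toLinearEquiv (ρ g v) ∈ S.toSubmodule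
        rw [key]; exact S.apply_mem_toSubmodule g hv⟩
    have hmem : ∀ w, w ∈ S ↔ e.toLinearEquiv.symm w ∈ S' := fun w => by
      change w ∈ S.toSubmodule ↔ e.toLinearEquiv (e.toLinearEquiv.symm w) ∈ S.toSubmodule
      rw [LinearEquiv.apply_symm_apply]
    rcases h.eq_bot_or_eq_top S' with h1 | h1
    · left
      refine SetLike.ext fun w => ?_
      rw [hmem, h1]
      exact e.toLinearEquiv.symm.map_eq_zero_iff
    · right
      refine SetLike.ext fun w => ?_
      rw [hmem, h1]
      exact ⟨fun _ => trivial, fun _ => trivial⟩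

/-- Every finite-dimensional irreducible representation is isomorphic to a model. -/
lemma exists_irrepModel {V : Type*} [AddCommGroup V] [Module ℂ V] [FiniteDimensional ℂ V]
    (ρ : Representation ℂ G V) (h : ρ.IsIrreducible) :
    ∃ π : IrrepModel G, Nonempty (ρ.Equiv π.rep) := by
  let b := (Module.finBasis ℂ V).equivFun
  let σ : Representation ℂ G (Fin (Module.finrank ℂ V) → ℂ) :=
    { toFun := fun g => b.conj (ρ g)
      map_one' := by ext; simp
      map_mul' := fun x y => by rw [map_mul]; ext; simp [LinearEquiv.conj_apply] }
  have e : ρ.Equiv σ := Representation.Equiv.mk b (fun g => by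
    ext v i; simp [σ, LinearEquiv.conj_apply])
  exact ⟨⟨_, σ, isIrreducible_of_equiv e h⟩, ⟨e⟩⟩

/-- The character of a finite-dimensional representation is a sum of irreducible characters. -/
lemma exists_list_character [Fintype G] : ∀ (n : ℕ) {V : Type*} [AddCommGroup V] [Module ℂ V]
    [FiniteDimensional ℂ V] (ρ : Representation ℂ G V), Module.finrank ℂ V = n →
    ∃ l : List (IrrepModel G), ρ.character = (l.map fun π => π.rep.character).sum := by
  intro n
  induction n using Nat.strong_induction_on with
  | _ n ih =>
  intro V _ _ _ ρ hn
  by_cases h0 : Subsingleton V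
  · refine ⟨[], funext fun g => ?_⟩
    have : ρ g = 0 := by ext v; exact Subsingleton.elim _ _
    simp [Representation.character, this]
  by_cases hirr : ρ.IsIrreducible
  · obtain ⟨π, ⟨e⟩⟩ := exists_irrepModel ρ hirr
    exact ⟨[π], by simp [Representation.char_iso e]⟩
  have hnt : Nontrivial (Subrepresentation ρ) := by
    rw [not_subsingleton_iff_nontrivial] at h0
    obtain ⟨v, hv⟩ := exists_ne (0 : V)
    exact ⟨⊥, ⊤, fun h => hv ((SetLike.ext_iff.1 h v).2 trivial)⟩
  obtain ⟨S, hS0, hS1⟩ : ∃ S : Subrepresentation ρ, S ≠ ⊥ ∧ S ≠ ⊤ := by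
    by_contra! h
    exact hirr { eq_bot_or_eq_top := fun S => or_iff_not_imp_left.2 (h S) }
  -- The group order is invertible in `ℂ`, so Maschke's theorem supplies an invariant complement.
  have : NeZero (Nat.card G : ℂ) := ⟨by simp⟩
  obtain ⟨T, hST⟩ := exists_isCompl S
  have hc : IsCompl S.toSubmodule T.toSubmodule := by
    refine IsCompl.of_eq ?_ ?_
    · rw [← Subrepresentation.toSubmodule_inf, hST.inf_eq_bot]; rfl
    · rw [← Subrepresentation.toSubmodule_sup, hST.sup_eq_top]; rfl
  have hadd := Submodule.finrank_add_eq_of_isCompl hc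
  have hS0' : S.toSubmodule ≠ ⊥ := fun h => hS0 (Subrepresentation.toSubmodule_injective h)
  have hS1' : S.toSubmodule ≠ ⊤ := fun h => hS1 (Subrepresentation.toSubmodule_injective h)
  have hSlt := Submodule.finrank_lt hS1'
  have hSpos : 0 < Module.finrank ℂ S.toSubmodule := by
    rw [Module.finrank_pos_iff]
    exact Submodule.nontrivial_iff_ne_bot.2 hS0'
  obtain ⟨l₁, h₁⟩ := ih _ (by omega) S.toRepresentation rfl
  obtain ⟨l₂, h₂⟩ := ih (Module.finrank ℂ T.toSubmodule) (by omega) T.toRepresentation rfl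
  refine ⟨l₁ ++ l₂, ?_⟩
  rw [List.map_append, List.sum_append, ← h₁, ← h₂]
  funext g
  let N : Bool → Submodule ℂ V := fun b => cond b S.toSubmodule T.toSubmodule
  have hint : DirectSum.IsInternal N := by
    rw [DirectSum.isInternal_submodule_iff_isCompl N (i := true) (j := false) (by decide)
      (by ext b; cases b <;> simp)]
    exact hc
  have hmaps : ∀ b, Set.MapsTo (ρ g) (N b) (N b) := by
    intro b
    cases b
    · exact fun v hv => T.apply_mem_toSubmodule g hv
    · exact fun v hv => S.apply_mem_toSubmodule g hv
  have := LinearMap.trace_eq_sum_trace_restrict hint hmaps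
  rw [Fintype.sum_bool] at this
  exact this

/-- The isomorphism class of an irreducible representation. -/
def Irrep.mk (π : IrrepModel G) : Irrep G := Quotient.mk (irrepSetoid G) π

section Finite

variable [Fintype G]

/-- Character orthogonality averages over the group and so divides by its order. -/
instance invertibleCard : Invertible (Nat.card G : ℂ) :=
  invertibleOfNonzero (by simp)

omit [Fintype G] in
lemma Irrep.mk_out (π : Irrep G) : Irrep.mk π.out = π :=
  Quotient.out_eq (s := irrepSetoid G) π

omit [Fintype G] in
lemma Irrep.nonempty_equiv_iff (π σ : IrrepModel G) :
    Nonempty (π.rep.Equiv σ.rep) ↔ Irrep.mk π = Irrep.mk σ :=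
  (Quotient.eq (r := irrepSetoid G)).symm

omit [Fintype G] in
lemma Irrep.character_out_mk (π : IrrepModel G) :
    (Irrep.mk π).out.rep.character = π.rep.character := by
  obtain ⟨e⟩ := (Irrep.nonempty_equiv_iff _ _).2 (Irrep.mk_out (Irrep.mk π))
  exact Representation.char_iso e

open Classical in
-- Schur orthogonality passes to classes because two representatives are isomorphic only if their
-- classes coincide.
lemma character_orthonormal (π σ : Irrep G) :
    (Nat.card G : ℂ)⁻¹ * ∑ g : G, π.out.rep.character g * σ.out.rep.character g⁻¹ =
      if π = σ then 1 else 0 := by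
  have := π.out.irreducible
  have := σ.out.irreducible
  rw [Representation.char_orthonormal]
  simp only [Irrep.nonempty_equiv_iff, Irrep.mk_out, eq_comm]

/-- A finite group has finitely many irreducible complex representations. -/
lemma finite_irrep : Finite (Irrep G) := by
  classical
  -- The functions on `G` form a finite-dimensional space, so independence of the irreducible
  -- characters forces finiteness.
  have hli : LinearIndependent ℂ (fun π : Irrep G => (π.out.rep.character : G → ℂ)) := by
    rw [linearIndependent_iff']
    intro s c hc σ hσ
    -- Pairing a linear relation with the character of `σ` isolates the coefficient of `σ`.
    have h1 : (Nat.card G : ℂ)⁻¹ * ∑ g : G, (∑ π ∈ s, c π • (π.out.rep.character : G → ℂ)) g *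
        σ.out.rep.character g⁻¹ = c σ := by
      simp only [Finset.sum_apply, Pi.smul_apply, smul_eq_mul, Finset.sum_mul]
      rw [Finset.sum_comm, Finset.mul_sum, Finset.sum_eq_single σ]
      · have := character_orthonormal σ σ
        rw [if_pos rfl] at this
        calc _ = c σ * ((Nat.card G : ℂ)⁻¹ * ∑ g : G, σ.out.rep.character g *
              σ.out.rep.character g⁻¹) := by
              simp only [Finset.mul_sum]
              exact Finset.sum_congr rfl fun g _ => by ring
          _ = c σ := by rw [this, mul_one]
      · intro π _ hπ
        have := character_orthonormal π σ
        rw [if_neg hπ] at this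
        calc _ = c π * ((Nat.card G : ℂ)⁻¹ * ∑ g : G, π.out.rep.character g *
              σ.out.rep.character g⁻¹) := by
              simp only [Finset.mul_sum]
              exact Finset.sum_congr rfl fun g _ => by ring
          _ = 0 := by rw [this, mul_zero]
      · exact fun h => absurd hσ h
    rw [hc] at h1
    simpa using h1.symm
  exact hli.finite

/-- Complete reducibility at the level of characters. -/
lemma character_eq_sum_multiplicity [Fintype (Irrep G)] {V : Type*} [AddCommGroup V] [Module ℂ V]
    [FiniteDimensional ℂ V] (ρ : Representation ℂ G V) (g : G) :
    ρ.character g = ∑ π : Irrep G, (multiplicity π.out.rep ρ : ℂ) * π.out.rep.character g := by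
  classical
  obtain ⟨l, hl⟩ := exists_list_character _ ρ rfl
  -- The dimension of the space of intertwining maps is a scalar product of characters; by
  -- orthonormality it counts the constituents in the class `π`.
  have hm : ∀ π : Irrep G, (multiplicity π.out.rep ρ : ℂ) =
      (l.map fun σ => if Irrep.mk σ = π then (1 : ℂ) else 0).sum := by
    intro π
    rw [multiplicity, ← Representation.card_inv_mul_sum_char_mul_char_eq_finrank, hl]
    have : ∀ l : List (IrrepModel G), (Nat.card G : ℂ)⁻¹ *
        ∑ g : G, ((l.map fun σ : IrrepModel G => σ.rep.character).sum) g * π.out.rep.character g⁻¹ =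
        (l.map fun σ => if Irrep.mk σ = π
          then (1 : ℂ) else 0).sum := by
      intro l
      induction l with
      | nil => simp
      | cons σ l ih =>
        simp only [List.map_cons, List.sum_cons, Pi.add_apply, add_mul, Finset.sum_add_distrib,
          mul_add, ih]
        congr 1
        rw [← character_orthonormal]
        congr 1
        refine Finset.sum_congr rfl fun g _ => ?_
        rw [Irrep.character_out_mk]
    exact this l
  simp_rw [hm, hl]
  clear hm hl
  induction l with
  | nil => simp
  | cons σ l ih =>
    simp only [List.map_cons, List.sum_cons, Pi.add_apply, add_mul, Finset.sum_add_distrib, ih]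
    congr 1
    simp only [ite_mul, one_mul, zero_mul, Finset.sum_ite_eq, Finset.mem_univ, if_true]
    rw [Irrep.character_out_mk]

variable {Γ : Type*} [Group Γ] [Fintype Γ] (ι : Γ →* G)

/-- Averaging over `Γ` projects functions on `G` onto the induced representation. -/
def averageProj : (G → ℂ) →ₗ[ℂ] (G → ℂ) where
  toFun φ x := (Nat.card Γ : ℂ)⁻¹ * ∑ γ : Γ, φ (ι γ * x)
  map_add' φ ψ := by ext x; simp [Finset.sum_add_distrib, mul_add]
  map_smul' c φ := by ext x; simp [← Finset.mul_sum, mul_left_comm]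

omit [Fintype G] in
lemma averageProj_mem (φ : G → ℂ) :
    averageProj ι φ ∈ Representation.coindV ι (Representation.trivial ℂ Γ ℂ) := by
  intro γ x
  simp only [averageProj, LinearMap.coe_mk, AddHom.coe_mk, Representation.isTrivial_def,
    LinearMap.id_coe, id_eq]
  congr 1
  refine Fintype.sum_equiv (Equiv.mulRight γ) _ _ fun γ' => ?_
  simp [mul_assoc]

omit [Fintype G] in
lemma averageProj_of_mem (φ : G → ℂ)
    (h : φ ∈ Representation.coindV ι (Representation.trivial ℂ Γ ℂ)) : averageProj ι φ = φ := by
  ext x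
  have h' : ∀ γ, φ (ι γ * x) = φ x := fun γ => by simpa using h γ x
  simp [averageProj, h']

open Classical in
/-- The character of the induced representation. -/
lemma character_inducedTrivial (g : G) :
    (inducedTrivial ι).character g =
      (Nat.card Γ : ℂ)⁻¹ * ∑ x : G, ∑ γ : Γ, if ι γ * x * g = x then 1 else 0 := by
  set V := Representation.coindV ι (Representation.trivial ℂ Γ ℂ) with hV
  let P : (G → ℂ) →ₗ[ℂ] V := (averageProj ι).codRestrict V (averageProj_mem ι)
  let R : (G → ℂ) →ₗ[ℂ] (G → ℂ) := LinearMap.funLeft ℂ ℂ (· * g)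
  -- The projection fixes invariant functions, so composing with it changes nothing here. Cyclicity
  -- of the trace then moves the computation to all functions on `G`, where the delta functions form
  -- a basis and the diagonal entry at `x` counts the `γ` with `γ x g = x`.
  have h1 : (inducedTrivial ι) g = (P ∘ₗ R) ∘ₗ V.subtype := by
    ext φ x
    have := averageProj_of_mem ι _ ((inducedTrivial ι) g φ).2
    exact (congrFun this x).symm
  have h2 : V.subtype ∘ₗ (P ∘ₗ R) = averageProj ι ∘ₗ R := rfl
  rw [Representation.character, h1, LinearMap.trace_comp_comm', h2,
    LinearMap.trace_eq_matrix_trace ℂ (Pi.basisFun ℂ G), Matrix.trace, Finset.mul_sum]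
  refine Finset.sum_congr rfl fun x _ => ?_
  simp [averageProj, R, Pi.single_apply]

end Finite

variable [Fintype G] {Γ : Type*} [Group Γ] [Fintype Γ] (ι : Γ →* G)

/-- The sum of `f` over all conjugates `s⁻¹ x s`, `s ∈ G`. -/
def conjSum (f : G → ℂ) (x : G) : ℂ := ∑ s : G, f (s⁻¹ * x * s)

lemma conjSum_conj (f : G → ℂ) (x y : G) : conjSum f (y * x * y⁻¹) = conjSum f x :=
  Fintype.sum_equiv (Equiv.mulLeft y⁻¹) _ _ fun s => by simp [mul_assoc]

lemma conjSum_of_isConj (f : G → ℂ) {x y : G} (h : IsConj x y) : conjSum f x = conjSum f y := by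
  obtain ⟨c, rfl⟩ := isConj_iff.1 h
  exact (conjSum_conj f x c).symm

/-- The pre-trace formula. -/
lemma spectralSide_eq (f : G → ℂ) :
    spectralSide ι f = (Nat.card Γ : ℂ)⁻¹ * ∑ γ : Γ, conjSum f (ι γ) := by
  classical
  have := finite_irrep (G := G)
  have := Fintype.ofFinite (Irrep G)
  have htr : ∀ π : Irrep G, LinearMap.trace ℂ _ (fourier f π.out.rep) =
      ∑ g : G, f g * π.out.rep.character g⁻¹ := fun π => by
    simp [fourier, Representation.character]
  rw [spectralSide, finsum_eq_sum_of_fintype]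
  simp_rw [htr, Finset.mul_sum]
  rw [Finset.sum_comm]
  have h1 : ∀ g : G, ∑ π : Irrep G, (multiplicity π.out.rep (inducedTrivial ι) : ℂ) *
      (f g * π.out.rep.character g⁻¹) = f g * (inducedTrivial ι).character g⁻¹ := fun g => by
    rw [character_eq_sum_multiplicity, Finset.mul_sum]
    exact Finset.sum_congr rfl fun π _ => by ring
  simp_rw [h1, character_inducedTrivial, mul_left_comm (f _), ← Finset.mul_sum]
  congr 1
  simp_rw [Finset.mul_sum, conjSum]
  rw [Finset.sum_comm, Finset.sum_comm (s := (Finset.univ : Finset Γ))]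
  refine Finset.sum_congr rfl fun x _ => ?_
  rw [Finset.sum_comm]
  refine Finset.sum_congr rfl fun γ _ => ?_
  -- For given `x` and `γ`, the equation `γ x g⁻¹ = x` has the single solution `g = x⁻¹ γ x`.
  rw [Finset.sum_eq_single (x⁻¹ * ι γ * x)]
  · simp [mul_assoc]
  · intro g _ hg
    rw [if_neg, mul_zero]
    intro h
    apply hg
    rw [mul_inv_eq_iff_eq_mul] at h
    rw [mul_assoc, h, inv_mul_cancel_left]
  · simp

end SpectralSide

/-! ### Orbital sums, class sizes and the sum over conjugacy classes. -/

namespace SpectralSide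

variable {G : Type*} [Group G] [Fintype G]

/-- The conjugators carrying `x` to a given conjugate form a coset of the centralizer. -/
lemma card_conjugators [DecidableEq G] (x g₀ : G) :
    Finset.card {g : G | g⁻¹ * x * g = g₀⁻¹ * x * g₀} =
      Nat.card (Subgroup.centralizer ({x} : Set G)) := by
  classical
  rw [Nat.card_eq_fintype_card, ← Finset.card_univ]
  symm
  refine Finset.card_bij (fun h _ => (h : G) * g₀) ?_ ?_ ?_
  · rintro ⟨h, hh⟩ -
    have hh' : x * h = h * x := (Subgroup.mem_centralizer_singleton_iff.1 hh).symm
    simp only [Finset.mem_filter, Finset.mem_univ, true_and]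
    simp only [mul_inv_rev, mul_assoc, mul_right_inj]
    rw [← mul_assoc x, hh', mul_assoc, inv_mul_cancel_left]
  · rintro ⟨h, _⟩ - ⟨h', _⟩ - e
    exact Subtype.ext (mul_right_cancel e)
  · intro g hg
    simp only [Finset.mem_filter, Finset.mem_univ, true_and] at hg
    refine ⟨⟨g * g₀⁻¹, ?_⟩, Finset.mem_univ _, by simp⟩
    rw [Subgroup.mem_centralizer_singleton_iff]
    have : x * g = g * (g₀⁻¹ * x * g₀) := by rw [← hg]; group
    rw [← mul_assoc, this]
    group

/-- Summing over conjugators amounts to summing over the conjugacy class. -/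
lemma sum_conj_eq [DecidableEq G] (x : G) [DecidablePred (IsConj x)] (φ : G → ℂ) :
    ∑ g : G, φ (g⁻¹ * x * g) =
      Nat.card (Subgroup.centralizer ({x} : Set G)) * ∑ y : G with IsConj x y, φ y := by
  rw [← Finset.sum_fiberwise_of_maps_to (t := ({y | IsConj x y} : Finset G))
    (g := fun g => g⁻¹ * x * g), Finset.mul_sum]
  · refine Finset.sum_congr rfl fun y hy => ?_
    obtain ⟨c, hc⟩ := isConj_iff.1 (Finset.mem_filter.1 hy).2
    have hy' : y = (c⁻¹)⁻¹ * x * c⁻¹ := by rw [← hc, inv_inv]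
    rw [Finset.sum_congr rfl (g := fun _ => φ y) (fun g hg => by rw [(Finset.mem_filter.1 hg).2]),
      Finset.sum_const, nsmul_eq_mul, ← card_conjugators x c⁻¹, hy']
  · intro g _
    simp only [Finset.mem_filter, Finset.mem_univ, true_and]
    exact isConj_iff.2 ⟨g⁻¹, by simp⟩

/-- Orbit–stabilizer, as the case of the constant function 1 in `sum_conj_eq`. -/
lemma card_centralizer_mul_card_class [DecidableEq G] (x : G) [DecidablePred (IsConj x)] :
    (Nat.card (Subgroup.centralizer ({x} : Set G)) : ℂ) *
      (Finset.card {y : G | IsConj x y} : ℂ) = Nat.card G := by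
  have := sum_conj_eq x (fun _ => (1 : ℂ))
  simp only [Finset.sum_const, nsmul_eq_mul, mul_one] at this
  rw [← this]
  simp

omit [Fintype G] in
-- The conjugate `s⁻¹ x s` depends only on the coset of `s` and determines it, so the
-- representatives chosen in `orbitalSum` are immaterial.
lemma rightRel_iff_conj_eq (x s t : G) :
    (QuotientGroup.rightRel (Subgroup.centralizer ({x} : Set G))).r s t ↔
      s⁻¹ * x * s = t⁻¹ * x * t := by
  rw [QuotientGroup.rightRel_apply, Subgroup.mem_centralizer_singleton_iff]
  constructor
  · intro h
    have h1 : x = (t * s⁻¹)⁻¹ * x * (t * s⁻¹) := by rw [mul_assoc, ← h]; group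
    conv_lhs => rw [h1]
    group
  · intro h
    have h1 : x * s = s * (t⁻¹ * x * t) := by rw [← h]; group
    have h2 : x = s * (t⁻¹ * x * t) * s⁻¹ := by rw [← h1]; group
    conv_lhs => rw [h2]
    group

/-- Each coset repeats one value as often as the centralizer has elements. The weight `|G_γ|` of the
trace formula thus unfolds the orbital sum to a sum over the whole group, which is what all later
computations use. -/
lemma card_centralizer_mul_orbitalSum (f : G → ℂ) (x : G) :
    (Nat.card (Subgroup.centralizer ({x} : Set G)) : ℂ) * orbitalSum f x = conjSum f x := by
  classical
  rw [orbitalSum, conjSum, ← Finset.sum_fiberwise_of_maps_to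
    (g := fun s : G => (Quotient.mk (QuotientGroup.rightRel (Subgroup.centralizer ({x} : Set G))) s))
    (t := Finset.univ) (fun _ _ => Finset.mem_univ _), Finset.mul_sum]
  refine Finset.sum_congr rfl fun c _ => ?_
  have key : ∀ s : G, Quotient.mk (QuotientGroup.rightRel (Subgroup.centralizer ({x} : Set G))) s
      = c ↔ s⁻¹ * x * s = c.out⁻¹ * x * c.out := by
    intro s
    conv_lhs => rw [← Quotient.out_eq c]
    exact Quotient.eq.trans (rightRel_iff_conj_eq x s c.out)
  simp_rw [key]
  rw [Finset.sum_congr rfl (g := fun _ => f (c.out⁻¹ * x * c.out))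
    (fun g hg => by rw [(Finset.mem_filter.1 hg).2]), Finset.sum_const, nsmul_eq_mul,
    ← card_conjugators x c.out]

variable {Γ : Type*} [Group Γ] [Fintype Γ] (ι : Γ →* G)

/-- The chosen representative of a conjugacy class. -/
def classRep (c : ConjClasses Γ) : Γ := Quotient.out c

omit [Fintype Γ] in
lemma mk_classRep (c : ConjClasses Γ) : ConjClasses.mk (classRep c) = c := Quotient.out_eq c

omit [Fintype Γ] in
lemma isConj_classRep_iff (c : ConjClasses Γ) (γ : Γ) :
    IsConj (classRep c) γ ↔ ConjClasses.mk γ = c := by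
  rw [← ConjClasses.mk_eq_mk_iff_isConj, mk_classRep, eq_comm]

open Classical in
lemma geometricSum_eq (T : Γ → Prop) (f : G → ℂ) :
    geometricSum ι T f = ∑ c : ConjClasses Γ, if T (classRep c) then
      conjSum f (ι (classRep c)) /
        (Nat.card (Subgroup.centralizer ({classRep c} : Set Γ)) : ℂ) else 0 := by
  refine (Finset.sum_filter _ _).trans (Finset.sum_congr rfl fun c _ => ?_)
  rw [← card_centralizer_mul_orbitalSum, mul_div_right_comm]
  rfl

/-- Conjugate elements share one class, and its size cancels from the orbit–stabilizer identity. -/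
lemma card_centralizer_eq_of_isConj {x y : Γ} (hxy : IsConj x y) :
    Nat.card (Subgroup.centralizer ({x} : Set Γ)) =
      Nat.card (Subgroup.centralizer ({y} : Set Γ)) := by
  classical
  have h1 := card_centralizer_mul_card_class x
  have h2 := card_centralizer_mul_card_class y
  have h3 : (Finset.univ.filter fun z => IsConj x z) = Finset.univ.filter fun z => IsConj y z :=
    Finset.filter_congr fun z _ => ⟨hxy.symm.trans, hxy.trans⟩
  rw [h3, ← h2] at h1
  have h4 : ((Finset.card {z : Γ | IsConj y z} : ℕ) : ℂ) ≠ 0 :=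
    Nat.cast_ne_zero.2 (Finset.card_pos.2 ⟨y, Finset.mem_filter.2
      ⟨Finset.mem_univ _, IsConj.refl y⟩⟩).ne'
  exact_mod_cast mul_right_cancel₀ h4 h1

lemma card_centralizer_ne_zero (γ : Γ) :
    (Nat.card (Subgroup.centralizer ({γ} : Set Γ)) : ℂ) ≠ 0 :=
  Nat.cast_ne_zero.2 Nat.card_pos.ne.symm

/-- The sum over all conjugacy classes is the average over the group. -/
lemma geometricSum_true (f : G → ℂ) :
    geometricSum ι (fun _ => True) f = (Nat.card Γ : ℂ)⁻¹ * ∑ γ : Γ, conjSum f (ι γ) := by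
  classical
  rw [geometricSum_eq, ← Finset.sum_fiberwise_of_maps_to (g := fun γ : Γ => ConjClasses.mk γ)
    (t := Finset.univ) (fun _ _ => Finset.mem_univ _), Finset.mul_sum]
  simp only [if_true]
  refine Finset.sum_congr rfl fun c _ => ?_
  have h1 : ∀ γ ∈ ({γ | ConjClasses.mk γ = c} : Finset Γ),
      conjSum f (ι γ) = conjSum f (ι (classRep c)) := fun γ hγ => by
    refine (conjSum_of_isConj f (ι.map_isConj ?_)).symm
    exact (isConj_classRep_iff c γ).2 (Finset.mem_filter.1 hγ).2
  have h2 := card_centralizer_mul_card_class (classRep c)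
  simp_rw [isConj_classRep_iff] at h2
  rw [Finset.sum_congr rfl h1, Finset.sum_const, nsmul_eq_mul, ← h2]
  have h3 := card_centralizer_ne_zero (classRep c)
  have h4 : ((Finset.card {γ : Γ | ConjClasses.mk γ = c} : ℕ) : ℂ) ≠ 0 := by
    refine Nat.cast_ne_zero.2 (Finset.card_pos.2 ⟨classRep c, ?_⟩).ne'
    simp only [Finset.mem_filter, Finset.mem_univ, true_and]
    exact mk_classRep c
  field_simp

/-- The contribution of a type of conjugacy classes, from an `N`-to-one parametrization of the
classes of that type whose members all have centralizers of the same order. -/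
lemma geometricSum_of_param {M : Type*} [Fintype M] (r : M → Γ) (T : Γ → Prop) (N : ℕ) (k : ℂ)
    (hN : N ≠ 0) (hT : ∀ γ, T γ → ∃ m, IsConj (r m) γ) (hr : ∀ m γ, IsConj (r m) γ → T γ)
    (hcount : ∀ m, Nat.card {m' // IsConj (r m) (r m')} = N)
    (hk : ∀ m, (Nat.card (Subgroup.centralizer ({r m} : Set Γ)) : ℂ) = k) (f : G → ℂ) :
    geometricSum ι T f = 1 / (N * k) * ∑ m : M, conjSum f (ι (r m)) := by
  classical
  rw [geometricSum_eq, ← Finset.sum_filter,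
    ← Finset.sum_fiberwise_of_maps_to (g := fun m : M => ConjClasses.mk (r m))
      (t := Finset.univ.filter fun c : ConjClasses Γ => T (classRep c)) (fun m _ => by
      simpa using hr m _ ((isConj_classRep_iff _ _).2 rfl).symm), Finset.mul_sum]
  refine Finset.sum_congr rfl fun c hc => ?_
  obtain ⟨m, hm⟩ := hT _ (Finset.mem_filter.1 hc).2
  have h1 : ∀ m' ∈ ({m' | ConjClasses.mk (r m') = c} : Finset M),
      conjSum f (ι (r m')) = conjSum f (ι (classRep c)) := fun m' hm' => by
    refine (conjSum_of_isConj f (ι.map_isConj ?_)).symm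
    exact (isConj_classRep_iff c _).2 (Finset.mem_filter.1 hm').2
  -- Every fibre over a class of the type has `N` elements, all with the same orbital sum; this
  -- cancels the `N` in the denominator.
  have h2 : Finset.card {m' | ConjClasses.mk (r m') = c} = N := by
    rw [← hcount m, Nat.card_eq_fintype_card, Fintype.card_subtype]
    congr 1
    refine Finset.filter_congr fun m' _ => ?_
    rw [← isConj_classRep_iff]
    exact ⟨hm.trans, hm.symm.trans⟩
  have h3 := card_centralizer_ne_zero (classRep c)
  have h4 : (N : ℂ) ≠ 0 := Nat.cast_ne_zero.2 hN
  rw [Finset.sum_congr rfl h1, Finset.sum_const, nsmul_eq_mul, h2, ← hk m,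
    card_centralizer_eq_of_isConj hm]
  field_simp

/-- If every class is of exactly one of finitely many types, the total is the sum over types. -/
lemma geometricSum_partition {I : Type*} [Fintype I] (T : I → Γ → Prop)
    (hT : ∀ γ, ∃! i, T i γ) (f : G → ℂ) :
    geometricSum ι (fun _ => True) f = ∑ i, geometricSum ι (T i) f := by
  classical
  simp_rw [geometricSum_eq]
  rw [Finset.sum_comm]
  refine Finset.sum_congr rfl fun c _ => ?_
  obtain ⟨i, hi, hi'⟩ := hT (classRep c)
  rw [Finset.sum_eq_single i]
  · simp [hi]
  · intro j _ hj
    rw [if_neg fun h => hj (hi' j h)]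
  · simp

end SpectralSide

namespace UpperHalfSpace

open SpectralSide

variable {F : Type*} [Field F]

/-! ### The stabilizer of the base point -/

/-- The coordinates of `F(δ^{1/3})` with respect to `δ^{2/3}, δ^{1/3}, 1`. -/
def coordEquiv (δ : F) : CubicExt δ ≃ₗ[F] (Fin 3 → F) where
  toFun α := ![coord δ 2 α, coord δ 1 α, coord δ 0 α]
  map_add' α β := by ext i; fin_cases i <;> simp
  map_smul' c α := by ext i; fin_cases i <;> simp
  invFun v := ofCoords δ (v 2) (v 1) (v 0)
  left_inv α := by simp [ofCoords_coord]
  right_inv v := by ext i; fin_cases i <;> simp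

lemma coordEquiv_ofCoords (δ a b c : F) : coordEquiv δ (ofCoords δ a b c) = ![c, b, a] := by
  simp [coordEquiv]

/-- The basis `δ^{2/3}, δ^{1/3}, 1` of `F(δ^{1/3})`. -/
def cubicBasis (δ : F) : Module.Basis (Fin 3) F (CubicExt δ) := Module.Basis.ofEquivFun (coordEquiv δ)

lemma theta_mul_ofCoords (δ a b c : F) :
    theta δ * ofCoords δ a b c = ofCoords δ (c * δ) a b := by
  simp only [ofCoords, map_mul]
  linear_combination algebraMap F (CubicExt δ) c * theta_cube δ

lemma cubicBasis_apply (δ : F) (i : Fin 3) : cubicBasis δ i = ![theta δ ^ 2, theta δ, 1] i := by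
  rw [cubicBasis, Module.Basis.coe_ofEquivFun]
  fin_cases i <;> simp [coordEquiv, ofCoords]

/-- The matrix by which multiplication acts on the column `(δ^{2/3}, δ^{1/3}, 1)`. -/
def mulMat (δ : F) : CubicExt δ →ₐ[F] Matrix (Fin 3) (Fin 3) F :=
  -- The points of the half-space are columns acted on by rows, whence the transpose. It reverses
  -- products, which is harmless because the field is commutative.
  AlgHom.ofLinearMap ((Matrix.transposeLinearEquiv (Fin 3) (Fin 3) F F).toLinearMap.comp
    (Algebra.leftMulMatrix (cubicBasis δ)).toLinearMap) (by simp) (fun x y => by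
      simp [mul_comm x y, Matrix.transpose_mul])

lemma mulMat_apply (δ : F) (α : CubicExt δ) (i j : Fin 3) :
    mulMat δ α i j = coordEquiv δ (α * cubicBasis δ i) j := by
  simp [mulMat, Algebra.leftMulMatrix_eq_repr_mul, cubicBasis]

lemma mulMat_injective (δ : F) : Function.Injective (mulMat δ) := by
  intro α β h
  refine (coordEquiv δ).injective (funext fun j => ?_)
  -- The last row belongs to the basis vector 1 and lists the coordinates of the element itself.
  have := congrFun (congrFun h 2) j
  simpa [mulMat_apply, cubicBasis_apply] using this

lemma mulMat_ofCoords (δ a b c : F) :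
    mulMat δ (ofCoords δ a b c) = !![a, c * δ, b * δ; b, a, c * δ; c, b, a] := by
  have h1 : ofCoords δ a b c * theta δ = ofCoords δ (c * δ) a b := by
    rw [mul_comm, theta_mul_ofCoords]
  have h2 : ofCoords δ a b c * theta δ ^ 2 = ofCoords δ (b * δ) (c * δ) a := by
    rw [sq, ← mul_assoc, h1, mul_comm, theta_mul_ofCoords]
  ext i j
  rw [mulMat_apply, cubicBasis_apply]
  fin_cases i <;> fin_cases j <;> simp [h1, h2, coordEquiv_ofCoords]

variable {δ : F} [hδ : Fact (∀ x : F, x ^ 3 ≠ δ)]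

/-- With `K` seen as multiplication matrices, powers and polynomial equations in `K` can be handled
inside the cubic field. -/
lemma mem_K_iff_mulMat (g : GL (Fin 3) F) : g ∈ K δ ↔ ∃ α : CubicExt δ, g.1 = mulMat δ α := by
  rw [mem_K_iff]
  constructor
  · rintro ⟨a, b, c, h⟩
    exact ⟨ofCoords δ a b c, by rw [h, mulMat_ofCoords]⟩
  · rintro ⟨α, h⟩
    refine ⟨coord δ 0 α, coord δ 1 α, coord δ 2 α, ?_⟩
    rw [h, ← mulMat_ofCoords, ofCoords_coord]

variable (δ) in
/-- The isomorphism `F(δ^{1/3})ˣ ≃ K`. -/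
def unitsEquivK : (CubicExt δ)ˣ ≃ K δ :=
  Equiv.ofBijective (fun u => ⟨Units.map (mulMat δ : CubicExt δ →* _) u,
    (mem_K_iff_mulMat _).2 ⟨u, rfl⟩⟩) <| by
    constructor
    · intro u v h
      have := congrArg (fun k : K δ => k.1.1) h
      exact Units.ext (mulMat_injective δ this)
    · rintro ⟨g, hg⟩
      obtain ⟨α, hα⟩ := (mem_K_iff_mulMat g).1 hg
      have h0 : α ≠ 0 := by
        rintro rfl
        rw [map_zero] at hα
        exact not_isUnit_zero (hα ▸ g.isUnit)
      exact ⟨Units.mk0 α h0, Subtype.ext (Units.ext hα.symm)⟩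

lemma unitsEquivK_val (u : (CubicExt δ)ˣ) : (unitsEquivK δ u).1.1 = mulMat δ u := rfl

omit hδ in
lemma card_cubicExt [Fintype F] : Nat.card (CubicExt δ) = Fintype.card F ^ 3 := by
  rw [Nat.card_congr (coordEquiv δ).toEquiv]
  simp

instance finite_cubicExt [Finite F] (δ : F) : Finite (CubicExt δ) :=
  Finite.of_equiv _ (coordEquiv δ).toEquiv.symm

lemma card_K [Fintype F] : Nat.card (K δ) = Fintype.card F ^ 3 - 1 := by
  rw [← Nat.card_congr (unitsEquivK δ), Nat.card_units, card_cubicExt]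

/-! ### Reduction to affine matrices -/

omit hδ in
lemma affineMat_injective {ξ ξ' : GL (Fin 2) F} {x y x' y' : F}
    (h : affineMat ξ x y = affineMat ξ' x' y') : ξ = ξ' ∧ x = x' ∧ y = y' := by
  have h1 : ∀ i j, (affineMat ξ x y).1 i j = (affineMat ξ' x' y').1 i j := fun i j => by rw [h]
  simp only [affineMat_val] at h1
  refine ⟨Matrix.GeneralLinearGroup.ext fun i j => ?_, ?_, ?_⟩
  · fin_cases i <;> fin_cases j
    · simpa using h1 0 0
    · simpa using h1 0 1
    · simpa using h1 1 0
    · simpa using h1 1 1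
  · simpa using h1 0 2
  · simpa using h1 1 2

omit hδ in
lemma affineMat_mul (ξ ξ' : GL (Fin 2) F) (x y x' y' : F) :
    affineMat ξ x y * affineMat ξ' x' y' = affineMat (ξ * ξ')
      (ξ.1 0 0 * x' + ξ.1 0 1 * y' + x) (ξ.1 1 0 * x' + ξ.1 1 1 * y' + y) := by
  apply Units.ext
  rw [Units.val_mul, affineMat_val, affineMat_val, affineMat_val]
  ext i j
  fin_cases i <;> fin_cases j <;>
    simp [Matrix.mul_apply, Fin.sum_univ_three, Fin.sum_univ_two]

omit hδ in
lemma Hq.toAffine_eq {z : Hq δ} : ∃ ξ x y, z.toAffine = affineMat ξ x y := ⟨_, _, _, rfl⟩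

/-- Together with `Hq.toAffine_smul` this says that the affine group acts simply transitively on the
half-space; it is the uniqueness half of the factorization through `K`. -/
lemma toAffine_affineMat_smul (ξ : GL (Fin 2) F) (x y : F) :
    (affineMat ξ x y • basePoint δ).toAffine = affineMat ξ x y := by
  have hv : (affineMat ξ x y • basePoint δ).1 =
      (ofCoords δ x (ξ.1 0 1) (ξ.1 0 0), ofCoords δ y (ξ.1 1 1) (ξ.1 1 0)) := by
    change (rowForm (affineMat ξ x y) (basePoint δ).1 0 / rowForm (affineMat ξ x y) (basePoint δ).1 2,
      rowForm (affineMat ξ x y) (basePoint δ).1 1 / rowForm (affineMat ξ x y) (basePoint δ).1 2) = _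
    refine Prod.ext ?_ ?_ <;>
      · simp [rowForm, affineMat_val, basePoint, Hq.point, ofCoords]
        ring
  apply Units.ext
  rw [Hq.toAffine_val, hv, affineMat_val]
  simp

/-- Every element of `G` is uniquely the product of an affine matrix and an element of `K`. -/
lemma bijective_affineMat_mul : Function.Bijective
    (fun a : (GL (Fin 2) F × F × F) × K δ => affineMat a.1.1 a.1.2.1 a.1.2.2 * a.2.1) := by
  have hk : ∀ k : K δ, k.1 • basePoint δ = basePoint δ := fun k => k.2
  constructor
  · rintro ⟨⟨ξ, x, y⟩, k⟩ ⟨⟨ξ', x', y'⟩, k'⟩ h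
    -- Applying both products to the base point removes the factors from `K`.
    have h1 := congrArg (fun g : GL (Fin 3) F => (g • basePoint δ).toAffine) h
    simp only [mul_smul, hk, toAffine_affineMat_smul] at h1
    obtain ⟨rfl, rfl, rfl⟩ := affineMat_injective h1
    simp only [mul_right_inj] at h
    rw [Subtype.ext h]
  · intro g
    obtain ⟨ξ, x, y, h⟩ := Hq.toAffine_eq (z := g • basePoint δ)
    refine ⟨⟨⟨ξ, x, y⟩, ⟨(affineMat ξ x y)⁻¹ * g, ?_⟩⟩, by simp⟩
    rw [K, MulAction.mem_stabilizer_iff, mul_smul, inv_smul_eq_iff, ← h, Hq.toAffine_smul]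

variable [Fintype F] [DecidableEq F]

/-- Writing `s = a k` with `a` affine and `k` in `K`, bi-invariance removes `k` from `f(k⁻¹ a⁻¹ g a
k)`, so every affine `a` is counted `|K| = q³ - 1` times. -/
lemma conjSum_eq_affine {f : GL (Fin 3) F → ℂ} (hf : BiInvariant δ f) (g : GL (Fin 3) F) :
    conjSum f g = ((Fintype.card F : ℂ) ^ 3 - 1) * ∑ ξ : GL (Fin 2) F, ∑ x : F, ∑ y : F,
      f ((affineMat ξ x y)⁻¹ * g * affineMat ξ x y) := by
  classical
  rw [conjSum, ← Fintype.sum_bijective _ (bijective_affineMat_mul (δ := δ)) (fun a =>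
    f ((affineMat a.1.1 a.1.2.1 a.1.2.2)⁻¹ * g * affineMat a.1.1 a.1.2.1 a.1.2.2)) _ ?_,
    Fintype.sum_prod_type_right]
  · simp only [Finset.sum_const, nsmul_eq_mul, Fintype.sum_prod_type]
    congr 1
    rw [Finset.card_univ, ← Nat.card_eq_fintype_card, card_K, Nat.cast_sub]
    · simp
    · exact Nat.one_le_pow _ _ Fintype.card_pos
  · intro a
    rw [← hf _ (inv_mem a.2.2) _ a.2.2]
    simp [mul_assoc]

/-- A nonzero scalar matrix. -/
def scalarGL {n : ℕ} {F : Type*} [Field F] (c : Fˣ) : GL (Fin n) F :=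
  Units.map (Matrix.scalar (Fin n) : F →+* Matrix (Fin n) (Fin n) F).toMonoidHom c

omit hδ [Fintype F] [DecidableEq F] in
lemma scalarGL_val {n : ℕ} (c : Fˣ) : (scalarGL c : GL (Fin n) F).1 = (c : F) • 1 := by
  simp [scalarGL, Matrix.smul_one_eq_diagonal]

omit hδ [Fintype F] [DecidableEq F] in
lemma scalarGL_comm {n : ℕ} (c : Fˣ) (g : GL (Fin n) F) : scalarGL c * g = g * scalarGL c := by
  apply Units.ext
  simp [scalarGL_val]

omit [Fintype F] [DecidableEq F] in
lemma scalarGL_mem_K (c : Fˣ) : scalarGL c ∈ K δ := by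
  rw [mem_K_iff_mulMat]
  refine ⟨algebraMap F _ c, ?_⟩
  rw [AlgHom.commutes, scalarGL_val, Algebra.algebraMap_eq_smul_one]

/-- A scalar commutes past `s` and is then absorbed by `K`. Hence an element may be rescaled until
one chosen eigenvalue is 1, which brings it into affine form. -/
lemma conjSum_scalar_mul {f : GL (Fin 3) F → ℂ} (hf : BiInvariant δ f) (c : Fˣ)
    (g : GL (Fin 3) F) : conjSum f (scalarGL c * g) = conjSum f g := by
  refine Finset.sum_congr rfl fun s _ => ?_
  rw [← mul_assoc, ← scalarGL_comm, mul_assoc, mul_assoc, ← mul_assoc s⁻¹]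
  have := hf _ (scalarGL_mem_K c) 1 (one_mem _) (s⁻¹ * g * s)
  rwa [mul_one] at this

/-! ### Orbital sums of block matrices and the horocycle transform. -/

open GeometricSide

omit [Fintype F] [DecidableEq F] in
lemma onHq_affineMat (f : GL (Fin 3) F → ℂ) (ξ : GL (Fin 2) F) (x y : F) :
    onHq f (affineMat ξ x y • basePoint δ) = f (affineMat ξ x y) := by
  rw [onHq, toAffine_affineMat_smul]

omit [DecidableEq F] in
/-- An invertible `2 × 2` matrix acts bijectively on pairs. -/
lemma sum_linear_change {a b c d : F} (h : a * d - b * c ≠ 0) (φ : F → F → ℂ) :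
    ∑ x : F, ∑ y : F, φ (a * x + b * y) (c * x + d * y) = ∑ x : F, ∑ y : F, φ x y := by
  rw [← Fintype.sum_prod_type' φ,
    ← Fintype.sum_prod_type' (fun x y => φ (a * x + b * y) (c * x + d * y))]
  refine Fintype.sum_bijective (fun v : F × F => (a * v.1 + b * v.2, c * v.1 + d * v.2)) ?_ _ _
    fun _ => rfl
  rw [← Finite.injective_iff_bijective]
  rintro ⟨x, y⟩ ⟨x', y'⟩ e
  simp only [Prod.mk.injEq] at e
  obtain ⟨e1, e2⟩ := e
  refine Prod.ext (mul_left_cancel₀ h ?_) (mul_left_cancel₀ h ?_)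
  · linear_combination d * e1 - b * e2
  · linear_combination a * e2 - c * e1

omit hδ [Fintype F] [DecidableEq F] in
/-- Conjugation of an affine matrix by an affine matrix, in terms of the translation parts. -/
lemma affineMat_conj (κ ξ : GL (Fin 2) F) (u v x y x' y' : F)
    (hx : κ.1 0 0 * x + κ.1 0 1 * y + u - x = ξ.1 0 0 * x' + ξ.1 0 1 * y')
    (hy : κ.1 1 0 * x + κ.1 1 1 * y + v - y = ξ.1 1 0 * x' + ξ.1 1 1 * y') :
    (affineMat ξ x y)⁻¹ * affineMat κ u v * affineMat ξ x y = affineMat (ξ⁻¹ * κ * ξ) x' y' := by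
  rw [mul_assoc, inv_mul_eq_iff_eq_mul, affineMat_mul, affineMat_mul]
  have h1 : ξ * (ξ⁻¹ * κ * ξ) = κ * ξ := by group
  rw [h1]
  congr 1
  · linear_combination hx
  · linear_combination hy

omit hδ [Fintype F] [DecidableEq F] in
lemma inv_det_ne_zero (ξ : GL (Fin 2) F) :
    ξ.1 0 0 * ξ.1 1 1 - ξ.1 0 1 * ξ.1 1 0 ≠ 0 := by
  have h := (Matrix.isUnits_det_units ξ).ne_zero
  rwa [Matrix.det_fin_two] at h

/-- The orbital sum of a block matrix `diag(κ, 1)` for which `1` is not an eigenvalue of `κ`. -/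
lemma conjSum_affineMat {f : GL (Fin 3) F → ℂ} (hf : BiInvariant δ f) (κ : GL (Fin 2) F)
    (hκ : (κ.1 0 0 - 1) * (κ.1 1 1 - 1) - κ.1 0 1 * κ.1 1 0 ≠ 0) :
    conjSum f (affineMat κ 0 0) = ((Fintype.card F : ℂ) ^ 3 - 1) *
      (Nat.card (Subgroup.centralizer ({κ} : Set (GL (Fin 2) F))) * horocycle δ f κ.1) := by
  classical
  rw [conjSum_eq_affine hf]
  congr 1
  -- Conjugating by the affine matrix with block `ξ` and translation `(x, y)` produces the
  -- translation part `ξ⁻¹ (κ - 1) (x, y)`. As `κ - 1` is invertible, this runs once over `F²`. The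
  -- coefficients below are the entries of `ξ⁻¹ (κ - 1)`, with `ξ⁻¹` written as adjugate over
  -- determinant.
  have h1 : ∀ ξ : GL (Fin 2) F, ∑ x : F, ∑ y : F,
      f ((affineMat ξ x y)⁻¹ * affineMat κ 0 0 * affineMat ξ x y) =
      ∑ x : F, ∑ y : F, f (affineMat (ξ⁻¹ * κ * ξ) x y) := by
    intro ξ
    have hD := inv_det_ne_zero ξ
    set D := ξ.1 0 0 * ξ.1 1 1 - ξ.1 0 1 * ξ.1 1 0 with hDdef
    have := sum_linear_change
      (a := (ξ.1 1 1 * (κ.1 0 0 - 1) - ξ.1 0 1 * κ.1 1 0) / D)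
      (b := (ξ.1 1 1 * κ.1 0 1 - ξ.1 0 1 * (κ.1 1 1 - 1)) / D)
      (c := (-ξ.1 1 0 * (κ.1 0 0 - 1) + ξ.1 0 0 * κ.1 1 0) / D)
      (d := (-ξ.1 1 0 * κ.1 0 1 + ξ.1 0 0 * (κ.1 1 1 - 1)) / D) (by
        have : (ξ.1 1 1 * (κ.1 0 0 - 1) - ξ.1 0 1 * κ.1 1 0) / D *
            ((-ξ.1 1 0 * κ.1 0 1 + ξ.1 0 0 * (κ.1 1 1 - 1)) / D) -
            (ξ.1 1 1 * κ.1 0 1 - ξ.1 0 1 * (κ.1 1 1 - 1)) / D *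
            ((-ξ.1 1 0 * (κ.1 0 0 - 1) + ξ.1 0 0 * κ.1 1 0) / D) =
            ((κ.1 0 0 - 1) * (κ.1 1 1 - 1) - κ.1 0 1 * κ.1 1 0) / D := by
          field_simp
          rw [hDdef]; ring
        rw [this]
        exact div_ne_zero hκ hD) (fun x y => f (affineMat (ξ⁻¹ * κ * ξ) x y))
    rw [← this]
    refine Finset.sum_congr rfl fun x _ => Finset.sum_congr rfl fun y _ => ?_
    congr 1
    apply affineMat_conj
    · field_simp
      rw [hDdef]; ring
    · field_simp
      rw [hDdef]; ring
  simp_rw [h1]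
  rw [sum_conj_eq κ (fun ξ => ∑ x : F, ∑ y : F, f (affineMat ξ x y)), horocycle]
  congr 1
  simp_rw [onHq_affineMat]
  rw [Finset.sum_comm]
  -- `horocycle` tests conjugacy in the matrix monoid, where conjugators are still units, so the two
  -- classes agree.
  have h2 : (Finset.univ.filter fun y => IsConj κ y) =
      Finset.univ.filter fun y : GL (Fin 2) F => IsConj κ.1 y.1 := by
    refine Finset.filter_congr fun ξ _ => ?_
    rw [isConj_iff]
    constructor
    · rintro ⟨c, rfl⟩
      exact ⟨c, by simp [SemiconjBy, mul_assoc]⟩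
    · rintro ⟨c, hc⟩
      refine ⟨c, Units.ext ?_⟩
      rw [Units.val_mul, Units.val_mul, hc.eq, mul_assoc, ← Units.val_mul, mul_inv_cancel,
        Units.val_one, mul_one]
  rw [h2, Finset.sum_comm]
  refine (Finset.sum_comm.trans (Finset.sum_congr rfl fun x _ => ?_))
  rw [Finset.sum_comm]

end UpperHalfSpace

/-! ### Bruhat cells of `GL₂` and the orbital sums of unipotent elements. -/

namespace UpperHalfSpace

open SpectralSide GeometricSide

variable {F : Type*} [Field F]

/-- An upper triangular element of `GL₂`. -/
def upperGL (a d : Fˣ) (b : F) : GL (Fin 2) F :=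
  Matrix.GeneralLinearGroup.mkOfDetNeZero !![(a : F), b; 0, (d : F)] (by
    rw [Matrix.det_fin_two_of]; simp)

/-- The element of `GL₂` with second row `(c, d)`, `c ≠ 0`, upper left entry `a` and determinant
`D`. -/
def lowerGL (c D : Fˣ) (d a : F) : GL (Fin 2) F :=
  Matrix.GeneralLinearGroup.mkOfDetNeZero !![a, (a * d - D) / c; (c : F), d] (by
    rw [Matrix.det_fin_two_of]
    have : (a * d - D) / c * (c : F) = a * d - D := div_mul_cancel₀ _ c.ne_zero
    rw [this]; simp)

lemma upperGL_val (a d : Fˣ) (b : F) : (upperGL a d b).1 = !![(a : F), b; 0, (d : F)] := rfl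

lemma lowerGL_val (c D : Fˣ) (d a : F) :
    (lowerGL c D d a).1 = !![a, (a * d - D) / c; (c : F), d] := rfl

lemma GL_two_ext {ξ ξ' : GL (Fin 2) F} (h00 : ξ.1 0 0 = ξ'.1 0 0) (h01 : ξ.1 0 1 = ξ'.1 0 1)
    (h10 : ξ.1 1 0 = ξ'.1 1 0) (h11 : ξ.1 1 1 = ξ'.1 1 1) : ξ = ξ' :=
  Matrix.GeneralLinearGroup.ext fun i j => by fin_cases i <;> fin_cases j <;> assumption

lemma lowerGL_det (c D : Fˣ) (d a : F) : a * d - (a * d - D) / c * (c : F) = D := by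
  rw [div_mul_cancel₀ _ c.ne_zero]; ring

/-- The two cells are told apart by whether the lower left entry vanishes. If it does not, the
determinant and the other three entries determine the upper right one. -/
lemma bijective_upper_lower : Function.Bijective
    (Sum.elim (fun t : Fˣ × Fˣ × F => upperGL t.1 t.2.1 t.2.2)
      (fun t : Fˣ × Fˣ × F × F => lowerGL t.1 t.2.1 t.2.2.1 t.2.2.2)) := by
  constructor
  · have entry : ∀ {ξ ξ' : GL (Fin 2) F}, ξ = ξ' → ∀ i j, ξ.1 i j = ξ'.1 i j := by
      rintro ξ _ rfl i j; rfl
    rintro (⟨a, d, b⟩ | ⟨c, D, d, a⟩) (⟨a', d', b'⟩ | ⟨c', D', d', a'⟩) h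
    · have h := entry h
      have h1 := h 0 0
      have h2 := h 0 1
      have h3 := h 1 1
      simp [upperGL_val] at h1 h2 h3
      rw [Units.ext h1, Units.ext h3, h2]
    · have h1 := entry h 1 0
      simp [upperGL_val, lowerGL_val] at h1
      exact absurd h1.symm c'.ne_zero
    · have h1 := entry h 1 0
      simp [upperGL_val, lowerGL_val] at h1
    · have h := entry h
      have h1 := h 0 0
      have h2 := h 0 1
      have h3 := h 1 0
      have h4 := h 1 1
      simp [lowerGL_val] at h1 h2 h3 h4
      have h5 : D = D' := Units.ext (by
        rw [← lowerGL_det c D d a, ← lowerGL_det c' D' d' a', h2, h1, h3, h4])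
      rw [Units.ext h3, h5, h1, h4]
  · intro ξ
    have hD := inv_det_ne_zero ξ
    by_cases hc : ξ.1 1 0 = 0
    · rw [hc, mul_zero, sub_zero] at hD
      refine ⟨Sum.inl ⟨Units.mk0 _ (left_ne_zero_of_mul hD), Units.mk0 _ (right_ne_zero_of_mul hD),
        ξ.1 0 1⟩, GL_two_ext ?_ ?_ ?_ ?_⟩ <;> simp [upperGL_val, hc]
    · refine ⟨Sum.inr ⟨Units.mk0 _ hc, Units.mk0 _ hD, ξ.1 1 1, ξ.1 0 0⟩,
        GL_two_ext ?_ ?_ ?_ ?_⟩ <;> simp [lowerGL_val, hc]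

section Sums

variable [Fintype F] [DecidableEq F]

/-- Summation over `GL₂` by Bruhat cells. -/
lemma sum_GL_two (φ : GL (Fin 2) F → ℂ) :
    ∑ ξ, φ ξ = ∑ a : Fˣ, ∑ d : Fˣ, ∑ b : F, φ (upperGL a d b) +
      ∑ c : Fˣ, ∑ D : Fˣ, ∑ d : F, ∑ a : F, φ (lowerGL c D d a) := by
  rw [← Fintype.sum_bijective _ (bijective_upper_lower (F := F)) _ φ fun _ => rfl,
    Fintype.sum_sum_type]
  simp [Fintype.sum_prod_type]

lemma card_units_cast : (Fintype.card Fˣ : ℂ) = (Fintype.card F : ℂ) - 1 := by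
  rw [Fintype.card_units, Nat.cast_sub Fintype.card_pos, Nat.cast_one]

lemma card_GL_two : (Nat.card (GL (Fin 2) F) : ℂ) =
    ((Fintype.card F : ℂ) ^ 2 - 1) * ((Fintype.card F : ℂ) ^ 2 - Fintype.card F) := by
  have := sum_GL_two (F := F) (fun _ => 1)
  simp only [Finset.sum_const, Finset.card_univ, card_units_cast, nsmul_eq_mul, mul_one] at this
  rw [Nat.card_eq_fintype_card, this]
  ring

omit [DecidableEq F] in
lemma sum_affine_change {a : F} (ha : a ≠ 0) (b : F) (φ : F → ℂ) :
    ∑ x : F, φ (a * x + b) = ∑ x : F, φ x :=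
  Fintype.sum_bijective _ (((Equiv.mulLeft₀ a ha).trans (Equiv.addRight b)).bijective) _ _
    fun _ => rfl

lemma sum_units_inv_change (a : Fˣ) (φ : Fˣ → ℂ) : ∑ x : Fˣ, φ (a * x⁻¹) = ∑ x : Fˣ, φ x :=
  Fintype.sum_bijective _ (((Equiv.inv Fˣ).trans (Equiv.mulLeft a)).bijective) _ _ fun _ => rfl

/-- Summation over `GL₂` of a function of the first column. -/
lemma sum_first_column (φ : F → F → ℂ) :
    ∑ ξ : GL (Fin 2) F, φ (ξ.1 0 0) (ξ.1 1 0) = ((Fintype.card F : ℂ) ^ 2 - Fintype.card F) *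
      (∑ x : F, ∑ y : F, φ x y - φ 0 0) := by
  have hU : ∀ ψ : F → ℂ, ∑ x : F, ψ x = ψ 0 + ∑ x : Fˣ, ψ x := fun ψ => by
    rw [Fintype.sum_eq_add_sum_compl 0]
    congr 1
    refine (Finset.sum_bij (fun (x : Fˣ) _ => (x : F)) ?_ ?_ ?_ ?_).symm
    · simp
    · intro x _ y _ h; exact Units.ext h
    · intro x hx; exact ⟨Units.mk0 x (by simpa using hx), by simp⟩
    · simp
  -- A nonzero column has either vanishing second entry and a unit above it, or a unit as second
  -- entry; these are the two cells.
  have hU2 : ∑ x : F, ∑ y : F, φ x y - φ 0 0 = ∑ a : Fˣ, φ a 0 + ∑ c : Fˣ, ∑ a : F, φ a c := by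
    simp_rw [hU (φ _), Finset.sum_add_distrib]
    rw [hU (fun x => φ x 0), Finset.sum_comm (s := (Finset.univ : Finset F))]
    ring
  rw [sum_GL_two, hU2]
  simp only [upperGL_val, lowerGL_val, Matrix.of_apply, Matrix.cons_val', Matrix.cons_val_zero,
    Matrix.cons_val_one, Matrix.cons_val_fin_one, Finset.sum_const, Finset.card_univ,
    card_units_cast, nsmul_eq_mul, mul_add, Finset.mul_sum]
  congr 1
  · exact Finset.sum_congr rfl fun x _ => by ring
  · exact Finset.sum_congr rfl fun x _ => Finset.sum_congr rfl fun y _ => by ring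

variable {δ : F} [hδ : Fact (∀ x : F, x ^ 3 ≠ δ)]

/-- The orbital sum of a transvection. -/
lemma conjSum_transvection {f : GL (Fin 3) F → ℂ} (hf : BiInvariant δ f) :
    conjSum f (affineMat 1 1 0) = ((Fintype.card F : ℂ) ^ 3 - 1) * ((Fintype.card F : ℂ) ^ 2 *
      (((Fintype.card F : ℂ) ^ 2 - Fintype.card F) *
        (horocycle δ f 1 - onHq f (basePoint δ)))) := by
  classical
  rw [conjSum_eq_affine hf]
  congr 1
  -- The identity block is unaffected by conjugation and the translation becomes the first column of
  -- `ξ⁻¹`, whatever `x` and `y` are; hence the factor `q²`.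
  have h1 : ∀ (ξ : GL (Fin 2) F) (x y : F),
      (affineMat ξ x y)⁻¹ * affineMat 1 1 0 * affineMat ξ x y =
        affineMat 1 ((ξ⁻¹).1 0 0) ((ξ⁻¹).1 1 0) := by
    intro ξ x y
    have h2 : ξ.1 * (ξ⁻¹).1 = 1 := by rw [← Units.val_mul, mul_inv_cancel, Units.val_one]
    have h00 := congrFun (congrFun h2 0) 0
    have h10 := congrFun (congrFun h2 1) 0
    simp only [Matrix.mul_apply, Fin.sum_univ_two, Matrix.one_apply_eq] at h00 h10
    rw [Matrix.one_apply_ne (by decide)] at h10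
    have h3 := affineMat_conj 1 ξ 1 0 x y ((ξ⁻¹).1 0 0) ((ξ⁻¹).1 1 0)
      (by rw [h00]; simp) (by rw [h10]; simp)
    rw [h3]
    simp
  simp_rw [h1]
  simp only [Finset.sum_const, Finset.card_univ, nsmul_eq_mul]
  refine (Fintype.sum_equiv (Equiv.inv (GL (Fin 2) F)) _
    (fun ξ => (Fintype.card F : ℂ) * ((Fintype.card F : ℂ) *
      f (affineMat 1 (ξ.1 0 0) (ξ.1 1 0)))) (fun _ => rfl)).trans ?_
  simp only [← Finset.mul_sum]
  rw [sum_first_column (fun x y => f (affineMat 1 x y)), horocycle]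
  have hbase : onHq f (basePoint δ) = f (affineMat 1 0 0) := by
    have h : (1 : GL (Fin 3) F) = affineMat 1 0 0 := by
      apply Units.ext
      rw [affineMat_val]
      ext i j
      fin_cases i <;> fin_cases j <;> simp
    have := onHq_affineMat f (1 : GL (Fin 2) F) 0 0 (δ := δ)
    rwa [← h, one_smul, h] at this
  -- The class of the identity is a single element, so `Hf(I)` sums over all translations. The zero
  -- translation, which is no column of an invertible matrix, accounts for the subtracted value at
  -- the base point.
  have hone : (Finset.univ.filter fun ξ : GL (Fin 2) F =>
      IsConj (1 : Matrix (Fin 2) (Fin 2) F) ξ.1) = {1} := by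
    ext ξ
    simp only [Finset.mem_filter, Finset.mem_univ, true_and, Finset.mem_singleton]
    constructor
    · rintro ⟨c, hc⟩
      apply Units.ext
      have h2 := hc.eq
      rw [mul_one] at h2
      have := c.mul_inv
      calc ξ.1 = ξ.1 * (c.1 * (c⁻¹).1) := by rw [← Units.val_mul, mul_inv_cancel]; simp
        _ = c.1 * (c⁻¹).1 := by rw [← mul_assoc, ← h2]
        _ = 1 := by rw [← Units.val_mul, mul_inv_cancel]; simp
    · rintro rfl; exact IsConj.refl _
  simp_rw [hone, Finset.sum_singleton, onHq_affineMat, hbase]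
  ring

omit hδ [Fintype F] [DecidableEq F] in
-- The conjugate is again affine, so its entries are the coordinates of a point of the half-space:
-- `r = d / a`, `s = 1 / d`, and `t` affine in `y`. Forms such as `1 * d⁻¹` are kept to fit the
-- substitution lemmas.
lemma apply_conj_upperGL (f : GL (Fin 3) F → ℂ) (a d : Fˣ) (b x y : F) :
  f ((affineMat (upperGL a d b) x y)⁻¹ *
    affineMat (upperGL 1 1 1) 0 1 * affineMat (upperGL a d b) x y) =
    onHq f (parabolicPoint δ (d * a⁻¹ : Fˣ) (1 * d⁻¹ : Fˣ) ((a⁻¹ : F) * y + (-b / (a * d)))) := by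
  have ha := a.ne_zero
  have hd := d.ne_zero
  rw [onHq]
  congr 1
  rw [mul_assoc, inv_mul_eq_iff_eq_mul]
  apply Units.ext
  rw [Units.val_mul, Units.val_mul, Hq.toAffine_val, affineMat_val, affineMat_val]
  ext i j
  fin_cases i <;> fin_cases j <;>
    simp [Matrix.mul_apply, Fin.sum_univ_three, upperGL_val, parabolicPoint, Hq.point] <;>
    field_simp <;> ring

omit hδ [Fintype F] [DecidableEq F] in
-- On the big cell the coordinates are `r = -c² / D`, `s = 1 / c`, `v = d / c`, and `t` affine in
-- `y`.
lemma apply_conj_lowerGL (f : GL (Fin 3) F → ℂ) (c D : Fˣ) (d a x y : F) :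
  f ((affineMat (lowerGL c D d a) x y)⁻¹ *
    affineMat (upperGL 1 1 1) 0 1 * affineMat (lowerGL c D d a) x y) =
    onHq f (parabolicPoint' δ (-c ^ 2 * D⁻¹ : Fˣ) (1 * c⁻¹ : Fˣ) (-(c / D : F) * y + a / D)
      ((c⁻¹ : F) * d + 0)) := by
  have hc := c.ne_zero
  have hD := D.ne_zero
  rw [onHq]
  congr 1
  rw [mul_assoc, inv_mul_eq_iff_eq_mul]
  apply Units.ext
  rw [Units.val_mul, Units.val_mul, Hq.toAffine_val, affineMat_val, affineMat_val]
  ext i j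
  fin_cases i <;> fin_cases j <;>
    simp [Matrix.mul_apply, Fin.sum_univ_three, upperGL_val, lowerGL_val, parabolicPoint',
      Hq.point] <;>
    field_simp <;> ring

omit hδ in
-- The variables `y`, `a`, `d` are replaced in turn by `t`, `r`, `s`. The shift of `t` absorbs `b`,
-- so `b` and the first translation coordinate are free and contribute `q²`.
lemma sum_upperGL_change (P : Fˣ → Fˣ → F → ℂ) :
    ∑ a : Fˣ, ∑ d : Fˣ, ∑ b : F, ∑ _x : F, ∑ y : F,
      P (d * a⁻¹) (1 * d⁻¹) ((a⁻¹ : F) * y + (-b / (a * d))) =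
    (Fintype.card F : ℂ) ^ 2 * ∑ r : Fˣ, ∑ s : Fˣ, ∑ t : F, P r s t := by
  have h1 : ∀ (a d : Fˣ) (b : F), ∑ y : F, P (d * a⁻¹) (1 * d⁻¹) ((a⁻¹ : F) * y + (-b / (a * d))) =
      ∑ t : F, P (d * a⁻¹) (1 * d⁻¹) t := fun a d b =>
    sum_affine_change (inv_ne_zero a.ne_zero) _ (P (d * a⁻¹) (1 * d⁻¹))
  have h2 : ∀ d : Fˣ, ∑ a : Fˣ, ∑ t : F, P (d * a⁻¹) (1 * d⁻¹) t =
      ∑ r : Fˣ, ∑ t : F, P r (1 * d⁻¹) t := fun d =>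
    sum_units_inv_change d (fun r => ∑ t : F, P r (1 * d⁻¹) t)
  simp_rw [h1]
  simp only [Finset.sum_const, Finset.card_univ, nsmul_eq_mul, ← Finset.mul_sum]
  rw [Finset.sum_comm]
  simp_rw [h2]
  rw [sum_units_inv_change 1 (fun s : Fˣ => ∑ r : Fˣ, ∑ t : F, P r s t), Finset.sum_comm]
  ring

omit hδ in
-- Here `y`, `d`, `D`, `c` become `t`, `v`, `r`, `s`; the free variables are `a`, absorbed in the
-- shift of `t`, and the first translation coordinate.
lemma sum_lowerGL_change (P : Fˣ → Fˣ → F → F → ℂ) :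
    ∑ c : Fˣ, ∑ D : Fˣ, ∑ d : F, ∑ a : F, ∑ _x : F, ∑ y : F,
      P (-c ^ 2 * D⁻¹) (1 * c⁻¹) (-(c / D : F) * y + a / D) ((c⁻¹ : F) * d + 0) =
    (Fintype.card F : ℂ) ^ 2 * ∑ r : Fˣ, ∑ s : Fˣ, ∑ t : F, ∑ v : F, P r s t v := by
  have h1 : ∀ (c D : Fˣ) (d a : F), ∑ y : F,
      P (-c ^ 2 * D⁻¹) (1 * c⁻¹) (-(c / D : F) * y + a / D) ((c⁻¹ : F) * d + 0) =
      ∑ t : F, P (-c ^ 2 * D⁻¹) (1 * c⁻¹) t ((c⁻¹ : F) * d + 0) := fun c D d a =>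
    sum_affine_change (neg_ne_zero.2 (div_ne_zero c.ne_zero D.ne_zero)) _
      (fun t => P (-c ^ 2 * D⁻¹) (1 * c⁻¹) t ((c⁻¹ : F) * d + 0))
  have h2 : ∀ (c D : Fˣ), ∑ d : F, ∑ t : F, P (-c ^ 2 * D⁻¹) (1 * c⁻¹) t ((c⁻¹ : F) * d + 0) =
      ∑ v : F, ∑ t : F, P (-c ^ 2 * D⁻¹) (1 * c⁻¹) t v := fun c D =>
    sum_affine_change (inv_ne_zero c.ne_zero) 0
      (fun v => ∑ t : F, P (-c ^ 2 * D⁻¹) (1 * c⁻¹) t v)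
  have h3 : ∀ c : Fˣ, ∑ D : Fˣ, ∑ v : F, ∑ t : F, P (-c ^ 2 * D⁻¹) (1 * c⁻¹) t v =
      ∑ r : Fˣ, ∑ v : F, ∑ t : F, P r (1 * c⁻¹) t v := fun c =>
    sum_units_inv_change (-c ^ 2) (fun r => ∑ v : F, ∑ t : F, P r (1 * c⁻¹) t v)
  simp_rw [h1]
  simp only [Finset.sum_const, Finset.card_univ, nsmul_eq_mul, ← Finset.mul_sum]
  simp_rw [h2, h3]
  rw [sum_units_inv_change 1 (fun s : Fˣ => ∑ r : Fˣ, ∑ v : F, ∑ t : F, P r s t v),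
    Finset.sum_comm]
  simp_rw [Finset.sum_comm (s := (Finset.univ : Finset F)) (f := fun v t => P _ _ t v)]
  ring

/-- The orbital sum of a regular unipotent element. -/
lemma conjSum_regular_unipotent {f : GL (Fin 3) F → ℂ} (hf : BiInvariant δ f) :
    conjSum f (affineMat (upperGL 1 1 1) 0 1) = (Fintype.card F : ℂ) ^ 2 *
      ((Fintype.card F : ℂ) - 1) * parabolicOrbital2 δ f := by
  rw [conjSum_eq_affine hf, sum_GL_two, parabolicOrbital2]
  simp_rw [apply_conj_upperGL (δ := δ) f, apply_conj_lowerGL (δ := δ) f]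
  rw [sum_upperGL_change (fun r s t => onHq f (parabolicPoint δ (r : F) (s : F) t)),
    sum_lowerGL_change (fun r s t v => onHq f (parabolicPoint' δ (r : F) (s : F) t v))]
  simp_rw [Finset.sum_add_distrib]
  ring

end Sums

end UpperHalfSpace

namespace ConjugacyClasses

open Matrix

variable {F : Type*} [Field F]

/-! ### Conjugacy of matrices through adapted bases -/

lemma isConj_units_iff {R : Type*} [Monoid R] (x y : Rˣ) : IsConj x y ↔ IsConj (x : R) (y : R) := by
  rw [isConj_iff]
  constructor
  · rintro ⟨c, rfl⟩
    exact ⟨c, by simp [SemiconjBy, mul_assoc]⟩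
  · rintro ⟨c, hc⟩
    refine ⟨c, Units.ext ?_⟩
    rw [Units.val_mul, Units.val_mul, hc.eq, mul_assoc, ← Units.val_mul, mul_inv_cancel,
      Units.val_one, mul_one]

lemma charpoly_eq_of_isConj {n : Type*} [Fintype n] [DecidableEq n] {M N : Matrix n n F}
    (h : IsConj M N) : M.charpoly = N.charpoly := by
  obtain ⟨c, hc⟩ := h
  have : N = c.1 * M * (c⁻¹).1 := by
    rw [hc.eq, mul_assoc, ← Units.val_mul, mul_inv_cancel, Units.val_one, mul_one]
  rw [this]
  simp

/-- A matrix acting on a basis through the matrix `T` is conjugate to `T`. -/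
lemma isConj_of_basis {n : Type*} [Fintype n] [DecidableEq n] (T M : Matrix n n F)
    (b : n → n → F) (hb : ∀ c : n → F, ∑ i, c i • b i = 0 → c = 0)
    (hM : ∀ j, M *ᵥ b j = ∑ i, T i j • b i) : IsConj T M := by
  have hdet : (Matrix.of b)ᵀ.det ≠ 0 := by
    intro h0
    obtain ⟨c, hc, h⟩ := Matrix.exists_mulVec_eq_zero_iff.2 h0
    refine hc (hb c ?_)
    rw [← h, Matrix.mulVec_eq_sum]
    simp [Matrix.of]
    rfl
  have hP : IsUnit (Matrix.of b)ᵀ := (Matrix.isUnit_iff_isUnit_det _).2 hdet.isUnit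
  refine ⟨hP.unit, ?_⟩
  change (Matrix.of b)ᵀ * T = M * (Matrix.of b)ᵀ
  ext i j
  have := congrFun (hM j) i
  simp only [Matrix.mulVec, dotProduct, Finset.sum_apply, Pi.smul_apply, smul_eq_mul] at this
  simp only [Matrix.mul_apply, Matrix.transpose_apply, Matrix.of_apply]
  rw [this]
  exact Finset.sum_congr rfl fun k _ => mul_comm _ _

/-- The companion matrix of a monic cubic. -/
def companion (P : F[X]) : Matrix (Fin 3) (Fin 3) F :=
  !![0, 0, -P.coeff 0; 1, 0, -P.coeff 1; 0, 1, -P.coeff 2]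

lemma sum_fin_three_range (P : F[X]) (hP : P.Monic) (h3 : P.natDegree = 3) :
    P = C (P.coeff 0) + C (P.coeff 1) * X + C (P.coeff 2) * X ^ 2 + X ^ 3 := by
  conv_lhs => rw [P.as_sum_range_C_mul_X_pow, h3]
  have : P.coeff 3 = 1 := by rw [← h3]; exact hP
  simp [Finset.sum_range_succ, this]

/-- A matrix with a cyclic vector is conjugate to the companion matrix of any monic cubic that
annihilates it. -/
lemma isConj_companion {M : Matrix (Fin 3) (Fin 3) F} {P : F[X]} (hP : P.Monic)
    (h3 : P.natDegree = 3) (hM : aeval M P = 0) (v : Fin 3 → F)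
    (hv : ∀ x y z : F, x • v + y • (M *ᵥ v) + z • (M *ᵥ (M *ᵥ v)) = 0 → x = 0 ∧ y = 0 ∧ z = 0) :
    IsConj (companion P) M := by
  refine isConj_of_basis _ _ ![v, M *ᵥ v, M *ᵥ (M *ᵥ v)] ?_ ?_
  · intro c hc
    simp only [Fin.sum_univ_three, Matrix.cons_val] at hc
    obtain ⟨h0, h1, h2⟩ := hv _ _ _ hc
    ext i; fin_cases i <;> assumption
  · rw [sum_fin_three_range P hP h3] at hM
    simp only [map_add, map_mul, aeval_C, aeval_X, map_pow, Algebra.algebraMap_eq_smul_one,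
      smul_mul_assoc, one_mul] at hM
    have h4 := congrArg (fun N => N *ᵥ v) hM
    simp only [Matrix.add_mulVec, Matrix.smul_mulVec, Matrix.one_mulVec, Matrix.zero_mulVec,
      pow_succ, pow_zero, one_mul, ← Matrix.mulVec_mulVec] at h4
    intro j
    fin_cases j
    · simp [companion, Fin.sum_univ_three]
    · simp [companion, Fin.sum_univ_three]
    -- The relation `P(M) v = 0` expresses `M³ v` through the basis and is the last column of the
    -- companion matrix.
    · simp only [Fin.reduceFinMk, Matrix.cons_val, companion, Fin.sum_univ_three, Matrix.of_apply,
        Matrix.cons_val', Matrix.cons_val_fin_one]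
      rw [← sub_eq_zero, ← h4]
      module

lemma aeval_mulVec_quadratic (M : Matrix (Fin 3) (Fin 3) F) (v : Fin 3 → F) (x y z : F) :
    aeval M (C x + C y * X + C z * X ^ 2) *ᵥ v = x • v + y • (M *ᵥ v) + z • (M *ᵥ (M *ᵥ v)) := by
  simp [Algebra.algebraMap_eq_smul_one, Matrix.add_mulVec, Matrix.smul_mulVec, sq]

lemma quadratic_eq_zero {x y z : F} (h : C x + C y * X + C z * X ^ 2 = 0) :
    x = 0 ∧ y = 0 ∧ z = 0 := by
  refine ⟨?_, ?_, ?_⟩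
  · simpa [coeff_C, coeff_X, coeff_X_pow] using congrArg (fun P => P.coeff 0) h
  · simpa [coeff_C, coeff_X, coeff_X_pow] using congrArg (fun P => P.coeff 1) h
  · simpa [coeff_C, coeff_X, coeff_X_pow] using congrArg (fun P => P.coeff 2) h

/-- For a matrix annihilated by an irreducible cubic, every nonzero vector is cyclic. -/
lemma cyclic_of_irreducible {M : Matrix (Fin 3) (Fin 3) F} {P : F[X]} (hP : Irreducible P)
    (h3 : P.natDegree = 3) (hM : aeval M P = 0) {v : Fin 3 → F} (hv : v ≠ 0) (x y z : F)
    (h : x • v + y • (M *ᵥ v) + z • (M *ᵥ (M *ᵥ v)) = 0) : x = 0 ∧ y = 0 ∧ z = 0 := by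
  rw [← aeval_mulVec_quadratic] at h
  by_contra h0
  have hR : C x + C y * X + C z * X ^ 2 ≠ 0 := fun hR => h0 (quadratic_eq_zero hR)
  have hdeg : (C x + C y * X + C z * X ^ 2).natDegree ≤ 2 := by compute_degree
  -- A nonzero polynomial of degree at most 2 is coprime to the irreducible cubic, and a Bézout
  -- relation applied to `v` would give `v = 0`.
  have hco : IsCoprime P (C x + C y * X + C z * X ^ 2) := by
    refine (hP.coprime_iff_not_dvd).2 fun hd => ?_
    have := natDegree_le_of_dvd hd hR
    omega
  obtain ⟨A, B, hAB⟩ := hco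
  have h1 := congrArg (fun R => aeval M R *ᵥ v) hAB
  rw [map_add, map_mul, map_mul, hM, mul_zero, zero_add, map_one, Matrix.one_mulVec] at h1
  rw [← Matrix.mulVec_mulVec, h, Matrix.mulVec_zero] at h1
  exact hv h1.symm

lemma isConj_companion_of_irreducible {M : Matrix (Fin 3) (Fin 3) F} {P : F[X]}
    (hP : Irreducible P) (hm : P.Monic) (h3 : P.natDegree = 3) (hM : aeval M P = 0) :
    IsConj (companion P) M :=
  isConj_companion hm h3 hM (fun _ => 1) (cyclic_of_irreducible hP h3 hM fun h => by
    simpa using congrFun h 0)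

/-! ### Splitting off an eigenvalue -/

/-- The block matrix `diag(B, e)`. -/
def blockMat (B : Matrix (Fin 2) (Fin 2) F) (e : F) : Matrix (Fin 3) (Fin 3) F :=
  !![B 0 0, B 0 1, 0; B 1 0, B 1 1, 0; 0, 0, e]

lemma charpoly_lower_block (B : Matrix (Fin 2) (Fin 2) F) (x y e : F) :
    (!![B 0 0, B 0 1, 0; B 1 0, B 1 1, 0; x, y, e] : Matrix (Fin 3) (Fin 3) F).charpoly =
      (X - C e) * B.charpoly := by
  rw [Matrix.charpoly, Matrix.charpoly, Matrix.det_fin_three, Matrix.det_fin_two]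
  simp
  ring

lemma charpoly_blockMat (B : Matrix (Fin 2) (Fin 2) F) (e : F) :
    (blockMat B e).charpoly = (X - C e) * B.charpoly := charpoly_lower_block B 0 0 e

lemma blockMat_isConj {B B' : Matrix (Fin 2) (Fin 2) F} (h : IsConj B B') (e : F) :
    IsConj (blockMat B e) (blockMat B' e) := by
  obtain ⟨c, hc⟩ := h
  have hdet : (blockMat c.1 1).det ≠ 0 := by
    have h := (Matrix.isUnits_det_units c).ne_zero
    rw [Matrix.det_fin_two] at h
    rw [blockMat, Matrix.det_fin_three]
    simpa using h
  have hP : IsUnit (blockMat c.1 1) := (Matrix.isUnit_iff_isUnit_det _).2 hdet.isUnit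
  refine ⟨hP.unit, ?_⟩
  change blockMat c.1 1 * blockMat B e = blockMat B' e * blockMat c.1 1
  have h := fun i j => congrFun (congrFun hc.eq i) j
  simp only [Matrix.mul_apply, Fin.sum_univ_two] at h
  ext i j
  fin_cases i <;> fin_cases j <;> simp [blockMat, Matrix.mul_apply, Fin.sum_univ_three, h]

/-- Every nonzero vector is the last vector of a basis. -/
lemma exists_basis_last {v : Fin 3 → F} (hv : v ≠ 0) :
    ∃ P : GL (Fin 3) F, ∀ i, P.1 i 2 = v i := by
  by_cases h2 : v 2 = 0
  · by_cases h1 : v 1 = 0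
    · have h0 : v 0 ≠ 0 := fun h0 => hv (by ext i; fin_cases i <;> assumption)
      refine ⟨GeneralLinearGroup.mkOfDetNeZero !![0, 0, v 0; 1, 0, v 1; 0, 1, v 2] ?_, ?_⟩
      · rw [Matrix.det_fin_three]; simpa using h0
      · intro i; fin_cases i <;> rfl
    · refine ⟨GeneralLinearGroup.mkOfDetNeZero !![1, 0, v 0; 0, 0, v 1; 0, 1, v 2] ?_, ?_⟩
      · rw [Matrix.det_fin_three]; simpa using h1
      · intro i; fin_cases i <;> rfl
  · refine ⟨GeneralLinearGroup.mkOfDetNeZero !![1, 0, v 0; 0, 1, v 1; 0, 0, v 2] ?_, ?_⟩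
    · rw [Matrix.det_fin_three]; simpa using h2
    · intro i; fin_cases i <;> rfl

/-- A simple root of the characteristic polynomial splits off as a block. -/
lemma exists_block {M : Matrix (Fin 3) (Fin 3) F} {e : F} {Q : F[X]}
    (h : M.charpoly = (X - C e) * Q) (hQ : Q.eval e ≠ 0) :
    ∃ B : Matrix (Fin 2) (Fin 2) F, B.charpoly = Q ∧ IsConj (blockMat B e) M := by
  have hroot : M.charpoly.eval e = 0 := by rw [h]; simp
  rw [Matrix.eval_charpoly] at hroot
  obtain ⟨v, hv, hMv⟩ := Matrix.exists_mulVec_eq_zero_iff.2 hroot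
  have hMv' : M *ᵥ v = e • v := by
    rw [Matrix.sub_mulVec, sub_eq_zero] at hMv
    rw [← hMv]
    ext i
    simp [Matrix.scalar_apply, Matrix.mulVec_diagonal]
  obtain ⟨P, hP⟩ := exists_basis_last hv
  set N := (P⁻¹).1 * M * P.1 with hN
  have hNM : IsConj N M := by
    refine ⟨P, ?_⟩
    change P.1 * N = M * P.1
    rw [hN, ← mul_assoc, ← mul_assoc, ← Units.val_mul, mul_inv_cancel, Units.val_one, one_mul]
  -- In a basis ending with an eigenvector the last column is diagonal; only the last row remains to
  -- be cleared.
  have hcol : ∀ i, N i 2 = if i = 2 then e else 0 := by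
    have h1 : P.1 *ᵥ (Pi.single 2 1) = v := by
      rw [Matrix.mulVec_single_one]
      exact funext hP
    have h2 : N *ᵥ (Pi.single 2 1) = e • Pi.single 2 1 := by
      rw [hN, ← Matrix.mulVec_mulVec, ← Matrix.mulVec_mulVec, h1, hMv', Matrix.mulVec_smul, ← h1,
        Matrix.mulVec_mulVec, ← Units.val_mul, inv_mul_cancel, Units.val_one, Matrix.one_mulVec]
    intro i
    have h3 := congrFun h2 i
    rw [Matrix.mulVec_single_one] at h3
    simpa [Matrix.col, Pi.single_apply] using h3
  let B : Matrix (Fin 2) (Fin 2) F := !![N 0 0, N 0 1; N 1 0, N 1 1]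
  have hNB : N = !![B 0 0, B 0 1, 0; B 1 0, B 1 1, 0; N 2 0, N 2 1, e] := by
    ext i j
    fin_cases i <;> fin_cases j <;> simp [B, hcol]
  have hB : B.charpoly = Q := by
    have h1 := charpoly_eq_of_isConj hNM
    rw [h, hNB, charpoly_lower_block] at h1
    exact mul_left_cancel₀ (X_sub_C_ne_zero e) h1
  refine ⟨B, hB, IsConj.trans ?_ hNM⟩
  -- This determinant of `B - e` is `Q(e)`, nonzero because the root is simple. Cramer's rule then
  -- solves `u (B - e) = (N₂₀, N₂₁)` for the row `u` that clears the last row.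
  have hD : (B 0 0 - e) * (B 1 1 - e) - B 0 1 * B 1 0 ≠ 0 := by
    rw [← hB, Matrix.eval_charpoly, Matrix.det_fin_two] at hQ
    simp only [Matrix.sub_apply, Matrix.scalar_apply, Matrix.diagonal_apply_eq] at hQ
    rw [Matrix.diagonal_apply_ne _ (by decide), Matrix.diagonal_apply_ne _ (by decide)] at hQ
    intro h0
    exact hQ (by linear_combination h0)
  set D := (B 0 0 - e) * (B 1 1 - e) - B 0 1 * B 1 0 with hDdef
  set u₀ := (N 2 0 * (B 1 1 - e) - N 2 1 * B 1 0) / D with hu₀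
  set u₁ := (N 2 1 * (B 0 0 - e) - N 2 0 * B 0 1) / D with hu₁
  have e0 : u₀ * B 0 0 + u₁ * B 1 0 = N 2 0 + e * u₀ := by
    rw [hu₀, hu₁]; field_simp; rw [hDdef]; ring
  have e1 : u₀ * B 0 1 + u₁ * B 1 1 = N 2 1 + e * u₁ := by
    rw [hu₀, hu₁]; field_simp; rw [hDdef]; ring
  have hT : IsUnit (!![1, 0, 0; 0, 1, 0; u₀, u₁, 1] : Matrix (Fin 3) (Fin 3) F) := by
    rw [Matrix.isUnit_iff_isUnit_det, Matrix.det_fin_three]; simp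
  refine ⟨hT.unit, ?_⟩
  change !![1, 0, 0; 0, 1, 0; u₀, u₁, 1] * blockMat B e = N * !![1, 0, 0; 0, 1, 0; u₀, u₁, 1]
  rw [hNB]
  ext i j
  fin_cases i <;> fin_cases j <;>
    simp [blockMat, Matrix.mul_apply, Fin.sum_univ_three]
  · simpa [B] using e0
  · simpa [B] using e1

end ConjugacyClasses

namespace ConjugacyClasses

open Matrix

variable {F : Type*} [Field F]

/-! ### Two by two matrices -/

lemma trace_det_of_charpoly {B : Matrix (Fin 2) (Fin 2) F} {a b : F}
    (h : B.charpoly = (X - C a) * (X - C b)) : B.trace = a + b ∧ B.det = a * b := by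
  rw [Matrix.charpoly_fin_two] at h
  have h0 := congrArg (Polynomial.eval 0) h
  have h1 := congrArg (fun P => P.coeff 1) h
  simp at h0
  have h2 : (X - C a) * (X - C b) = X ^ 2 - C (a + b) * X + C (a * b) := by
    rw [C_add, C_mul]; ring
  rw [h2] at h1
  simp [coeff_C, coeff_X_pow] at h1
  exact ⟨by linear_combination -h1, h0⟩

lemma charpoly_of_trace_det {B : Matrix (Fin 2) (Fin 2) F} {a b : F} (ht : B.trace = a + b)
    (hd : B.det = a * b) : B.charpoly = (X - C a) * (X - C b) := by
  rw [Matrix.charpoly_fin_two, ht, hd, C_add, C_mul]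
  ring

/-- A nonscalar `2 × 2` matrix is conjugate to a companion matrix. -/
lemma isConj_companion_two {B : Matrix (Fin 2) (Fin 2) F} (hB : ∀ c : F, B ≠ c • 1) :
    IsConj !![0, -B.det; 1, B.trace] B := by
  -- If every vector were an eigenvector, testing on the two basis vectors and their sum would make
  -- `B` scalar. Otherwise some `v` and `B v` form a basis.
  obtain ⟨v, hv⟩ : ∃ v : Fin 2 → F, v 0 * (B *ᵥ v) 1 - v 1 * (B *ᵥ v) 0 ≠ 0 := by
    by_contra! h
    have h1 := h ![1, 0]
    have h2 := h ![0, 1]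
    have h3 := h ![1, 1]
    simp [Matrix.mulVec, dotProduct, Fin.sum_univ_two] at h1 h2 h3
    refine hB (B 0 0) ?_
    ext i j
    fin_cases i <;> fin_cases j <;> simp [h1, h2]
    rw [h1, h2] at h3
    linear_combination h3
  refine isConj_of_basis _ _ ![v, B *ᵥ v] ?_ ?_
  · intro c hc
    simp only [Fin.sum_univ_two, Matrix.cons_val_zero, Matrix.cons_val_one] at hc
    have e0 := congrFun hc 0
    have e1 := congrFun hc 1
    simp only [Pi.add_apply, Pi.smul_apply, smul_eq_mul, Pi.zero_apply] at e0 e1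
    ext i
    fin_cases i
    · refine (mul_eq_zero.1 (?_ : c 0 * _ = 0)).resolve_right hv
      linear_combination (B *ᵥ v) 1 * e0 - (B *ᵥ v) 0 * e1
    · refine (mul_eq_zero.1 (?_ : c 1 * _ = 0)).resolve_right hv
      linear_combination - v 1 * e0 + v 0 * e1
  · intro j
    fin_cases j
    · simp [Fin.sum_univ_two]
    · ext i
      fin_cases i <;>
        simp [Fin.sum_univ_two, Matrix.mulVec, dotProduct, Matrix.det_fin_two,
          Matrix.trace_fin_two] <;> ring

/-- Both matrices are conjugate to the same companion matrix. -/
lemma isConj_of_trace_det {B B' : Matrix (Fin 2) (Fin 2) F} (hB : ∀ c : F, B ≠ c • 1)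
    (hB' : ∀ c : F, B' ≠ c • 1) (ht : B.trace = B'.trace) (hd : B.det = B'.det) :
    IsConj B B' := by
  have h1 := isConj_companion_two hB
  rw [ht, hd] at h1
  exact h1.symm.trans (isConj_companion_two hB')

lemma isConj_of_charpoly_two {B B' : Matrix (Fin 2) (Fin 2) F} (hB : ∀ c : F, B ≠ c • 1)
    (hB' : ∀ c : F, B' ≠ c • 1) (h : B.charpoly = B'.charpoly) : IsConj B B' := by
  rw [Matrix.charpoly_fin_two, Matrix.charpoly_fin_two] at h
  have h0 := congrArg (Polynomial.eval 0) h
  have h1 := congrArg (fun P => P.coeff 1) h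
  simp at h0
  simp [coeff_C, coeff_X_pow] at h1
  exact isConj_of_trace_det hB hB' h1 h0

lemma ne_smul_one_of_offDiag {B : Matrix (Fin 2) (Fin 2) F} (h : B 0 1 ≠ 0 ∨ B 1 0 ≠ 0 ∨ B 0 0 ≠ B 1 1)
    (c : F) : B ≠ c • 1 := by
  rintro rfl
  simp at h

lemma isConj_diag {B : Matrix (Fin 2) (Fin 2) F} {a b : F} (hab : a ≠ b)
    (h : B.charpoly = (X - C a) * (X - C b)) : IsConj !![a, 0; 0, b] B := by
  obtain ⟨ht, hd⟩ := trace_det_of_charpoly h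
  refine isConj_of_trace_det (ne_smul_one_of_offDiag (by simp [hab])) ?_ ?_ ?_
  · rintro c rfl
    simp at ht hd
    -- A scalar matrix has vanishing discriminant, and `tr² - 4 det` is `(a - b)²`.
    refine hab (sub_eq_zero.1 (pow_eq_zero_iff (two_ne_zero)|>.1 (?_ : (a - b) ^ 2 = 0)))
    linear_combination (-(c + c) - (a + b)) * ht + 4 * hd
  · rw [ht]; simp [Matrix.trace_fin_two]
  · rw [hd]; simp [Matrix.det_fin_two]

/-- Outside the scalar case trace and determinant decide. Leaving `c` and `d` free admits upper and
lower Jordan blocks with any nonzero off-diagonal entry. -/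
lemma scalar_or_isConj_jordan {B : Matrix (Fin 2) (Fin 2) F} {a : F}
    (h : B.charpoly = (X - C a) * (X - C a)) :
    B = !![a, 0; 0, a] ∨ ∀ c d : F, c ≠ 0 ∨ d ≠ 0 → c * d = 0 → IsConj !![a, c; d, a] B := by
  obtain ⟨ht, hd⟩ := trace_det_of_charpoly h
  by_cases hs : ∃ c : F, B = c • 1
  · left
    obtain ⟨c, rfl⟩ := hs
    have h1 : (c • (1 : Matrix (Fin 2) (Fin 2) F)).charpoly.eval c = 0 := by
      rw [Matrix.eval_charpoly]; simp [Matrix.det_fin_two]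
    rw [h] at h1
    simp [sub_eq_zero] at h1
    subst h1
    ext i j
    fin_cases i <;> fin_cases j <;> simp
  · right
    intro c d hcd hcd0
    push Not at hs
    refine isConj_of_trace_det (ne_smul_one_of_offDiag (by simpa using hcd)) hs ?_ ?_
    · rw [ht]; simp [Matrix.trace_fin_two]
    · rw [hd]; simp [Matrix.det_fin_two, hcd0]

/-! ### A triple eigenvalue -/

/-- By Cayley–Hamilton `N = M - a` has `N³ = 0`; the three cases are `N = 0`, `N ≠ 0 = N²` and `N² ≠
0`. -/
lemma triple_cases {M : Matrix (Fin 3) (Fin 3) F} {a : F} (ha : a ≠ 0)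
    (h : M.charpoly = (X - C a) * ((X - C a) * (X - C a))) :
    M = !![a, 0, 0; 0, a, 0; 0, 0, a] ∨ IsConj !![a, 0, a; 0, a, 0; 0, 0, a] M ∨
      IsConj !![a, a, 0; 0, a, a; 0, 0, a] M := by
  have hCH := Matrix.aeval_self_charpoly M
  rw [h] at hCH
  simp only [map_mul, map_sub, aeval_X, aeval_C, Algebra.algebraMap_eq_smul_one] at hCH
  set N := M - a • (1 : Matrix (Fin 3) (Fin 3) F) with hN
  have hMv : ∀ v, M *ᵥ v = N *ᵥ v + a • v := fun v => by
    rw [hN, Matrix.sub_mulVec, Matrix.smul_mulVec, Matrix.one_mulVec]; simp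
  have hN3 : ∀ v, N *ᵥ (N *ᵥ (N *ᵥ v)) = 0 := fun v => by
    rw [Matrix.mulVec_mulVec, Matrix.mulVec_mulVec, mul_assoc, hCH, Matrix.zero_mulVec]
  by_cases h0 : N = 0
  · left
    rw [hN, sub_eq_zero] at h0
    rw [h0]
    ext i j
    fin_cases i <;> fin_cases j <;> simp
  right
  by_cases h2 : N * N = 0
  · left
    have hN2 : ∀ v, N *ᵥ (N *ᵥ v) = 0 := fun v => by
      rw [Matrix.mulVec_mulVec, h2, Matrix.zero_mulVec]
    obtain ⟨y, hy⟩ : ∃ y, N *ᵥ y ≠ 0 := by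
      by_contra! hc
      exact h0 (Matrix.ext_of_mulVec_single fun i => by rw [hc, Matrix.zero_mulVec])
    -- The image lies in the kernel, so the kernel has dimension at least 2 and contains a vector
    -- outside the line of `N y`.
    have hle : LinearMap.range N.mulVecLin ≤ LinearMap.ker N.mulVecLin := by
      rintro _ ⟨v, rfl⟩
      simpa using hN2 v
    have hrk := LinearMap.finrank_range_add_finrank_ker N.mulVecLin
    have hle' := Submodule.finrank_mono hle
    rw [Module.finrank_fin_fun] at hrk
    obtain ⟨x, hx, hx'⟩ : ∃ x, N *ᵥ x = 0 ∧ x ∉ Submodule.span F {N *ᵥ y} := by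
      by_contra! hc
      have : LinearMap.ker N.mulVecLin ≤ Submodule.span F {N *ᵥ y} := fun x hx => hc x (by simpa using hx)
      have h1 := Submodule.finrank_mono this
      have h3 := finrank_span_singleton (K := F) hy
      omega
    -- Scaling `y` by `a` makes the off-diagonal entry `a` rather than 1, as the normal form
    -- demands.
    refine isConj_of_basis _ _ ![N *ᵥ y, x, a • y] ?_ ?_
    · intro c hc
      simp only [Fin.sum_univ_three, Matrix.cons_val] at hc
      have h3 := congrArg (fun v => N *ᵥ v) hc
      simp only [Matrix.mulVec_add, Matrix.mulVec_smul, hN2, hx, smul_zero, zero_add,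
        Matrix.mulVec_zero, smul_smul, smul_eq_zero, hy, or_false, mul_eq_zero, ha] at h3
      rw [h3, zero_smul, add_zero] at hc
      have h4 : c 1 = 0 := by
        by_contra h4
        refine hx' (Submodule.mem_span_singleton.2 ⟨-(c 0 / c 1), ?_⟩)
        have : x = -((c 1)⁻¹ • (c 0 • (N *ᵥ y))) := by
          rw [eq_neg_of_add_eq_zero_left hc, smul_neg, neg_neg, smul_smul, inv_mul_cancel₀ h4,
            one_smul]
        conv_rhs => rw [this]
        rw [smul_smul, neg_smul, div_eq_inv_mul]
      rw [h4, zero_smul, add_zero, smul_eq_zero] at hc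
      have h5 := hc.resolve_right hy
      ext i; fin_cases i <;> assumption
    · intro j
      fin_cases j <;> simp [Fin.sum_univ_three, hMv, hN2, hx, Matrix.mulVec_smul, smul_smul]
  · right
    obtain ⟨v, hv⟩ : ∃ v, N *ᵥ (N *ᵥ v) ≠ 0 := by
      by_contra! hc
      refine h2 (Matrix.ext_of_mulVec_single fun i => ?_)
      rw [← Matrix.mulVec_mulVec, hc, Matrix.zero_mulVec]
    -- A Jordan chain whose vectors carry growing powers of `a`, again to obtain off-diagonal
    -- entries `a`.
    refine isConj_of_basis _ _ ![N *ᵥ (N *ᵥ v), a • (N *ᵥ v), (a * a) • v] ?_ ?_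
    · intro c hc
      simp only [Fin.sum_univ_three, Matrix.cons_val] at hc
      have h3 := congrArg (fun v => N *ᵥ (N *ᵥ v)) hc
      simp only [Matrix.mulVec_add, Matrix.mulVec_smul, hN3, smul_zero, zero_add,
        Matrix.mulVec_zero, smul_smul, smul_eq_zero, hv, or_false, mul_eq_zero, ha] at h3
      rw [h3, zero_smul, add_zero] at hc
      have h4 := congrArg (fun v => N *ᵥ v) hc
      simp only [Matrix.mulVec_add, Matrix.mulVec_smul, hN3, smul_zero, zero_add,
        Matrix.mulVec_zero, smul_smul, smul_eq_zero, hv, or_false, mul_eq_zero, ha] at h4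
      rw [h4, zero_smul, add_zero, smul_eq_zero] at hc
      have h5 := hc.resolve_right hv
      ext i; fin_cases i <;> assumption
    · intro j
      fin_cases j <;> simp [Fin.sum_univ_three, hMv, hCH, Matrix.mulVec_smul, smul_smul]

end ConjugacyClasses

namespace ConjugacyClasses

open Matrix GeometricSide

variable {F : Type*} [Field F]

/-! ### Every class is of exactly one type -/

lemma blockMat_diag (a b c : F) : blockMat !![a, 0; 0, b] c = !![a, 0, 0; 0, b, 0; 0, 0, c] := by
  simp [blockMat]

lemma charpoly_lower_two (a b c : F) :
    (!![a, 0; c, b] : Matrix (Fin 2) (Fin 2) F).charpoly = (X - C a) * (X - C b) :=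
  charpoly_of_trace_det (by simp [Matrix.trace_fin_two]) (by simp [Matrix.det_fin_two])

lemma charpoly_upper_three (a b c x y z : F) :
    (!![a, x, y; 0, b, z; 0, 0, c] : Matrix (Fin 3) (Fin 3) F).charpoly =
      (X - C a) * ((X - C b) * (X - C c)) := by
  rw [Matrix.charpoly, Matrix.det_fin_three]
  simp
  ring

lemma eval_charpoly_zero_ne {n : ℕ} (γ : GL (Fin n) F) : γ.1.charpoly.eval 0 ≠ 0 := by
  rw [Matrix.eval_charpoly, map_zero, zero_sub, Matrix.det_neg]
  exact mul_ne_zero (pow_ne_zero _ (neg_ne_zero.2 one_ne_zero))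
    (Matrix.isUnits_det_units γ).ne_zero

lemma exists_quadratic_of_not_irreducible {Q : F[X]} (hm : Q.Monic) (hd : Q.natDegree = 2)
    (h : ¬ Irreducible Q) : ∃ a b, Q = (X - C a) * (X - C b) := by
  rw [hm.irreducible_iff_roots_eq_zero_of_degree_le_three (by omega) (by omega)] at h
  obtain ⟨a, ha⟩ := Multiset.exists_mem_of_ne_zero h
  obtain ⟨R, hR⟩ := dvd_iff_isRoot.2 (mem_roots'.1 ha).2
  have hRm : R.Monic := (monic_X_sub_C a).of_mul_monic_left (hR ▸ hm)
  have hRd : R.natDegree = 1 := by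
    have := hd
    rw [hR, (monic_X_sub_C a).natDegree_mul hRm, natDegree_X_sub_C] at this
    omega
  refine ⟨a, -R.coeff 0, ?_⟩
  rw [hR]
  congr 1
  rw [C_neg, sub_neg_eq_add]
  exact (hRm.eq_X_add_C hRd)

/-- An invertible matrix with a simple rational eigenvalue. -/
lemma block_cases {γ : GL (Fin 3) F} {e : F} {Q : F[X]}
    (h : γ.1.charpoly = (X - C e) * Q) (hQ : Q.eval e ≠ 0) :
    (∃ g : Matrix (Fin 2) (Fin 2) F, ∃ e : Fˣ, Irreducible g.charpoly ∧
      IsConj (blockMat g e) γ.1) ∨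
    (∃ a b c : Fˣ, a ≠ b ∧ b ≠ c ∧ a ≠ c ∧
      IsConj !![(a : F), 0, 0; 0, (b : F), 0; 0, 0, (c : F)] γ.1) ∨
    (∃ a b : Fˣ, a ≠ b ∧ IsConj !![(a : F), 0, 0; 0, (a : F), 0; 0, 0, (b : F)] γ.1) ∨
    (∃ a b : Fˣ, a ≠ b ∧ IsConj !![(a : F), 0, 0; (a : F), (a : F), 0; 0, 0, (b : F)] γ.1) := by
  obtain ⟨B, hB, hconj⟩ := exists_block h hQ
  have h0 := eval_charpoly_zero_ne γ
  rw [h, eval_mul] at h0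
  have he : e ≠ 0 := by
    have := left_ne_zero_of_mul h0
    simpa using this
  have hQm : Q.Monic := hB ▸ Matrix.charpoly_monic B
  have hQd : Q.natDegree = 2 := by rw [← hB, Matrix.charpoly_natDegree_eq_dim]; simp
  by_cases hirr : Irreducible Q
  · exact Or.inl ⟨B, Units.mk0 e he, hB ▸ hirr, hconj⟩
  right
  obtain ⟨a, b, hab⟩ := exists_quadratic_of_not_irreducible hQm hQd hirr
  have h1 := right_ne_zero_of_mul h0
  rw [hab] at h1 hQ
  simp only [eval_mul, eval_sub, eval_X, eval_C, zero_sub, mul_ne_zero_iff, sub_ne_zero,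
    neg_ne_zero] at h1 hQ
  obtain ⟨ha0, hb0⟩ := h1
  obtain ⟨hea, heb⟩ := hQ
  by_cases hne : a = b
  · right
    subst hne
    rcases scalar_or_isConj_jordan (hB.trans hab) with hs | hj
    · left
      refine ⟨Units.mk0 a ha0, Units.mk0 e he, by simpa [Units.ext_iff] using hea.symm, ?_⟩
      rw [hs, blockMat_diag] at hconj
      exact hconj
    · right
      refine ⟨Units.mk0 a ha0, Units.mk0 e he, by simpa [Units.ext_iff] using hea.symm, ?_⟩
      refine IsConj.trans ?_ ((blockMat_isConj (hj 0 a (Or.inr ha0) (zero_mul a)) e).trans hconj)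
      simp [blockMat, IsConj.refl]
  · left
    refine ⟨Units.mk0 a ha0, Units.mk0 b hb0, Units.mk0 e he, ?_, ?_, ?_, ?_⟩
    · simpa [Units.ext_iff] using hne
    · simpa [Units.ext_iff] using heb.symm
    · simpa [Units.ext_iff] using hea.symm
    · have := (blockMat_isConj (isConj_diag hne (hB.trans hab)) e).trans hconj
      rwa [blockMat_diag] at this

section Types

variable {p : ℕ} [Fact p.Prime]

/-- The eight types of conjugacy classes. -/
def classType : Fin 8 → GL (Fin 3) (ZMod p) → Prop :=
  ![IsCentral, IsHyperbolic1, IsHyperbolic2, IsParabolic1, IsParabolic2, IsParabolic3,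
    IsElliptic1, IsElliptic2]

/-- Without rational roots the cubic is irreducible. A simple root splits off a block. If the root
found is multiple, the polynomial splits, and the remaining root either equals it, giving a triple
root, or is itself simple. -/
lemma exists_classType (γ : GL (Fin 3) (ZMod p)) : ∃ i, classType i γ := by
  have h0 := eval_charpoly_zero_ne γ
  have hm := Matrix.charpoly_monic γ.1
  have hd : γ.1.charpoly.natDegree = 3 := by rw [Matrix.charpoly_natDegree_eq_dim]; simp
  have key : ∀ {e : ZMod p} {Q : (ZMod p)[X]}, γ.1.charpoly = (X - C e) * Q → Q.eval e ≠ 0 →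
      ∃ i, classType i γ := by
    intro e Q h hQ
    rcases block_cases h hQ with ⟨g, e, hg⟩ | h | h | h
    · exact ⟨7, g, e, hg⟩
    · exact ⟨2, h⟩
    · exact ⟨1, h⟩
    · exact ⟨5, h⟩
  by_cases hirr : Irreducible γ.1.charpoly
  · exact ⟨6, hirr⟩
  rw [hm.irreducible_iff_roots_eq_zero_of_degree_le_three (by omega) (by omega)] at hirr
  obtain ⟨e, he⟩ := Multiset.exists_mem_of_ne_zero hirr
  obtain ⟨Q, hQ⟩ := dvd_iff_isRoot.2 (mem_roots'.1 he).2
  by_cases hQe : Q.eval e = 0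
  swap
  · exact key hQ hQe
  obtain ⟨R, hR⟩ := dvd_iff_isRoot.2 hQe
  have hQm : Q.Monic := (monic_X_sub_C e).of_mul_monic_left (hQ ▸ hm)
  have hRm : R.Monic := (monic_X_sub_C e).of_mul_monic_left (hR ▸ hQm)
  have hRd : R.natDegree = 1 := by
    have := hd
    rw [hQ, (monic_X_sub_C e).natDegree_mul hQm, natDegree_X_sub_C, hR,
      (monic_X_sub_C e).natDegree_mul hRm, natDegree_X_sub_C] at this
    omega
  obtain ⟨b, hb⟩ : ∃ b, R = X - C b := ⟨-R.coeff 0, by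
    rw [C_neg, sub_neg_eq_add]; exact hRm.eq_X_add_C hRd⟩
  have h3 : γ.1.charpoly = (X - C b) * ((X - C e) * (X - C e)) := by
    rw [hQ, hR, hb]; ring
  by_cases hbe : b = e
  · subst hbe
    have hb0 : b ≠ 0 := by
      rw [h3] at h0
      simpa using h0
    rcases triple_cases hb0 h3 with h | h | h
    · exact ⟨0, Units.mk0 b hb0, h⟩
    · exact ⟨3, Units.mk0 b hb0, h⟩
    · exact ⟨4, Units.mk0 b hb0, h⟩
  · exact key h3 (by simpa [sub_eq_zero] using hbe)

/-- Satisfying a monic quadratic equation. -/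
def IsQuadratic (M : Matrix (Fin 3) (Fin 3) F) : Prop := ∃ x y : F, M * M = x • M + y • 1

lemma isQuadratic_of_isConj {M N : Matrix (Fin 3) (Fin 3) F} (h : IsConj M N)
    (hM : IsQuadratic M) : IsQuadratic N := by
  obtain ⟨c, hc⟩ := h
  obtain ⟨x, y, hxy⟩ := hM
  refine ⟨x, y, ?_⟩
  have h1 : N = c.1 * M * (c⁻¹).1 := by
    rw [hc.eq, mul_assoc, ← Units.val_mul, mul_inv_cancel, Units.val_one, mul_one]
  have h2 : (c⁻¹).1 * c.1 = 1 := by rw [← Units.val_mul, inv_mul_cancel, Units.val_one]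
  have h3 : c.1 * (c⁻¹).1 = 1 := by rw [← Units.val_mul, mul_inv_cancel, Units.val_one]
  calc N * N = c.1 * M * ((c⁻¹).1 * c.1) * M * (c⁻¹).1 := by rw [h1]; simp only [mul_assoc]
    _ = c.1 * (M * M) * (c⁻¹).1 := by rw [h2]; simp only [mul_assoc, one_mul]
    _ = x • N + y • 1 := by
      rw [hxy, mul_add, add_mul, mul_smul_comm, mul_smul_comm, smul_mul_assoc, smul_mul_assoc,
        mul_one, h3, h1]

lemma eq_smul_one_of_isConj {M N : Matrix (Fin 3) (Fin 3) F} (h : IsConj M N) {c : F}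
    (hN : N = c • 1) : M = c • 1 := by
  obtain ⟨u, hu⟩ := h
  have h1 := hu.eq
  rw [hN, smul_mul_assoc, one_mul] at h1
  have h2 : (u⁻¹).1 * u.1 = 1 := by rw [← Units.val_mul, inv_mul_cancel, Units.val_one]
  calc M = (u⁻¹).1 * (u.1 * M) := by rw [← mul_assoc, h2, one_mul]
    _ = c • 1 := by rw [h1, mul_smul_comm, h2]

open Classical in
/-- The index of the type of a class, read off from its invariants. -/
def typeIndex (M : Matrix (Fin 3) (Fin 3) F) : Fin 8 :=
  -- Rational roots are counted first with multiplicity, then without; when they repeat, the degree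
  -- of the minimal polynomial separates diagonalizable from Jordan form.
  if M.charpoly.roots.card = 0 then 6
  else if M.charpoly.roots.card = 1 then 7
  else if M.charpoly.roots.toFinset.card = 3 then 2
  else if M.charpoly.roots.toFinset.card = 2 then (if IsQuadratic M then 1 else 5)
  else if ∃ c : F, M = c • 1 then 0 else if IsQuadratic M then 3 else 4

lemma roots_three {M : Matrix (Fin 3) (Fin 3) F} {a b c : F}
    (h : M.charpoly = (X - C a) * ((X - C b) * (X - C c))) : M.charpoly.roots = {a, b, c} := by
  rw [h, roots_mul (mul_ne_zero (X_sub_C_ne_zero _) (mul_ne_zero (X_sub_C_ne_zero _)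
    (X_sub_C_ne_zero _))), roots_mul (mul_ne_zero (X_sub_C_ne_zero _) (X_sub_C_ne_zero _))]
  simp only [roots_X_sub_C]
  rfl

/-- The invariants are unchanged by conjugation and are evaluated on the normal forms; this proves
that the types are mutually exclusive. -/
lemma typeIndex_of_classType {i : Fin 8} {γ : GL (Fin 3) (ZMod p)} (h : classType i γ) :
    typeIndex γ.1 = i := by
  classical
  fin_cases i
  · obtain ⟨a, h⟩ := h
    have hr : γ.1.charpoly.roots = {(a : ZMod p), (a : ZMod p), (a : ZMod p)} :=
      roots_three (by rw [h, charpoly_upper_three])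
    have hs : ∃ c : ZMod p, γ.1 = c • 1 := ⟨a, by
      rw [h]; ext i j; fin_cases i <;> fin_cases j <;> simp⟩
    simp [typeIndex, hr, hs]
  · obtain ⟨a, b, hab, h⟩ := h
    have hab' : (a : ZMod p) ≠ b := fun h => hab (Units.ext h)
    have hr : γ.1.charpoly.roots = {(a : ZMod p), (a : ZMod p), (b : ZMod p)} :=
      roots_three (by rw [← charpoly_eq_of_isConj h, charpoly_upper_three])
    have hq : IsQuadratic γ.1 := isQuadratic_of_isConj h ⟨a + b, -(a * b), by
      ext i j
      fin_cases i <;> fin_cases j <;> simp [Matrix.mul_apply, Fin.sum_univ_three] <;> ring⟩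
    simp [typeIndex, hr, hq, hab']
  · obtain ⟨a, b, c, hab, hbc, hac, h⟩ := h
    have hab' : (a : ZMod p) ≠ b := fun h => hab (Units.ext h)
    have hbc' : (b : ZMod p) ≠ c := fun h => hbc (Units.ext h)
    have hac' : (a : ZMod p) ≠ c := fun h => hac (Units.ext h)
    have hr : γ.1.charpoly.roots = {(a : ZMod p), (b : ZMod p), (c : ZMod p)} :=
      roots_three (by rw [← charpoly_eq_of_isConj h, charpoly_upper_three])
    simp [typeIndex, hr, hab', hbc', hac']
  · obtain ⟨a, h⟩ := h
    have hr : γ.1.charpoly.roots = {(a : ZMod p), (a : ZMod p), (a : ZMod p)} :=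
      roots_three (by rw [← charpoly_eq_of_isConj h, charpoly_upper_three])
    have hs : ¬ ∃ c : ZMod p, γ.1 = c • 1 := by
      rintro ⟨c, hc⟩
      have h1 := eq_smul_one_of_isConj h hc
      have h2 := congrFun (congrFun h1 0) 2
      simp at h2
    have hq : IsQuadratic γ.1 := isQuadratic_of_isConj h ⟨2 * a, -(a * a), by
      ext i j
      fin_cases i <;> fin_cases j <;> simp [Matrix.mul_apply, Fin.sum_univ_three] <;> ring⟩
    simp [typeIndex, hr, hs, hq]
  · obtain ⟨a, h⟩ := h
    have hr : γ.1.charpoly.roots = {(a : ZMod p), (a : ZMod p), (a : ZMod p)} :=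
      roots_three (by rw [← charpoly_eq_of_isConj h, charpoly_upper_three])
    have hq : ¬ IsQuadratic γ.1 := by
      intro hq
      obtain ⟨x, y, hxy⟩ := isQuadratic_of_isConj h.symm hq
      have h2 := congrFun (congrFun hxy 0) 2
      simp [Matrix.mul_apply, Fin.sum_univ_three] at h2
    have hs : ¬ ∃ c : ZMod p, γ.1 = c • 1 := by
      rintro ⟨c, hc⟩
      exact hq ⟨0, c * c, by rw [hc]; ext i j; simp [mul_assoc]⟩
    simp [typeIndex, hr, hs, hq]
  · obtain ⟨a, b, hab, h⟩ := h
    have hab' : (a : ZMod p) ≠ b := fun h => hab (Units.ext h)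
    have hr : γ.1.charpoly.roots = {(b : ZMod p), (a : ZMod p), (a : ZMod p)} :=
      roots_three (by
        rw [← charpoly_eq_of_isConj h, ← charpoly_lower_two (a : ZMod p) a a, ← charpoly_blockMat]
        simp [blockMat])
    have hq : ¬ IsQuadratic γ.1 := by
      intro hq
      obtain ⟨x, y, hxy⟩ := isQuadratic_of_isConj h.symm hq
      have h0 := congrFun (congrFun hxy 0) 0
      have h1 := congrFun (congrFun hxy 1) 0
      have h2 := congrFun (congrFun hxy 2) 2
      simp [Matrix.mul_apply, Fin.sum_univ_three] at h0 h1 h2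
      -- The entry below the diagonal forces the linear coefficient `2a`; comparing the diagonal
      -- entries then gives `(a - b)² = 0`.
      have h3 : x = a + a := mul_right_cancel₀ a.ne_zero (by linear_combination -h1)
      subst h3
      refine hab' (sub_eq_zero.1 (pow_eq_zero_iff (two_ne_zero)|>.1
        (?_ : ((a : ZMod p) - b) ^ 2 = 0)))
      linear_combination h2 - h0
    simp [typeIndex, hr, hq, hab'.symm]
  · have h' : Irreducible γ.1.charpoly := h
    rw [(Matrix.charpoly_monic γ.1).irreducible_iff_roots_eq_zero_of_degree_le_three
      (by rw [Matrix.charpoly_natDegree_eq_dim]; simp)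
      (by rw [Matrix.charpoly_natDegree_eq_dim]; simp)] at h'
    simp [typeIndex, h']
  · obtain ⟨g, e, hg, h⟩ := h
    have hr : γ.1.charpoly.roots = {(e : ZMod p)} := by
      have h1 : γ.1.charpoly = (X - C (e : ZMod p)) * g.charpoly := by
        rw [← charpoly_eq_of_isConj h]; exact charpoly_blockMat g e
      rw [(Matrix.charpoly_monic g).irreducible_iff_roots_eq_zero_of_degree_le_three
        (by rw [Matrix.charpoly_natDegree_eq_dim]; simp)
        (by rw [Matrix.charpoly_natDegree_eq_dim]; simp)] at hg
      rw [h1, roots_mul (mul_ne_zero (X_sub_C_ne_zero _) (Matrix.charpoly_monic g).ne_zero), hg]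
      simp
    simp [typeIndex, hr]

lemma existsUnique_classType (γ : GL (Fin 3) (ZMod p)) : ∃! i, classType i γ := by
  obtain ⟨i, hi⟩ := exists_classType γ
  exact ⟨i, hi, fun j hj => (typeIndex_of_classType hj).symm.trans (typeIndex_of_classType hi)⟩

end Types

end ConjugacyClasses

namespace ConjugacyClasses

open Matrix GeometricSide UpperHalfSpace SpectralSide

variable {F : Type*} [Field F]

/-! ### Orders of centralizers -/

lemma GL_comm_iff {n : ℕ} (g h : GL (Fin n) F) : g * h = h * g ↔ g.1 * h.1 = h.1 * g.1 := by
  rw [Units.ext_iff, Units.val_mul, Units.val_mul]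

lemma mem_centralizer_iff_val {n : ℕ} (g h : GL (Fin n) F) :
    g ∈ Subgroup.centralizer ({h} : Set (GL (Fin n) F)) ↔ g.1 * h.1 = h.1 * g.1 := by
  rw [Subgroup.mem_centralizer_singleton_iff, GL_comm_iff]

lemma centralizer_scalar_mul {n : ℕ} (c : Fˣ) (g : GL (Fin n) F) :
    Subgroup.centralizer ({scalarGL c * g} : Set (GL (Fin n) F)) = Subgroup.centralizer {g} := by
  ext h
  rw [Subgroup.mem_centralizer_singleton_iff, Subgroup.mem_centralizer_singleton_iff, ← mul_assoc,
    ← scalarGL_comm, mul_assoc, mul_assoc, mul_right_inj]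

/-- The block matrix `diag(eκ, e)`. -/
def blockGL (κ : GL (Fin 2) F) (e : Fˣ) : GL (Fin 3) F := scalarGL e * affineMat κ 0 0

lemma blockGL_val (κ : GL (Fin 2) F) (e : Fˣ) :
    (blockGL κ e).1 = blockMat ((e : F) • κ.1) e := by
  rw [blockGL, Units.val_mul, scalarGL_val, affineMat_val]
  ext i j
  fin_cases i <;> fin_cases j <;> simp [blockMat]

/-- `1` is not an eigenvalue of `κ`. -/
def NoFixed (κ : GL (Fin 2) F) : Prop :=
  (κ.1 0 0 - 1) * (κ.1 1 1 - 1) - κ.1 0 1 * κ.1 1 0 ≠ 0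

lemma blockGL_comm_of_comm {κ A : GL (Fin 2) F} (h : A * κ = κ * A) (d e : Fˣ) :
    blockGL A d * blockGL κ e = blockGL κ e * blockGL A d := by
  have : affineMat A 0 0 * affineMat κ 0 0 = affineMat κ 0 0 * affineMat A 0 0 := by
    rw [affineMat_mul, affineMat_mul, h]; simp
  rw [blockGL, blockGL]
  calc scalarGL d * affineMat A 0 0 * (scalarGL e * affineMat κ 0 0)
      = scalarGL d * (affineMat A 0 0 * scalarGL e) * affineMat κ 0 0 := by group
    _ = scalarGL d * scalarGL e * (affineMat A 0 0 * affineMat κ 0 0) := by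
      rw [← scalarGL_comm]; group
    _ = scalarGL e * (scalarGL d * affineMat κ 0 0) * affineMat A 0 0 := by
      rw [this, scalarGL_comm d]; group
    _ = _ := by rw [scalarGL_comm d]; group

/-- Since `κ` does not have the eigenvalue 1, a commuting matrix preserves the splitting into plane
and line. Dividing it by its corner entry `d` leaves an element of the centralizer of `κ`. -/
lemma card_centralizer_blockGL [Fintype F] [DecidableEq F] {κ : GL (Fin 2) F} (hκ : NoFixed κ)
    (e : Fˣ) : (Nat.card (Subgroup.centralizer ({blockGL κ e} : Set (GL (Fin 3) F))) : ℂ) =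
      Nat.card (Subgroup.centralizer ({κ} : Set (GL (Fin 2) F))) * ((Fintype.card F : ℂ) - 1) := by
  let φ : Subgroup.centralizer ({κ} : Set (GL (Fin 2) F)) × Fˣ →
      Subgroup.centralizer ({blockGL κ e} : Set (GL (Fin 3) F)) := fun a =>
    ⟨blockGL a.1.1 a.2, Subgroup.mem_centralizer_singleton_iff.2
      (blockGL_comm_of_comm (Subgroup.mem_centralizer_singleton_iff.1 a.1.2) _ _)⟩
  have hφ : Function.Bijective φ := by
    constructor
    · rintro ⟨⟨A, hA⟩, d⟩ ⟨⟨A', hA'⟩, d'⟩ h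
      have h1 : blockGL A d = blockGL A' d' := congrArg Subtype.val h
      have h2 : ∀ i j, (blockGL A d).1 i j = (blockGL A' d').1 i j := fun i j => by rw [h1]
      simp only [blockGL_val] at h2
      have hd : d = d' := Units.ext (by simpa [blockMat] using h2 2 2)
      subst hd
      rw [blockGL, blockGL, mul_right_inj] at h1
      obtain ⟨rfl, -, -⟩ := affineMat_injective h1
      rfl
    · rintro ⟨g, hg⟩
      rw [blockGL, centralizer_scalar_mul, mem_centralizer_iff_val, affineMat_val] at hg
      have h := fun i j => congrFun (congrFun hg i) j
      simp only [Matrix.mul_apply, Fin.sum_univ_three] at h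
      have h02 := h 0 2
      have h12 := h 1 2
      have h20 := h 2 0
      have h21 := h 2 1
      simp at h02 h12 h20 h21
      -- The off-diagonal column and row are annihilated by `κ - 1`, from the left and from the
      -- right, so they vanish.
      have e02 : g.1 0 2 = 0 := by
        refine (mul_eq_zero.1 (?_ : _ * g.1 0 2 = 0)).resolve_left hκ
        linear_combination -(κ.1 1 1 - 1) * h02 + κ.1 0 1 * h12
      have e12 : g.1 1 2 = 0 := by
        refine (mul_eq_zero.1 (?_ : _ * g.1 1 2 = 0)).resolve_left hκ
        linear_combination -(κ.1 0 0 - 1) * h12 + κ.1 1 0 * h02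
      have e20 : g.1 2 0 = 0 := by
        refine (mul_eq_zero.1 (?_ : _ * g.1 2 0 = 0)).resolve_left hκ
        linear_combination (κ.1 1 1 - 1) * h20 - κ.1 1 0 * h21
      have e21 : g.1 2 1 = 0 := by
        refine (mul_eq_zero.1 (?_ : _ * g.1 2 1 = 0)).resolve_left hκ
        linear_combination (κ.1 0 0 - 1) * h21 - κ.1 0 1 * h20
      have hdet := (Matrix.isUnits_det_units g).ne_zero
      rw [Matrix.det_fin_three, e02, e12, e20, e21] at hdet
      have hdet' : (g.1 0 0 * g.1 1 1 - g.1 0 1 * g.1 1 0) * g.1 2 2 ≠ 0 := fun h0 =>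
        hdet (by linear_combination h0)
      have hd : g.1 2 2 ≠ 0 := right_ne_zero_of_mul hdet'
      let A : GL (Fin 2) F := Matrix.GeneralLinearGroup.mkOfDetNeZero
        !![g.1 0 0 / g.1 2 2, g.1 0 1 / g.1 2 2; g.1 1 0 / g.1 2 2, g.1 1 1 / g.1 2 2] (by
          rw [Matrix.det_fin_two_of]
          intro h0
          field_simp at h0
          exact left_ne_zero_of_mul hdet' (by linear_combination h0))
      have hAval : A.1 = !![g.1 0 0 / g.1 2 2, g.1 0 1 / g.1 2 2; g.1 1 0 / g.1 2 2,
        g.1 1 1 / g.1 2 2] := rfl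
      have hA : A ∈ Subgroup.centralizer ({κ} : Set (GL (Fin 2) F)) := by
        rw [mem_centralizer_iff_val, hAval]
        have h00 := h 0 0
        have h01 := h 0 1
        have h10 := h 1 0
        have h11 := h 1 1
        simp at h00 h01 h10 h11
        rw [e20, e02] at *
        rw [e21, e12] at *
        ext i j
        fin_cases i <;> fin_cases j <;>
          simp only [Matrix.mul_apply, Fin.sum_univ_two, Fin.zero_eta, Fin.mk_one, Matrix.of_apply,
            Matrix.cons_val', Matrix.cons_val_zero, Matrix.cons_val_one,
            Matrix.cons_val_fin_one] <;> field_simp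
        · linear_combination h00
        · linear_combination h01
        · linear_combination h10
        · linear_combination h11
      refine ⟨⟨⟨A, hA⟩, Units.mk0 _ hd⟩, Subtype.ext (Units.ext ?_)⟩
      change (blockGL A (Units.mk0 _ hd)).1 = g.1
      rw [blockGL_val, hAval]
      ext i j
      fin_cases i <;> fin_cases j <;> simp [blockMat, e02, e12, e20, e21] <;> field_simp
  rw [← Nat.card_congr (Equiv.ofBijective φ hφ), Nat.card_prod, Nat.cast_mul,
    Nat.card_eq_fintype_card (α := Fˣ), card_units_cast]

lemma card_centralizer_scalarGL [Fintype F] [DecidableEq F] {n : ℕ} (c : Fˣ) :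
    Nat.card (Subgroup.centralizer ({scalarGL c} : Set (GL (Fin n) F))) = Nat.card (GL (Fin n) F) := by
  have : Subgroup.centralizer ({scalarGL c} : Set (GL (Fin n) F)) = ⊤ := by
    rw [eq_top_iff]
    intro g _
    rw [Subgroup.mem_centralizer_singleton_iff, scalarGL_comm]
  rw [this, Nat.card_congr Subgroup.topEquiv.toEquiv]

lemma card_centralizer_diag [Fintype F] [DecidableEq F] {a b : Fˣ} (hab : a ≠ b) :
    (Nat.card (Subgroup.centralizer ({upperGL a b 0} : Set (GL (Fin 2) F))) : ℂ) =
      ((Fintype.card F : ℂ) - 1) ^ 2 := by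
  have hab' : (a : F) ≠ b := fun h => hab (Units.ext h)
  let φ : Fˣ × Fˣ → Subgroup.centralizer ({upperGL a b 0} : Set (GL (Fin 2) F)) := fun t =>
    ⟨upperGL t.1 t.2 0, by
      rw [mem_centralizer_iff_val, upperGL_val, upperGL_val]
      ext i j
      fin_cases i <;> fin_cases j <;> simp [mul_comm]⟩
  have hφ : Function.Bijective φ := by
    constructor
    · rintro ⟨x, y⟩ ⟨x', y'⟩ h
      have h1 := congrArg (fun k => k.1.1 0 0) h
      have h2 := congrArg (fun k => k.1.1 1 1) h
      simp [φ, upperGL_val] at h1 h2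
      exact Prod.ext (Units.ext h1) (Units.ext h2)
    · rintro ⟨g, hg⟩
      rw [mem_centralizer_iff_val, upperGL_val] at hg
      have h01 := congrFun (congrFun hg 0) 1
      have h10 := congrFun (congrFun hg 1) 0
      simp [Matrix.mul_apply, Fin.sum_univ_two] at h01 h10
      have e01 : g.1 0 1 = 0 := by
        refine (mul_eq_zero.1 (?_ : _ * g.1 0 1 = 0)).resolve_left (sub_ne_zero.2 hab')
        linear_combination -h01
      have e10 : g.1 1 0 = 0 := by
        refine (mul_eq_zero.1 (?_ : _ * g.1 1 0 = 0)).resolve_left (sub_ne_zero.2 hab')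
        linear_combination h10
      have hD := inv_det_ne_zero g
      rw [e01, zero_mul, sub_zero] at hD
      refine ⟨⟨Units.mk0 _ (left_ne_zero_of_mul hD), Units.mk0 _ (right_ne_zero_of_mul hD)⟩,
        Subtype.ext (GL_two_ext ?_ ?_ ?_ ?_)⟩ <;> simp [φ, upperGL_val, e01, e10]
  rw [← Nat.card_congr (Equiv.ofBijective φ hφ), Nat.card_eq_fintype_card, Fintype.card_prod,
    Nat.cast_mul, card_units_cast, sq]

lemma card_centralizer_jordan [Fintype F] [DecidableEq F] (c : Fˣ) :
    (Nat.card (Subgroup.centralizer ({upperGL c c 1} : Set (GL (Fin 2) F))) : ℂ) =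
      (Fintype.card F : ℂ) * ((Fintype.card F : ℂ) - 1) := by
  let φ : F × Fˣ → Subgroup.centralizer ({upperGL c c 1} : Set (GL (Fin 2) F)) := fun t =>
    ⟨upperGL t.2 t.2 t.1, by
      rw [mem_centralizer_iff_val, upperGL_val, upperGL_val]
      ext i j
      fin_cases i <;> fin_cases j <;> simp <;> ring⟩
  have hφ : Function.Bijective φ := by
    constructor
    · rintro ⟨x, y⟩ ⟨x', y'⟩ h
      have h1 := congrArg (fun k => k.1.1 0 0) h
      have h2 := congrArg (fun k => k.1.1 0 1) h
      simp [φ, upperGL_val] at h1 h2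
      exact Prod.ext h2 (Units.ext h1)
    · rintro ⟨g, hg⟩
      rw [mem_centralizer_iff_val, upperGL_val] at hg
      have h00 := congrFun (congrFun hg 0) 0
      have h01 := congrFun (congrFun hg 0) 1
      simp [Matrix.mul_apply, Fin.sum_univ_two] at h01 h00
      have e10 : g.1 1 0 = 0 := by linear_combination -h00
      have e11 : g.1 1 1 = g.1 0 0 := by linear_combination -h01
      have hD := inv_det_ne_zero g
      rw [e10, mul_zero, sub_zero] at hD
      refine ⟨⟨g.1 0 1, Units.mk0 _ (left_ne_zero_of_mul hD)⟩,
        Subtype.ext (GL_two_ext ?_ ?_ ?_ ?_)⟩ <;> simp [φ, upperGL_val, e11, e10]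
  rw [← Nat.card_congr (Equiv.ofBijective φ hφ), Nat.card_eq_fintype_card, Fintype.card_prod,
    Nat.cast_mul, card_units_cast]

/-- The centralizer of an element of `GL₂` without eigenvalues is a nonsplit torus. -/
lemma card_centralizer_anisotropic [Fintype F] [DecidableEq F] {κ : GL (Fin 2) F}
    (hκ : Irreducible κ.1.charpoly) :
    (Nat.card (Subgroup.centralizer ({κ} : Set (GL (Fin 2) F))) : ℂ) =
      (Fintype.card F : ℂ) ^ 2 - 1 := by
  have hroot : ∀ z, (z - κ.1 0 0) * (z - κ.1 1 1) - κ.1 0 1 * κ.1 1 0 ≠ 0 := by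
    intro z hz
    have hdeg : κ.1.charpoly.natDegree = 2 := by rw [Matrix.charpoly_natDegree_eq_dim]; simp
    have hev : κ.1.charpoly.IsRoot z := by
      rw [IsRoot, Matrix.charpoly_fin_two, Matrix.trace_fin_two, Matrix.det_fin_two]
      simp
      linear_combination hz
    have := (degree_eq_one_of_irreducible_of_root hκ hev)
    rw [degree_eq_natDegree hκ.ne_zero, hdeg] at this
    norm_num at this
  have h10 : κ.1 1 0 ≠ 0 := fun h0 => hroot (κ.1 0 0) (by rw [h0]; ring)
  -- The matrix `x + y κ` with `y ≠ 0` is singular only if `-x / y` is an eigenvalue of `κ`. Thus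
  -- the nonzero elements of `F[κ]` are all invertible.
  have hdet : ∀ v : F × F, v ≠ 0 →
      Matrix.det !![v.1 + v.2 * κ.1 0 0, v.2 * κ.1 0 1; v.2 * κ.1 1 0, v.1 + v.2 * κ.1 1 1] ≠ 0 := by
    rintro ⟨x, y⟩ hv h0
    rw [Matrix.det_fin_two_of] at h0
    simp only at h0
    by_cases hy : y = 0
    · subst hy
      simp at h0
      exact hv (by rw [h0]; rfl)
    · refine hroot (-x / y) ?_
      field_simp
      linear_combination h0
  let φ : {v : F × F // v ≠ 0} → Subgroup.centralizer ({κ} : Set (GL (Fin 2) F)) := fun v =>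
    ⟨Matrix.GeneralLinearGroup.mkOfDetNeZero _ (hdet v.1 v.2), by
      rw [mem_centralizer_iff_val]
      change !![v.1.1 + v.1.2 * κ.1 0 0, v.1.2 * κ.1 0 1; v.1.2 * κ.1 1 0,
        v.1.1 + v.1.2 * κ.1 1 1] * κ.1 = κ.1 * !![v.1.1 + v.1.2 * κ.1 0 0, v.1.2 * κ.1 0 1;
        v.1.2 * κ.1 1 0, v.1.1 + v.1.2 * κ.1 1 1]
      ext i j
      fin_cases i <;> fin_cases j <;> simp [Matrix.mul_apply, Fin.sum_univ_two] <;> ring⟩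
  have hφv : ∀ v, (φ v).1.1 = !![v.1.1 + v.1.2 * κ.1 0 0, v.1.2 * κ.1 0 1; v.1.2 * κ.1 1 0,
    v.1.1 + v.1.2 * κ.1 1 1] := fun v => rfl
  have hφ : Function.Bijective φ := by
    constructor
    · rintro ⟨⟨x, y⟩, _⟩ ⟨⟨x', y'⟩, _⟩ h
      have h1 := congrArg (fun k => k.1.1 0 0) h
      have h2 := congrArg (fun k => k.1.1 1 0) h
      simp [hφv, h10] at h1 h2
      subst h2
      simp at h1
      simp [h1]
    · rintro ⟨g, hg⟩
      rw [mem_centralizer_iff_val] at hg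
      have h00 := congrFun (congrFun hg 0) 0
      have h10' := congrFun (congrFun hg 1) 0
      simp [Matrix.mul_apply, Fin.sum_univ_two] at h00 h10'
      have e1 : g.1 1 0 / κ.1 1 0 * κ.1 1 0 = g.1 1 0 := div_mul_cancel₀ _ h10
      have e2 : g.1 1 0 / κ.1 1 0 * κ.1 0 1 = g.1 0 1 := by
        rw [div_mul_eq_mul_div, div_eq_iff h10]; linear_combination -h00
      have e3 : g.1 0 0 - g.1 1 0 / κ.1 1 0 * κ.1 0 0 + g.1 1 0 / κ.1 1 0 * κ.1 1 1 = g.1 1 1 := by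
        field_simp; linear_combination -h10'
      refine ⟨⟨⟨g.1 0 0 - g.1 1 0 / κ.1 1 0 * κ.1 0 0, g.1 1 0 / κ.1 1 0⟩, ?_⟩,
        Subtype.ext (GL_two_ext ?_ ?_ ?_ ?_)⟩
      · intro h0
        simp only [Prod.mk_eq_zero] at h0
        obtain ⟨h0, h0'⟩ := h0
        rw [h0'] at e1 e2 e3 h0
        refine inv_det_ne_zero g ?_
        rw [← e1, ← e3]
        simp only [zero_mul, sub_zero] at h0
        rw [h0]; ring
      all_goals simp [hφv, e1, e2, e3]
  rw [← Nat.card_congr (Equiv.ofBijective φ hφ), Nat.card_eq_fintype_card,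
    Fintype.card_subtype_compl, Fintype.card_subtype_eq, Fintype.card_prod,
    Nat.cast_sub (Nat.mul_pos Fintype.card_pos Fintype.card_pos)]
  push_cast
  ring

end ConjugacyClasses

namespace ConjugacyClasses

open Matrix GeometricSide UpperHalfSpace SpectralSide

section Centralizers

variable {F : Type*} [Field F] [Fintype F] [DecidableEq F]

omit [Fintype F] [DecidableEq F] in
lemma GL_three_ext {g h : GL (Fin 3) F} (h00 : g.1 0 0 = h.1 0 0) (h01 : g.1 0 1 = h.1 0 1)
    (h02 : g.1 0 2 = h.1 0 2) (h10 : g.1 1 0 = h.1 1 0) (h11 : g.1 1 1 = h.1 1 1)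
    (h12 : g.1 1 2 = h.1 1 2) (h20 : g.1 2 0 = h.1 2 0) (h21 : g.1 2 1 = h.1 2 1)
    (h22 : g.1 2 2 = h.1 2 2) : g = h :=
  Matrix.GeneralLinearGroup.ext fun i j => by fin_cases i <;> fin_cases j <;> assumption

omit [DecidableEq F] in
lemma card_GL_three : (Nat.card (GL (Fin 3) F) : ℂ) = ((Fintype.card F : ℂ) ^ 3 - 1) *
    ((Fintype.card F : ℂ) ^ 3 - Fintype.card F) *
      ((Fintype.card F : ℂ) ^ 3 - (Fintype.card F : ℂ) ^ 2) := by
  have hq : 1 ≤ Fintype.card F := Fintype.card_pos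
  rw [Matrix.card_GL_field, Fin.prod_univ_three]
  push_cast [Nat.cast_sub (Nat.pow_le_pow_right hq (by decide : 0 ≤ 3)),
    Nat.cast_sub (Nat.pow_le_pow_right hq (by decide : 1 ≤ 3)),
    Nat.cast_sub (Nat.pow_le_pow_right hq (by decide : 2 ≤ 3))]
  have h0 : ((0 : Fin 3) : ℕ) = 0 := rfl
  have h1 : ((1 : Fin 3) : ℕ) = 1 := rfl
  have h2 : ((2 : Fin 3) : ℕ) = 2 := rfl
  rw [h0, h1, h2, Nat.cast_sub (Nat.pow_le_pow_right hq (by decide : 0 ≤ 3)),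
    Nat.cast_sub (Nat.pow_le_pow_right hq (by decide : 1 ≤ 3)),
    Nat.cast_sub (Nat.pow_le_pow_right hq (by decide : 2 ≤ 3))]
  push_cast
  ring

/-- An invertible upper triangular matrix. -/
def upperGL₃ (a b c : Fˣ) (x y z : F) : GL (Fin 3) F :=
  Matrix.GeneralLinearGroup.mkOfDetNeZero !![(a : F), x, y; 0, b, z; 0, 0, c] (by
    rw [Matrix.det_fin_three]; simp)

omit [Fintype F] [DecidableEq F] in
lemma upperGL₃_val (a b c : Fˣ) (x y z : F) :
    (upperGL₃ a b c x y z).1 = !![(a : F), x, y; 0, b, z; 0, 0, c] := rfl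

lemma card_centralizer_transvection :
    (Nat.card (Subgroup.centralizer ({affineMat 1 1 0} : Set (GL (Fin 3) F))) : ℂ) =
      (Fintype.card F : ℂ) ^ 3 * ((Fintype.card F : ℂ) - 1) ^ 2 := by
  have hval : (affineMat 1 1 0 : GL (Fin 3) F).1 = !![1, 0, 1; 0, 1, 0; 0, 0, 1] := by
    rw [affineMat_val]; simp
  let φ : Fˣ × Fˣ × F × F × F → Subgroup.centralizer ({affineMat 1 1 0} : Set (GL (Fin 3) F)) :=
    fun t => ⟨upperGL₃ t.1 t.2.1 t.1 t.2.2.1 t.2.2.2.1 t.2.2.2.2, by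
      rw [mem_centralizer_iff_val, hval, upperGL₃_val]
      ext i j
      fin_cases i <;> fin_cases j <;> simp [Matrix.mul_apply, Fin.sum_univ_three]
      ring⟩
  have hφ : Function.Bijective φ := by
    constructor
    · rintro ⟨a, b, x, y, z⟩ ⟨a', b', x', y', z'⟩ h
      have h1 : upperGL₃ a b a x y z = upperGL₃ a' b' a' x' y' z' := congrArg Subtype.val h
      have h2 := fun i j => congrArg (fun k : GL (Fin 3) F => k.1 i j) h1
      simp only [upperGL₃_val] at h2
      have e1 : a = a' := Units.ext (by simpa using h2 0 0)
      have e2 : b = b' := Units.ext (by simpa using h2 1 1)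
      have e3 : x = x' := by simpa using h2 0 1
      have e4 : y = y' := by simpa using h2 0 2
      have e5 : z = z' := by simpa using h2 1 2
      rw [e1, e2, e3, e4, e5]
    · rintro ⟨g, hg⟩
      rw [mem_centralizer_iff_val, hval] at hg
      have h := fun i j => congrFun (congrFun hg i) j
      simp only [Matrix.mul_apply, Fin.sum_univ_three] at h
      have h00 := h 0 0
      have h01 := h 0 1
      have h02 := h 0 2
      have h12 := h 1 2
      simp at h00 h01 h02 h12
      have h10 : g.1 1 0 = 0 := by linear_combination h12
      have h22 : g.1 2 2 = g.1 0 0 := by linear_combination -h02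
      have hdet := (Matrix.isUnits_det_units g).ne_zero
      rw [Matrix.det_fin_three, h00, h01, h10, h22] at hdet
      have hdet' : g.1 0 0 * g.1 1 1 ≠ 0 := fun h0 =>
        hdet (by linear_combination g.1 0 0 * h0)
      refine ⟨⟨Units.mk0 _ (left_ne_zero_of_mul hdet'), Units.mk0 _ (right_ne_zero_of_mul hdet'),
        g.1 0 1, g.1 0 2, g.1 1 2⟩, Subtype.ext (GL_three_ext ?_ ?_ ?_ ?_ ?_ ?_ ?_ ?_ ?_)⟩ <;>
        simp [φ, upperGL₃_val, h10, h00, h01, h22]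
  rw [← Nat.card_congr (Equiv.ofBijective φ hφ), Nat.card_eq_fintype_card]
  simp only [Fintype.card_prod, Nat.cast_mul, card_units_cast]
  ring

lemma card_centralizer_regular_unipotent :
    (Nat.card (Subgroup.centralizer ({affineMat (upperGL 1 1 1) 0 1} : Set (GL (Fin 3) F))) : ℂ) =
      (Fintype.card F : ℂ) ^ 2 * ((Fintype.card F : ℂ) - 1) := by
  have hval : (affineMat (upperGL 1 1 1) 0 1 : GL (Fin 3) F).1 = !![1, 1, 0; 0, 1, 1; 0, 0, 1] := by
    rw [affineMat_val, upperGL_val]; simp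
  let φ : Fˣ × F × F → Subgroup.centralizer ({affineMat (upperGL 1 1 1) 0 1} :
      Set (GL (Fin 3) F)) :=
    fun t => ⟨upperGL₃ t.1 t.1 t.1 t.2.1 t.2.2 t.2.1, by
      rw [mem_centralizer_iff_val, hval, upperGL₃_val]
      ext i j
      fin_cases i <;> fin_cases j <;> simp [Matrix.mul_apply, Fin.sum_univ_three] <;> ring⟩
  have hφ : Function.Bijective φ := by
    constructor
    · rintro ⟨a, x, y⟩ ⟨a', x', y'⟩ h
      have h1 : upperGL₃ a a a x y x = upperGL₃ a' a' a' x' y' x' := congrArg Subtype.val h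
      have h2 := fun i j => congrArg (fun k : GL (Fin 3) F => k.1 i j) h1
      simp only [upperGL₃_val] at h2
      have e1 : a = a' := Units.ext (by simpa using h2 0 0)
      have e3 : x = x' := by simpa using h2 0 1
      have e4 : y = y' := by simpa using h2 0 2
      rw [e1, e3, e4]
    · rintro ⟨g, hg⟩
      rw [mem_centralizer_iff_val, hval] at hg
      have h := fun i j => congrFun (congrFun hg i) j
      simp only [Matrix.mul_apply, Fin.sum_univ_three] at h
      have h00 := h 0 0
      have h01 := h 0 1
      have h02 := h 0 2
      have h10 := h 1 0
      have h11 := h 1 1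
      have h12 := h 1 2
      have h21 := h 2 1
      simp at h00 h01 h02 h10 h11 h12 h21
      have e10 : g.1 1 0 = 0 := by linear_combination h00
      have e20 : g.1 2 0 = 0 := by linear_combination h10
      have e21 : g.1 2 1 = 0 := by linear_combination -h11 + e10
      have e11 : g.1 1 1 = g.1 0 0 := by linear_combination -h01
      have e22 : g.1 2 2 = g.1 0 0 := by linear_combination -h12 + e11
      have e12 : g.1 1 2 = g.1 0 1 := by linear_combination -h02
      have hdet := (Matrix.isUnits_det_units g).ne_zero
      rw [Matrix.det_fin_three, e10, e20, e21, e11, e22] at hdet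
      have h0 : g.1 0 0 ≠ 0 := fun h0 => hdet (by rw [h0]; ring)
      refine ⟨⟨Units.mk0 _ h0, g.1 0 1, g.1 0 2⟩,
        Subtype.ext (GL_three_ext ?_ ?_ ?_ ?_ ?_ ?_ ?_ ?_ ?_)⟩ <;>
        simp [φ, upperGL₃_val, e10, e20, e21, e11, e22, e12]
  rw [← Nat.card_congr (Equiv.ofBijective φ hφ), Nat.card_eq_fintype_card]
  simp only [Fintype.card_prod, Nat.cast_mul, card_units_cast]
  ring

/-- The quadratic polynomials in a matrix. -/
def quadMat (M : Matrix (Fin 3) (Fin 3) F) (v : Fin 3 → F) : Matrix (Fin 3) (Fin 3) F :=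
  aeval M (C (v 0) + C (v 1) * X + C (v 2) * X ^ 2)

omit [Fintype F] [DecidableEq F] in
lemma quadMat_comm (M : Matrix (Fin 3) (Fin 3) F) (v : Fin 3 → F) :
    quadMat M v * M = M * quadMat M v := by
  have := (Commute.all (C (v 0) + C (v 1) * X + C (v 2) * X ^ 2) (X : F[X])).map (aeval M)
  rw [aeval_X] at this
  exact this.eq

omit [Fintype F] [DecidableEq F] in
lemma companion_mulVec (P : F[X]) : companion P *ᵥ ![1, 0, 0] = ![0, 1, 0] ∧
    companion P *ᵥ ![0, 1, 0] = ![0, 0, 1] := by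
  constructor <;> ext i <;> fin_cases i <;>
    simp [companion, Matrix.mulVec, dotProduct, Fin.sum_univ_three]

omit [Fintype F] [DecidableEq F] in
lemma quadMat_companion_mulVec (P : F[X]) (v : Fin 3 → F) :
    quadMat (companion P) v *ᵥ ![1, 0, 0] = v := by
  rw [quadMat, aeval_mulVec_quadratic, (companion_mulVec P).1, (companion_mulVec P).2]
  ext i; fin_cases i <;> simp

omit [Fintype F] [DecidableEq F] in
-- The first basis vector is cyclic, so a commuting matrix is determined by its value there.
lemma eq_of_comm_companion {P : F[X]} {A B : Matrix (Fin 3) (Fin 3) F}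
    (hA : A * companion P = companion P * A) (hB : B * companion P = companion P * B)
    (h : A *ᵥ ![1, 0, 0] = B *ᵥ ![1, 0, 0]) : A = B := by
  have h1 : A *ᵥ ![0, 1, 0] = B *ᵥ ![0, 1, 0] := by
    rw [← (companion_mulVec P).1, Matrix.mulVec_mulVec, Matrix.mulVec_mulVec, hA, hB,
      ← Matrix.mulVec_mulVec, ← Matrix.mulVec_mulVec, h]
  have h2 : A *ᵥ ![0, 0, 1] = B *ᵥ ![0, 0, 1] := by
    rw [← (companion_mulVec P).2, Matrix.mulVec_mulVec, Matrix.mulVec_mulVec, hA, hB,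
      ← Matrix.mulVec_mulVec, ← Matrix.mulVec_mulVec, h1]
  ext i j
  have h0 := congrFun h i
  have h1 := congrFun h1 i
  have h2 := congrFun h2 i
  simp [Matrix.mulVec, dotProduct, Fin.sum_univ_three] at h0 h1 h2
  fin_cases j <;> assumption

omit [Fintype F] [DecidableEq F] in
lemma charpoly_companion {P : F[X]} (hP : P.Monic) (h3 : P.natDegree = 3) :
    (companion P).charpoly = P := by
  conv_rhs => rw [sum_fin_three_range P hP h3]
  rw [Matrix.charpoly, Matrix.det_fin_three]
  simp [companion]
  ring

/-- Evaluation at the cyclic vector identifies the commuting matrices with the quadratic polynomials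
in the companion matrix. The nonzero ones are invertible because their kernel would contain a
noncyclic vector, which irreducibility excludes. -/
lemma card_centralizer_companion {P : F[X]} (hP : Irreducible P) (hm : P.Monic)
    (h3 : P.natDegree = 3) {γ : GL (Fin 3) F} (hγ : γ.1 = companion P) :
    (Nat.card (Subgroup.centralizer ({γ} : Set (GL (Fin 3) F))) : ℂ) =
      (Fintype.card F : ℂ) ^ 3 - 1 := by
  have hCH : aeval (companion P) P = 0 := by
    conv_lhs => rw [← charpoly_companion hm h3]
    rw [charpoly_companion hm h3]
    have := Matrix.aeval_self_charpoly (companion P)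
    rwa [charpoly_companion hm h3] at this
  have hdet : ∀ v : Fin 3 → F, v ≠ 0 → (quadMat (companion P) v).det ≠ 0 := by
    intro v hv h0
    obtain ⟨w, hw, h⟩ := Matrix.exists_mulVec_eq_zero_iff.2 h0
    rw [quadMat, aeval_mulVec_quadratic] at h
    obtain ⟨e0, e1, e2⟩ := cyclic_of_irreducible hP h3 hCH hw _ _ _ h
    exact hv (by ext i; fin_cases i <;> assumption)
  let φ : {v : Fin 3 → F // v ≠ 0} → Subgroup.centralizer ({γ} : Set (GL (Fin 3) F)) := fun v =>
    ⟨Matrix.GeneralLinearGroup.mkOfDetNeZero _ (hdet v.1 v.2), by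
      rw [mem_centralizer_iff_val, hγ]
      exact quadMat_comm _ _⟩
  have hφv : ∀ v, (φ v).1.1 = quadMat (companion P) v.1 := fun v => rfl
  have hφ : Function.Bijective φ := by
    constructor
    · rintro v v' h
      have h1 : quadMat (companion P) v.1 = quadMat (companion P) v'.1 := by
        rw [← hφv, ← hφv, h]
      have h2 := congrArg (fun M => M *ᵥ ![1, 0, 0]) h1
      simp only [quadMat_companion_mulVec] at h2
      exact Subtype.ext h2
    · rintro ⟨g, hg⟩
      rw [mem_centralizer_iff_val, hγ] at hg
      have hgv : g.1 = quadMat (companion P) (g.1 *ᵥ ![1, 0, 0]) :=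
        eq_of_comm_companion hg (quadMat_comm _ _) (quadMat_companion_mulVec _ _).symm
      refine ⟨⟨g.1 *ᵥ ![1, 0, 0], ?_⟩, Subtype.ext (Units.ext hgv.symm)⟩
      intro h0
      have h1 : g.1 = 0 := by
        rw [hgv, h0]; simp [quadMat]
      exact not_isUnit_zero (h1 ▸ g.isUnit)
  rw [← Nat.card_congr (Equiv.ofBijective φ hφ), Nat.card_eq_fintype_card,
    Fintype.card_subtype_compl, Fintype.card_subtype_eq, Fintype.card_fun, Fintype.card_fin,
    Nat.cast_sub (Nat.one_le_pow _ _ Fintype.card_pos)]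
  push_cast
  ring

end Centralizers

/-! ### Passage from `𝔽_p` to `F` and the contribution of block matrices. -/

section Terms

variable {p : ℕ} [Fact p.Prime] {F : Type*} [Field F] [Fintype F] [DecidableEq F]
  [Algebra (ZMod p) F] {δ : F} [hδ : Fact (∀ x : F, x ^ 3 ≠ δ)]

variable (F) in
/-- The embedding of `GL₂(𝔽_p)`. -/
def embed₂ : GL (Fin 2) (ZMod p) →* GL (Fin 2) F :=
  Matrix.GeneralLinearGroup.map (algebraMap (ZMod p) F)

omit [Fintype F] [DecidableEq F] in
lemma embed_val (g : GL (Fin 3) (ZMod p)) : (embed F p g).1 = g.1.map (algebraMap (ZMod p) F) := rfl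

omit [Fintype F] [DecidableEq F] in
lemma embed₂_val (g : GL (Fin 2) (ZMod p)) : (embed₂ F g).1 = g.1.map (algebraMap (ZMod p) F) := rfl

omit [Fintype F] [DecidableEq F] in
lemma embed_scalar_affine (e : (ZMod p)ˣ) (κ : GL (Fin 2) (ZMod p)) (x y : ZMod p) :
    embed F p (scalarGL e * affineMat κ x y) = scalarGL (Units.map (algebraMap (ZMod p) F) e) *
      affineMat (embed₂ F κ) (algebraMap (ZMod p) F x) (algebraMap (ZMod p) F y) := by
  apply Units.ext
  rw [embed_val, Units.val_mul, Units.val_mul, scalarGL_val, scalarGL_val, affineMat_val,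
    affineMat_val, embed₂_val]
  ext i j
  fin_cases i <;> fin_cases j <;> simp [-algebraMap_smul]

omit [Fintype F] [DecidableEq F] in
lemma noFixed_embed₂ {κ : GL (Fin 2) (ZMod p)} (h : NoFixed κ) : NoFixed (embed₂ F κ) := by
  intro h0
  rw [embed₂_val] at h0
  simp only [Matrix.map_apply] at h0
  refine h ((algebraMap (ZMod p) F).injective ?_)
  simpa using h0

lemma conjSum_embed_scalar_affine {f : GL (Fin 3) F → ℂ} (hf : BiInvariant δ f) (e : (ZMod p)ˣ)
    (κ : GL (Fin 2) (ZMod p)) (x y : ZMod p) :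
    conjSum f (embed F p (scalarGL e * affineMat κ x y)) = conjSum f
      (affineMat (embed₂ F κ) (algebraMap (ZMod p) F x) (algebraMap (ZMod p) F y)) := by
  rw [embed_scalar_affine, conjSum_scalar_mul hf]

lemma conjSum_embed_blockGL {f : GL (Fin 3) F → ℂ} (hf : BiInvariant δ f) (e : (ZMod p)ˣ)
    {κ : GL (Fin 2) (ZMod p)} (h : NoFixed κ) :
    conjSum f (embed F p (blockGL κ e)) = ((Fintype.card F : ℂ) ^ 3 - 1) *
      (Nat.card (Subgroup.centralizer ({embed₂ F κ} : Set (GL (Fin 2) F))) *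
        horocycle δ f (embed₂ F κ).1) := by
  rw [blockGL, conjSum_embed_scalar_affine hf, map_zero, conjSum_affineMat hf _ (noFixed_embed₂ h)]

lemma p_sub_one_ne_zero : (p : ℂ) - 1 ≠ 0 := by
  have := (Fact.out : p.Prime).one_lt
  rw [sub_ne_zero]
  exact_mod_cast this.ne.symm

/-- The contribution of a type of classes represented by block matrices `e · diag(κ, 1)`. -/
lemma geometricSum_block {M : Type*} [Fintype M] (κ : M → GL (Fin 2) (ZMod p))
    (T : GL (Fin 3) (ZMod p) → Prop) (N : ℕ) (k c : ℂ) (hN : N ≠ 0) (hκ : ∀ m, NoFixed (κ m))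
    (hT : ∀ γ, T γ → ∃ m e, IsConj (blockGL (κ m) e) γ)
    (hr : ∀ m e γ, IsConj (blockGL (κ m) e) γ → T γ)
    (hcount : ∀ m e, Nat.card {m' : M × (ZMod p)ˣ //
      IsConj (blockGL (κ m) e) (blockGL (κ m'.1) m'.2)} = N)
    (hk : ∀ m, (Nat.card (Subgroup.centralizer ({κ m} : Set (GL (Fin 2) (ZMod p)))) : ℂ) = k)
    (hc : ∀ m, (Nat.card (Subgroup.centralizer ({embed₂ F (κ m)} : Set (GL (Fin 2) F))) : ℂ) = c)
    {f : GL (Fin 3) F → ℂ} (hf : BiInvariant δ f) :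
    geometricSum (embed F p) T f = ((Fintype.card F : ℂ) ^ 3 - 1) * c / (N * k) *
      ∑ m, horocycle δ f (embed₂ F (κ m)).1 := by
  rw [geometricSum_of_param (embed F p) (fun m : M × (ZMod p)ˣ => blockGL (κ m.1) m.2) T N
    (k * ((p : ℂ) - 1)) hN (fun γ hγ => by
      obtain ⟨m, e, h⟩ := hT γ hγ
      exact ⟨(m, e), h⟩) (fun m => hr m.1 m.2) (fun m => hcount m.1 m.2) (fun m => by
      rw [card_centralizer_blockGL (hκ m.1), hk, ZMod.card])]
  -- The orbital sum does not see the scalar `e`; its `p - 1` values cancel the factor `p - 1` in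
  -- the order of the centralizer.
  simp_rw [conjSum_embed_blockGL hf _ (hκ _), hc]
  rw [Fintype.sum_prod_type]
  simp only [Finset.sum_const, Finset.card_univ, card_units_cast, ZMod.card, nsmul_eq_mul,
    ← Finset.mul_sum]
  have := p_sub_one_ne_zero (p := p)
  have hN' : (N : ℂ) ≠ 0 := Nat.cast_ne_zero.2 hN
  field_simp

end Terms

end ConjugacyClasses

/-! ### Central elements and parabolic elements with one eigenvalue. -/

namespace ConjugacyClasses

open Matrix GeometricSide UpperHalfSpace SpectralSide

lemma card_isConj_eq_one {Γ M : Type*} [Group Γ] (r : M → Γ)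
    (h : ∀ m m', IsConj (r m) (r m') → m = m') (m : M) :
    Nat.card {m' // IsConj (r m) (r m')} = 1 :=
  Nat.card_eq_one_iff_unique.2
    ⟨⟨fun a b => Subtype.ext ((h m _ a.2).symm.trans (h m _ b.2))⟩, ⟨⟨m, IsConj.refl _⟩⟩⟩

variable {p : ℕ} [Fact p.Prime] {F : Type*} [Field F] [Fintype F] [DecidableEq F]
  [Algebra (ZMod p) F] {δ : F} [hδ : Fact (∀ x : F, x ^ 3 ≠ δ)]

omit [Fact p.Prime] in
-- The triple eigenvalue is a class invariant, so distinct scalars give distinct classes.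
lemma triple_root_unique {K : Type*} [Field K] {M N : Matrix (Fin 3) (Fin 3) K} {a b : K}
    (hM : M.charpoly = (X - C a) * ((X - C a) * (X - C a)))
    (hN : N.charpoly = (X - C b) * ((X - C b) * (X - C b))) (h : IsConj M N) : a = b := by
  have h1 := congrArg (Polynomial.eval a) (charpoly_eq_of_isConj h)
  rw [hM, hN] at h1
  simp at h1
  exact sub_eq_zero.1 h1

section

variable {K : Type*} [Field K] (a : Kˣ)

lemma scalarGL_three_val : (scalarGL a : GL (Fin 3) K).1 =
    !![(a : K), 0, 0; 0, (a : K), 0; 0, 0, (a : K)] := by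
  rw [scalarGL_val]
  ext i j
  fin_cases i <;> fin_cases j <;> simp

lemma scalarGL_mul_transvection_val : (scalarGL a * affineMat 1 1 0 : GL (Fin 3) K).1 =
    !![(a : K), 0, (a : K); 0, (a : K), 0; 0, 0, (a : K)] := by
  rw [Units.val_mul, scalarGL_val, affineMat_val]
  ext i j
  fin_cases i <;> fin_cases j <;> simp

lemma scalarGL_mul_regular_unipotent_val :
    (scalarGL a * affineMat (upperGL 1 1 1) 0 1 : GL (Fin 3) K).1 =
      !![(a : K), (a : K), 0; 0, (a : K), (a : K); 0, 0, (a : K)] := by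
  rw [Units.val_mul, scalarGL_val, affineMat_val, upperGL_val]
  ext i j
  fin_cases i <;> fin_cases j <;> simp

end

lemma p_ne_zero_complex : (p : ℂ) ≠ 0 := Nat.cast_ne_zero.2 (Fact.out : p.Prime).ne_zero

lemma p_pow_sub_one_ne_zero {k : ℕ} (hk : k ≠ 0) : (p : ℂ) ^ k - 1 ≠ 0 := by
  have := Nat.one_lt_pow hk (Fact.out : p.Prime).one_lt
  rw [sub_ne_zero]
  exact_mod_cast this.ne'

omit [Fintype F] [DecidableEq F] in
lemma onHq_basePoint {f : GL (Fin 3) F → ℂ} (hf : BiInvariant δ f) :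
    onHq f (basePoint δ) = f 1 := by
  rw [← onHq_smul hf, one_smul]

lemma geometricSum_central {f : GL (Fin 3) F → ℂ} (hf : BiInvariant δ f) :
    geometricSum (embed F p) IsCentral f = centralTerm p δ f := by
  rw [geometricSum_of_param (embed F p) (fun a : (ZMod p)ˣ => scalarGL a) IsCentral 1
    _ one_ne_zero ?_ ?_ (card_isConj_eq_one _ ?_) (fun m => by rw [card_centralizer_scalarGL]) f]
  · have h1 : ∀ a : (ZMod p)ˣ, conjSum f (embed F p (scalarGL a)) =
        Nat.card (GL (Fin 3) F) * onHq f (basePoint δ) := by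
      intro a
      have h2 : scalarGL a = scalarGL a * affineMat (1 : GL (Fin 2) (ZMod p)) 0 0 := by
        rw [left_eq_mul]
        refine Units.ext ?_
        rw [affineMat_val]
        ext i j
        fin_cases i <;> fin_cases j <;> simp
      rw [h2, conjSum_embed_scalar_affine hf, map_one, map_zero]
      have h3 : affineMat (1 : GL (Fin 2) F) 0 0 = 1 := by
        refine Units.ext ?_
        rw [affineMat_val]
        ext i j
        fin_cases i <;> fin_cases j <;> simp
      rw [h3, conjSum, onHq_basePoint hf]
      simp
    simp_rw [h1]
    rw [Finset.sum_const, Finset.card_univ, nsmul_eq_mul, card_units_cast, card_GL_three,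
      card_GL_three, ZMod.card, centralTerm]
    have := p_sub_one_ne_zero (p := p)
    have := p_ne_zero_complex (p := p)
    have h3 := p_pow_sub_one_ne_zero (p := p) three_ne_zero
    have h2 := p_pow_sub_one_ne_zero (p := p) two_ne_zero
    have e1 : (p : ℂ) ^ 3 - p = p * (p ^ 2 - 1) := by ring
    have e2 : (p : ℂ) ^ 3 - p ^ 2 = p ^ 2 * (p - 1) := by ring
    rw [e1, e2]
    push_cast
    field_simp
  · rintro γ ⟨a, ha⟩
    exact ⟨a, Units.ext ((scalarGL_three_val a).trans ha.symm) ▸ IsConj.refl _⟩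
  · intro a γ h
    refine ⟨a, ?_⟩
    rw [← scalarGL_three_val]
    exact (eq_smul_one_of_isConj ((isConj_units_iff _ _).1 h).symm (scalarGL_val a)).trans
      (scalarGL_val a).symm
  · intro a b h
    exact Units.ext (triple_root_unique
      (by rw [scalarGL_three_val, charpoly_upper_three])
      (by rw [scalarGL_three_val, charpoly_upper_three]) ((isConj_units_iff _ _).1 h))

lemma geometricSum_parabolic1 {f : GL (Fin 3) F → ℂ} (hf : BiInvariant δ f) :
    geometricSum (embed F p) IsParabolic1 f = parabolicTerm1 p δ f := by
  rw [geometricSum_of_param (embed F p) (fun a : (ZMod p)ˣ => scalarGL a * affineMat 1 1 0)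
    IsParabolic1 1 _ one_ne_zero ?_ ?_ (card_isConj_eq_one _ ?_)
    (fun m => by rw [centralizer_scalar_mul, card_centralizer_transvection]) f]
  · simp_rw [conjSum_embed_scalar_affine hf, map_one, map_zero, conjSum_transvection hf]
    rw [Finset.sum_const, Finset.card_univ, nsmul_eq_mul, card_units_cast, ZMod.card,
      parabolicTerm1]
    have := p_sub_one_ne_zero (p := p)
    have := p_ne_zero_complex (p := p)
    push_cast
    field_simp
  · rintro γ ⟨a, ha⟩
    refine ⟨a, ?_⟩
    rwa [isConj_units_iff, scalarGL_mul_transvection_val]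
  · intro a γ h
    refine ⟨a, ?_⟩
    rwa [isConj_units_iff, scalarGL_mul_transvection_val] at h
  · intro a b h
    exact Units.ext (triple_root_unique
      (by rw [scalarGL_mul_transvection_val, charpoly_upper_three])
      (by rw [scalarGL_mul_transvection_val, charpoly_upper_three]) ((isConj_units_iff _ _).1 h))

lemma geometricSum_parabolic2 {f : GL (Fin 3) F → ℂ} (hf : BiInvariant δ f) :
    geometricSum (embed F p) IsParabolic2 f = parabolicTerm2 p δ f := by
  have hemb : embed₂ F (upperGL (1 : (ZMod p)ˣ) 1 1) = upperGL 1 1 1 := by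
    refine Units.ext ?_
    rw [embed₂_val, upperGL_val, upperGL_val]
    ext i j
    fin_cases i <;> fin_cases j <;> simp
  rw [geometricSum_of_param (embed F p)
    (fun a : (ZMod p)ˣ => scalarGL a * affineMat (upperGL 1 1 1) 0 1)
    IsParabolic2 1 _ one_ne_zero ?_ ?_ (card_isConj_eq_one _ ?_)
    (fun m => by rw [centralizer_scalar_mul, card_centralizer_regular_unipotent]) f]
  · simp_rw [conjSum_embed_scalar_affine hf, hemb, map_one, map_zero, conjSum_regular_unipotent hf]
    rw [Finset.sum_const, Finset.card_univ, nsmul_eq_mul, card_units_cast, ZMod.card,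
      parabolicTerm2]
    have := p_sub_one_ne_zero (p := p)
    have := p_ne_zero_complex (p := p)
    push_cast
    field_simp
  · rintro γ ⟨a, ha⟩
    refine ⟨a, ?_⟩
    rwa [isConj_units_iff, scalarGL_mul_regular_unipotent_val]
  · intro a γ h
    refine ⟨a, ?_⟩
    rwa [isConj_units_iff, scalarGL_mul_regular_unipotent_val] at h
  · intro a b h
    exact Units.ext (triple_root_unique
      (by rw [scalarGL_mul_regular_unipotent_val, charpoly_upper_three])
      (by rw [scalarGL_mul_regular_unipotent_val, charpoly_upper_three])
      ((isConj_units_iff _ _).1 h))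

end ConjugacyClasses

/-! ### Classes with a rational eigenvalue split off: hyperbolic and third parabolic terms. -/

namespace ConjugacyClasses

open Matrix GeometricSide UpperHalfSpace SpectralSide

section Field

variable {K : Type*} [Field K]

lemma isConj_blockGL_iff (κ : GL (Fin 2) K) (e : Kˣ) (γ : GL (Fin 3) K) :
    IsConj (blockGL κ e) γ ↔ IsConj (blockMat ((e : K) • κ.1) e) γ.1 := by
  rw [isConj_units_iff, blockGL_val]

lemma charpoly_blockGL {κ : GL (Fin 2) K} {a b : K} (h : κ.1.charpoly = (X - C a) * (X - C b))
    (e : Kˣ) : (blockGL κ e).1.charpoly = (X - C (e : K)) * ((X - C (e * a)) * (X - C (e * b))) := by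
  obtain ⟨ht, hd⟩ := trace_det_of_charpoly h
  rw [blockGL_val, charpoly_blockMat, charpoly_of_trace_det (a := (e : K) * a) (b := e * b)]
  · rw [Matrix.trace_smul, ht, smul_eq_mul, mul_add]
  · rw [Matrix.det_smul, hd, Fintype.card_fin]; ring

lemma roots_blockGL {κ : GL (Fin 2) K} {a b : K} (h : κ.1.charpoly = (X - C a) * (X - C b))
    (e : Kˣ) : (blockGL κ e).1.charpoly.roots = {(e : K), e * a, e * b} :=
  roots_three (charpoly_blockGL h e)

lemma noFixed_of_charpoly {κ : GL (Fin 2) K} {a b : K}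
    (h : κ.1.charpoly = (X - C a) * (X - C b)) (ha : a ≠ 1) (hb : b ≠ 1) : NoFixed κ := by
  obtain ⟨ht, hd⟩ := trace_det_of_charpoly h
  rw [Matrix.trace_fin_two] at ht
  rw [Matrix.det_fin_two] at hd
  have : (κ.1 0 0 - 1) * (κ.1 1 1 - 1) - κ.1 0 1 * κ.1 1 0 = (a - 1) * (b - 1) := by
    linear_combination hd - ht
  rw [NoFixed, this]
  exact mul_ne_zero (sub_ne_zero.2 ha) (sub_ne_zero.2 hb)

omit [Field K] in
lemma double_multiset_unique {x y x' y' : K} (hxy : x ≠ y) (h : ({y, x, x} : Multiset K) = {y', x', x'}) :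
    x = x' ∧ y = y' := by
  classical
  have hx : x ∈ ({y', x', x'} : Multiset K) := by rw [← h]; simp
  have hy : y ∈ ({y', x', x'} : Multiset K) := by rw [← h]; simp
  simp only [Multiset.insert_eq_cons, Multiset.mem_cons, Multiset.mem_singleton, or_self] at hx hy
  rcases hx with rfl | rfl <;> rcases hy with rfl | rfl
  · exact absurd rfl hxy
  · have := congrArg (Multiset.count x) h
    simp [hxy] at this
  · exact ⟨rfl, rfl⟩
  · exact absurd rfl hxy

/-- The eigenvalues are `e` once and `e a` twice, distinct because `a ≠ 1`; their multiplicities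
reveal which is which, and so both `e` and `a`. -/
lemma double_root_unique {κ κ' : GL (Fin 2) K} {a a' e e' : Kˣ} (ha : a ≠ 1)
    (h : κ.1.charpoly = (X - C (a : K)) * (X - C (a : K)))
    (h' : κ'.1.charpoly = (X - C (a' : K)) * (X - C (a' : K)))
    (hc : IsConj (blockGL κ e) (blockGL κ' e')) : a = a' ∧ e = e' := by
  have hr := congrArg Polynomial.roots (charpoly_eq_of_isConj ((isConj_units_iff _ _).1 hc))
  rw [roots_blockGL h, roots_blockGL h'] at hr
  have hne : (e : K) * a ≠ e := by
    intro h0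
    refine ha (Units.ext ?_)
    have := mul_left_cancel₀ e.ne_zero (h0.trans (mul_one (e : K)).symm)
    simpa using this
  obtain ⟨h1, h2⟩ := double_multiset_unique hne hr
  have he : e = e' := Units.ext h2
  subst he
  exact ⟨Units.ext (mul_left_cancel₀ e.ne_zero h1), rfl⟩

lemma isConj_diag_three {M : Matrix (Fin 3) (Fin 3) K} {x y z : K} (hxy : x ≠ y) (hxz : x ≠ z)
    (hyz : y ≠ z) (h : M.charpoly = (X - C z) * ((X - C x) * (X - C y))) :
    IsConj (blockMat !![x, 0; 0, y] z) M := by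
  obtain ⟨B, hB, hBM⟩ := exists_block h (by
    simp [sub_eq_zero, hxz.symm, hyz.symm])
  exact (blockMat_isConj (isConj_diag hxy hB) z).trans hBM

lemma scalarGL_two_charpoly (a : Kˣ) : (scalarGL a : GL (Fin 2) K).1.charpoly =
    (X - C (a : K)) * (X - C (a : K)) := by
  rw [scalarGL_val]
  exact charpoly_of_trace_det (by simp [mul_two]) (by simp [sq])

lemma upperGL_charpoly (a b : Kˣ) (x : K) : (upperGL a b x).1.charpoly =
    (X - C (a : K)) * (X - C (b : K)) := by
  rw [upperGL_val]
  exact charpoly_of_trace_det (by simp [Matrix.trace_fin_two]) (by simp [Matrix.det_fin_two])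

end Field

variable {p : ℕ} [Fact p.Prime] {F : Type*} [Field F] [Fintype F] [DecidableEq F]
  [Algebra (ZMod p) F] {δ : F} [hδ : Fact (∀ x : F, x ^ 3 ≠ δ)]

omit [Fintype F] [DecidableEq F] in
lemma embed₂_scalarGL (a : (ZMod p)ˣ) :
    embed₂ F (scalarGL a) = scalarGL (Units.map (algebraMap (ZMod p) F) a) := by
  refine Units.ext ?_
  rw [embed₂_val, scalarGL_val, scalarGL_val]
  ext i j
  fin_cases i <;> fin_cases j <;> simp [-algebraMap_smul]

omit [Fintype F] [DecidableEq F] in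
lemma embed₂_upperGL (a b : (ZMod p)ˣ) (x : ZMod p) :
    embed₂ F (upperGL a b x) = upperGL (Units.map (algebraMap (ZMod p) F) a)
      (Units.map (algebraMap (ZMod p) F) b) (algebraMap (ZMod p) F x) := by
  refine Units.ext ?_
  rw [embed₂_val, upperGL_val, upperGL_val]
  ext i j
  fin_cases i <;> fin_cases j <;> simp

lemma geometricSum_hyperbolic1 {f : GL (Fin 3) F → ℂ} (hf : BiInvariant δ f) :
    geometricSum (embed F p) IsHyperbolic1 f = hyperbolicTerm1 p δ f := by
  rw [geometricSum_block (M := {a : (ZMod p)ˣ // a ≠ 1}) (fun a => scalarGL a.1) IsHyperbolic1 1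
    (Nat.card (GL (Fin 2) (ZMod p))) (Nat.card (GL (Fin 2) F)) one_ne_zero ?_ ?_ ?_ ?_
    (fun m => by rw [card_centralizer_scalarGL])
    (fun m => by rw [embed₂_scalarGL, card_centralizer_scalarGL]) hf]
  · rw [hyperbolicTerm1, card_GL_two, card_GL_two, ZMod.card,
      Finset.sum_subtype (p := fun a : (ZMod p)ˣ => a ≠ 1) _ (fun a => by simp)]
    refine congrArg₂ (· * ·) ?_ ?_
    · push_cast; ring
    · refine Finset.sum_congr rfl fun a _ => ?_
      congr 1
      rw [embed₂_scalarGL, scalarGL_val]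
      ext i j
      fin_cases i <;> fin_cases j <;> simp
  · rintro ⟨a, ha⟩
    have ha' : (a : ZMod p) ≠ 1 := fun h => ha (Units.ext h)
    exact noFixed_of_charpoly (scalarGL_two_charpoly a) ha' ha'
  · rintro γ ⟨a, b, hab, h⟩
    -- Dividing by the simple eigenvalue: `diag(a, a, b) = b · diag(a/b, a/b, 1)`.
    refine ⟨⟨a / b, fun h => hab (div_eq_one.1 h)⟩, b, ?_⟩
    rw [isConj_blockGL_iff, scalarGL_val]
    convert h
    ext i j
    fin_cases i <;> fin_cases j <;> simp [blockMat, mul_div_cancel₀]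
  · rintro ⟨a, ha⟩ e γ h
    refine ⟨e * a, e, fun h => ha (mul_eq_left.1 h), ?_⟩
    rw [isConj_blockGL_iff, scalarGL_val] at h
    convert h
    ext i j
    fin_cases i <;> fin_cases j <;> simp [blockMat]
  · intro m e
    refine card_isConj_eq_one (fun m : {a : (ZMod p)ˣ // a ≠ 1} × (ZMod p)ˣ =>
      blockGL (scalarGL m.1.1) m.2) ?_ (m, e)
    rintro ⟨⟨a, ha⟩, e⟩ ⟨⟨a', ha'⟩, e'⟩ h
    obtain ⟨rfl, rfl⟩ := double_root_unique ha (scalarGL_two_charpoly a)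
      (scalarGL_two_charpoly a') h
    rfl

lemma geometricSum_parabolic3 {f : GL (Fin 3) F → ℂ} (hf : BiInvariant δ f) :
    geometricSum (embed F p) IsParabolic3 f = parabolicTerm3 p δ f := by
  -- The type is defined by a lower Jordan block, while the horocycle transform is taken at an upper
  -- one.
  have hconj : ∀ a b c : ZMod p, b ≠ 0 → c ≠ 0 → IsConj !![a, b; 0, a] !![a, 0; c, a] := by
    intro a b c hb hc
    refine isConj_of_trace_det (ne_smul_one_of_offDiag (by simp [hb]))
      (ne_smul_one_of_offDiag (by simp [hc])) ?_ ?_ <;>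
      simp [Matrix.trace_fin_two, Matrix.det_fin_two]
  rw [geometricSum_block (M := {a : (ZMod p)ˣ // a ≠ 1}) (fun a => upperGL a.1 a.1 1) IsParabolic3 1
    _ ((Fintype.card F : ℂ) * (Fintype.card F - 1)) one_ne_zero ?_ ?_ ?_ ?_
    (fun m => by rw [card_centralizer_jordan])
    (fun m => by rw [embed₂_upperGL, map_one, card_centralizer_jordan]) hf]
  · rw [parabolicTerm3, ZMod.card,
      Finset.sum_subtype (p := fun a : (ZMod p)ˣ => a ≠ 1) _ (fun a => by simp)]
    refine congrArg₂ (· * ·) ?_ ?_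
    · push_cast; ring
    · refine Finset.sum_congr rfl fun a _ => ?_
      congr 1
      rw [embed₂_upperGL, upperGL_val]
      ext i j
      fin_cases i <;> fin_cases j <;> simp
  · rintro ⟨a, ha⟩
    have ha' : (a : ZMod p) ≠ 1 := fun h => ha (Units.ext h)
    exact noFixed_of_charpoly (upperGL_charpoly a a 1) ha' ha'
  · rintro γ ⟨a, b, hab, h⟩
    refine ⟨⟨a / b, fun h => hab (div_eq_one.1 h)⟩, b, ?_⟩
    rw [isConj_blockGL_iff, upperGL_val]
    have h1 := blockMat_isConj (hconj a b a b.ne_zero a.ne_zero) (b : ZMod p)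
    have h2 : blockMat !![(a : ZMod p), 0; (a : ZMod p), (a : ZMod p)] b =
      !![(a : ZMod p), 0, 0; (a : ZMod p), (a : ZMod p), 0; 0, 0, (b : ZMod p)] := by
      simp [blockMat]
    rw [h2] at h1
    refine IsConj.trans ?_ (h1.trans h)
    convert IsConj.refl _
    ext i j
    fin_cases i <;> fin_cases j <;> simp [mul_div_cancel₀]
  · rintro ⟨a, ha⟩ e γ h
    refine ⟨e * a, e, fun h => ha (mul_eq_left.1 h), ?_⟩
    rw [isConj_blockGL_iff, upperGL_val] at h
    refine IsConj.trans ?_ h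
    have h1 := blockMat_isConj (hconj (e * a) e (e * a) e.ne_zero (e * a).ne_zero).symm (e : ZMod p)
    convert h1 using 1
    · simp [blockMat]
    · simp [blockMat]
  · intro m e
    refine card_isConj_eq_one (fun m : {a : (ZMod p)ˣ // a ≠ 1} × (ZMod p)ˣ =>
      blockGL (upperGL m.1.1 m.1.1 1) m.2) ?_ (m, e)
    rintro ⟨⟨a, ha⟩, e⟩ ⟨⟨a', ha'⟩, e'⟩ h
    obtain ⟨rfl, rfl⟩ := double_root_unique ha (upperGL_charpoly a a 1)
      (upperGL_charpoly a' a' 1) h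
    rfl

/-- A parameter is an ordering of the three distinct eigenvalues: the first is the scalar `e`, the
ratios of the others to it are the block. The class remembers only the unordered set, whence `3! =
6`. -/
lemma card_diag_three {K : Type*} [Field K] (m : {m : Kˣ × Kˣ // m.1 ≠ 1 ∧ m.2 ≠ 1 ∧ m.1 ≠ m.2})
    (e : Kˣ) : Nat.card {m' : {m : Kˣ × Kˣ // m.1 ≠ 1 ∧ m.2 ≠ 1 ∧ m.1 ≠ m.2} × Kˣ //
      IsConj (blockGL (upperGL m.1.1 m.1.2 0) e) (blockGL (upperGL m'.1.1.1 m'.1.1.2 0) m'.2)} =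
      6 := by
  let t : {m : Kˣ × Kˣ // m.1 ≠ 1 ∧ m.2 ≠ 1 ∧ m.1 ≠ m.2} × Kˣ → Fin 3 → Kˣ := fun m =>
    ![m.2, m.2 * m.1.1.1, m.2 * m.1.1.2]
  have htinj : ∀ m, Function.Injective (t m) := by
    rintro ⟨⟨⟨a, b⟩, ha, hb, hab⟩, e⟩ i j h
    simp only at ha hb hab
    fin_cases i <;> fin_cases j <;> simp [t, ha, hb, hab, hab.symm] at h ⊢
  have hchar : ∀ m, (blockGL (upperGL m.1.1.1 m.1.1.2 0) m.2).1.charpoly =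
      ∏ i, (X - C (t m i : K)) := by
    intro m
    rw [charpoly_blockGL (upperGL_charpoly _ _ _), Fin.prod_univ_three, mul_assoc]
    simp [t]
  have hconj : ∀ m m', IsConj (blockGL (upperGL m.1.1.1 m.1.1.2 0) m.2)
      (blockGL (upperGL m'.1.1.1 m'.1.1.2 0) m'.2) ↔ ∃ σ : Equiv.Perm (Fin 3), t m' = t m ∘ σ := by
    intro m m'
    constructor
    · intro h
      have h1 := charpoly_eq_of_isConj ((isConj_units_iff _ _).1 h)
      rw [hchar, hchar] at h1
      have h2 : ∀ i, ∃ j, t m' i = t m j := by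
        intro i
        have h3 := congrArg (Polynomial.eval (t m' i : K)) h1
        rw [eval_prod, eval_prod, Finset.prod_eq_zero (s := Finset.univ)
          (f := fun j => eval (t m' i : K) (X - C (t m' j : K))) (Finset.mem_univ i) (by simp)] at h3
        obtain ⟨j, -, hj⟩ := Finset.prod_eq_zero_iff.1 h3
        exact ⟨j, Units.ext (sub_eq_zero.1 (by simpa using hj))⟩
      choose σ hσ using h2
      have hσi : Function.Injective σ := fun i j h => htinj m' (by rw [hσ, hσ, h])
      exact ⟨Equiv.ofBijective σ (Finite.injective_iff_bijective.1 hσi), funext hσ⟩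
    · rintro ⟨σ, hσ⟩
      rw [isConj_blockGL_iff]
      have h1 : (blockGL (upperGL m'.1.1.1 m'.1.1.2 0) m'.2).1.charpoly =
          ∏ i, (X - C (t m i : K)) := by
        rw [hchar, hσ, ← Equiv.prod_comp σ (fun i => X - C (t m i : K))]; rfl
      have hne : ∀ {i j}, i ≠ j → (t m i : K) ≠ t m j := fun hij h =>
        hij (htinj m (Units.ext h))
      rw [Fin.prod_univ_three, mul_assoc] at h1
      convert isConj_diag_three (hne (by decide)) (hne (by decide)) (hne (by decide)) h1 using 1
      rw [upperGL_val]
      simp [blockMat, t]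
  have hsurj : ∀ s : Fin 3 → Kˣ, Function.Injective s → ∃ m, t m = s := by
    intro s hs
    refine ⟨⟨⟨⟨s 1 / s 0, s 2 / s 0⟩, fun h => ?_, fun h => ?_, fun h => ?_⟩, s 0⟩, ?_⟩
    · exact absurd (hs (div_eq_one.1 h)) (by decide)
    · exact absurd (hs (div_eq_one.1 h)) (by decide)
    · exact absurd (hs (div_left_injective h)) (by decide)
    · ext i; fin_cases i <;> simp [t]
  have htt : Function.Injective t := by
    rintro ⟨⟨⟨a, b⟩, _⟩, e⟩ ⟨⟨⟨a', b'⟩, _⟩, e'⟩ h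
    have h0 : e = e' := congrFun h 0
    have h1 : e * a = e' * a' := congrFun h 1
    have h2 : e * b = e' * b' := congrFun h 2
    subst h0
    obtain rfl := mul_left_cancel h1
    obtain rfl := mul_left_cancel h2
    rfl
  have hσ : ∀ σ : Equiv.Perm (Fin 3), ∃ m', t m' = t (m, e) ∘ σ := fun σ =>
    hsurj _ ((htinj _).comp σ.injective)
  choose g hg using hσ
  have hbij : Function.Bijective (fun σ : Equiv.Perm (Fin 3) =>
      (⟨g σ, (hconj (m, e) (g σ)).2 ⟨σ, hg σ⟩⟩ :
        {m' : {m : Kˣ × Kˣ // m.1 ≠ 1 ∧ m.2 ≠ 1 ∧ m.1 ≠ m.2} × Kˣ //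
      IsConj (blockGL (upperGL m.1.1 m.1.2 0) e) (blockGL (upperGL m'.1.1.1 m'.1.1.2 0) m'.2)})) := by
    constructor
    · intro σ τ h
      have h1 : g σ = g τ := congrArg Subtype.val h
      have h2 := (hg σ).symm.trans ((congrArg t h1).trans (hg τ))
      exact Equiv.ext fun i => htinj _ (congrFun h2 i)
    · rintro ⟨m', hm'⟩
      obtain ⟨σ, hσ⟩ := (hconj (m, e) m').1 hm'
      exact ⟨σ, Subtype.ext (htt ((hg σ).trans hσ.symm))⟩
  rw [← Nat.card_congr (Equiv.ofBijective _ hbij), Nat.card_eq_fintype_card, Fintype.card_perm,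
    Fintype.card_fin]
  rfl

lemma geometricSum_hyperbolic2 {f : GL (Fin 3) F → ℂ} (hf : BiInvariant δ f) :
    geometricSum (embed F p) IsHyperbolic2 f = hyperbolicTerm2 p δ f := by
  rw [geometricSum_block (M := {m : (ZMod p)ˣ × (ZMod p)ˣ // m.1 ≠ 1 ∧ m.2 ≠ 1 ∧ m.1 ≠ m.2})
    (fun a => upperGL a.1.1 a.1.2 0) IsHyperbolic2 6
    _ (((Fintype.card F : ℂ) - 1) ^ 2) (by norm_num) ?_ ?_ ?_ card_diag_three
    (fun m => by rw [card_centralizer_diag m.2.2.2])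
    (fun m => by
      rw [embed₂_upperGL, map_zero, card_centralizer_diag]
      exact fun h => m.2.2.2 (Units.map_injective (algebraMap (ZMod p) F).injective h)) hf]
  · rw [hyperbolicTerm2, ZMod.card, ← Finset.sum_subtype (p := fun m : (ZMod p)ˣ × (ZMod p)ˣ =>
      m.1 ≠ 1 ∧ m.2 ≠ 1 ∧ m.1 ≠ m.2) {m | m.1 ≠ 1 ∧ m.2 ≠ 1 ∧ m.1 ≠ m.2} (fun a => by simp)
      (fun m => horocycle δ f (embed₂ F (upperGL m.1 m.2 0)).1)]
    have hsum : ∀ g : (ZMod p)ˣ → (ZMod p)ˣ → ℂ, ∑ m : (ZMod p)ˣ × (ZMod p)ˣ with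
        m.1 ≠ 1 ∧ m.2 ≠ 1 ∧ m.1 ≠ m.2, g m.1 m.2 =
        ∑ a : (ZMod p)ˣ with a ≠ 1, ∑ b : (ZMod p)ˣ with b ≠ 1 ∧ a ≠ b, g a b := by
      intro g
      simp only [Finset.sum_filter]
      rw [Fintype.sum_prod_type]
      refine Finset.sum_congr rfl fun a _ => ?_
      by_cases ha : a = 1 <;> simp [ha]
    rw [hsum fun a b => horocycle δ f (embed₂ F (upperGL a b 0)).1]
    refine congrArg₂ (· * ·) ?_ ?_
    -- The constants agree because `q³ - 1 = (q - 1)(q² + q + 1)`.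
    · push_cast; field_simp; ring
    · refine Finset.sum_congr rfl fun a _ => Finset.sum_congr rfl fun b _ => ?_
      congr 1
      rw [embed₂_upperGL, upperGL_val]
      ext i j
      fin_cases i <;> fin_cases j <;> simp
  · rintro ⟨⟨a, b⟩, ha, hb, hab⟩
    exact noFixed_of_charpoly (upperGL_charpoly a b 0) (fun h => ha (Units.ext h))
      (fun h => hb (Units.ext h))
  · rintro γ ⟨a, b, c, hab, hbc, hac, h⟩
    refine ⟨⟨⟨a / c, b / c⟩, fun h => hac (div_eq_one.1 h), fun h => hbc (div_eq_one.1 h),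
      fun h => hab (div_left_injective h)⟩, c, ?_⟩
    rw [isConj_blockGL_iff, upperGL_val]
    convert h
    ext i j
    fin_cases i <;> fin_cases j <;> simp [blockMat, mul_div_cancel₀]
  · rintro ⟨⟨a, b⟩, ha, hb, hab⟩ e γ h
    refine ⟨e * a, e * b, e, fun h => hab (mul_left_cancel h), fun h => hb (mul_eq_left.1 h),
      fun h => ha (mul_eq_left.1 h), ?_⟩
    rw [isConj_blockGL_iff, upperGL_val] at h
    convert h
    ext i j
    fin_cases i <;> fin_cases j <;> simp [blockMat]

end ConjugacyClasses

/-! ### Elliptic elements of the second kind: general reduction and odd degree. -/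

namespace ConjugacyClasses

open Matrix GeometricSide UpperHalfSpace SpectralSide

section Field

variable {K : Type*} [Field K]

lemma irreducible_charpoly_two_iff (B : Matrix (Fin 2) (Fin 2) K) :
    Irreducible B.charpoly ↔ ∀ z, z ^ 2 - B.trace * z + B.det ≠ 0 := by
  have hd : B.charpoly.natDegree = 2 := by rw [Matrix.charpoly_natDegree_eq_dim]; simp
  have hm := Matrix.charpoly_monic B
  rw [hm.irreducible_iff_roots_eq_zero_of_degree_le_three (by omega) (by omega),
    Multiset.eq_zero_iff_forall_notMem]
  refine forall_congr' fun z => not_congr ?_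
  rw [mem_roots hm.ne_zero, IsRoot, Matrix.charpoly_fin_two]
  simp

lemma irreducible_charpoly_smul {B : Matrix (Fin 2) (Fin 2) K} (hB : Irreducible B.charpoly)
    {e : K} (he : e ≠ 0) : Irreducible (e • B).charpoly := by
  rw [irreducible_charpoly_two_iff] at hB ⊢
  intro z hz
  rw [Matrix.trace_smul, Matrix.det_smul, Fintype.card_fin, smul_eq_mul] at hz
  refine hB (z / e) ?_
  field_simp
  linear_combination hz

lemma noFixed_of_irreducible {κ : GL (Fin 2) K} (h : Irreducible κ.1.charpoly) : NoFixed κ := by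
  intro h0
  refine (irreducible_charpoly_two_iff _).1 h 1 ?_
  rw [Matrix.trace_fin_two, Matrix.det_fin_two]
  linear_combination h0

lemma ne_smul_one_of_irreducible {B : Matrix (Fin 2) (Fin 2) K} (h : Irreducible B.charpoly)
    (c : K) : B ≠ c • 1 := by
  rintro rfl
  refine (irreducible_charpoly_two_iff _).1 h c ?_
  simp
  ring

lemma isConj_iff_of_irreducible {B B' : Matrix (Fin 2) (Fin 2) K} (h : Irreducible B.charpoly)
    (h' : Irreducible B'.charpoly) : IsConj B B' ↔ B.trace = B'.trace ∧ B.det = B'.det := by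
  constructor
  · intro hc
    have h1 := charpoly_eq_of_isConj hc
    rw [Matrix.charpoly_fin_two, Matrix.charpoly_fin_two] at h1
    have h2 := congrArg (Polynomial.eval 0) h1
    have h3 := congrArg (Polynomial.eval 1) h1
    simp at h2 h3
    exact ⟨by linear_combination h2 - h3, h2⟩
  · rintro ⟨ht, hd⟩
    exact isConj_of_trace_det (ne_smul_one_of_irreducible h) (ne_smul_one_of_irreducible h') ht hd

/-- The scalar `e` is the only rational eigenvalue. Cancelling `X - e` from the characteristic
polynomials leaves those of the blocks. -/
lemma isConj_blockGL_iff_of_irreducible {κ κ' : GL (Fin 2) K} (h : Irreducible κ.1.charpoly)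
    (h' : Irreducible κ'.1.charpoly) (e e' : Kˣ) : IsConj (blockGL κ e) (blockGL κ' e') ↔
      (κ.1.trace = κ'.1.trace ∧ κ.1.det = κ'.1.det) ∧ e = e' := by
  constructor
  · intro hc
    have h1 := charpoly_eq_of_isConj ((isConj_units_iff _ _).1 hc)
    rw [blockGL_val, blockGL_val, charpoly_blockMat, charpoly_blockMat] at h1
    have h2 := congrArg (Polynomial.eval (e' : K)) h1
    rw [eval_mul, eval_mul] at h2
    simp only [eval_sub, eval_X, eval_C, sub_self, zero_mul, mul_eq_zero] at h2
    have he : e = e' := by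
      refine (h2.resolve_right ?_ |> sub_eq_zero.1 |> Units.ext).symm
      have := (irreducible_charpoly_two_iff _).1 (irreducible_charpoly_smul h e.ne_zero) (e' : K)
      rw [Matrix.charpoly_fin_two]
      simpa using this
    subst he
    have h3 := mul_left_cancel₀ (X_sub_C_ne_zero _) h1
    have h4 := isConj_of_charpoly_two
      (ne_smul_one_of_irreducible (irreducible_charpoly_smul h e.ne_zero))
      (ne_smul_one_of_irreducible (irreducible_charpoly_smul h' e.ne_zero)) h3
    rw [isConj_iff_of_irreducible (irreducible_charpoly_smul h e.ne_zero)
      (irreducible_charpoly_smul h' e.ne_zero)] at h4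
    simp at h4
    exact ⟨h4, rfl⟩
  · rintro ⟨⟨ht, hd⟩, rfl⟩
    rw [isConj_blockGL_iff, blockGL_val]
    refine blockMat_isConj ((isConj_iff_of_irreducible (irreducible_charpoly_smul h e.ne_zero)
      (irreducible_charpoly_smul h' e.ne_zero)).2 ?_) _
    simp [ht, hd]

end Field

variable {p : ℕ} [Fact p.Prime] {F : Type*} [Field F] [Fintype F] [DecidableEq F]
  [Algebra (ZMod p) F] {δ : F} [hδ : Fact (∀ x : F, x ^ 3 ≠ δ)]

/-- Common to both parities of `n`: irreducible blocks are classified by trace and determinant, and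
each pair is to be met twice. The constant `c` varies, as the block may remain irreducible over `F`
(order `q² - 1`) or split (order `(q - 1)²`). -/
lemma geometricSum_elliptic2_of_param {M : Type*} [Fintype M] (κ : M → GL (Fin 2) (ZMod p))
    (hκ : ∀ m, Irreducible (κ m).1.charpoly)
    (hsurj : ∀ B : GL (Fin 2) (ZMod p), Irreducible B.1.charpoly →
      ∃ m, (κ m).1.trace = B.1.trace ∧ (κ m).1.det = B.1.det)
    (hcount : ∀ m, Nat.card {m' // (κ m).1.trace = (κ m').1.trace ∧
      (κ m).1.det = (κ m').1.det} = 2) (c : ℂ)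
    (hc : ∀ m, (Nat.card (Subgroup.centralizer ({embed₂ F (κ m)} : Set (GL (Fin 2) F))) : ℂ) = c)
    {f : GL (Fin 3) F → ℂ} (hf : BiInvariant δ f) :
    geometricSum (embed F p) IsElliptic2 f = ((Fintype.card F : ℂ) ^ 3 - 1) * c /
      (2 * ((p : ℂ) ^ 2 - 1)) * ∑ m, horocycle δ f (embed₂ F (κ m)).1 := by
  rw [geometricSum_block κ IsElliptic2 2 ((p : ℂ) ^ 2 - 1) c two_ne_zero
    (fun m => noFixed_of_irreducible (hκ m)) ?_ ?_ ?_
    (fun m => by rw [card_centralizer_anisotropic (hκ m), ZMod.card]) hc hf]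
  · norm_num
  · rintro γ ⟨g, e, hg, h⟩
    have hirr : Irreducible ((e : ZMod p)⁻¹ • g).charpoly :=
      irreducible_charpoly_smul hg (inv_ne_zero e.ne_zero)
    have hdet : ((e : ZMod p)⁻¹ • g).det ≠ 0 := fun h0 =>
      (irreducible_charpoly_two_iff _).1 hirr 0 (by rw [h0]; ring)
    obtain ⟨κ', hκ'⟩ : ∃ κ' : GL (Fin 2) (ZMod p), κ'.1 = (e : ZMod p)⁻¹ • g :=
      ⟨Matrix.GeneralLinearGroup.mkOfDetNeZero _ hdet, rfl⟩
    rw [← hκ'] at hirr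
    obtain ⟨m, hm⟩ := hsurj κ' hirr
    refine ⟨m, e, ((isConj_blockGL_iff_of_irreducible (hκ m) hirr e e).2 ⟨hm, rfl⟩).trans ?_⟩
    rw [isConj_blockGL_iff, hκ', smul_smul, mul_inv_cancel₀ e.ne_zero, one_smul]
    exact h
  · intro m e γ h
    exact ⟨_, e, irreducible_charpoly_smul (hκ m) e.ne_zero, (isConj_blockGL_iff _ _ _).1 h⟩
  · intro m e
    rw [← hcount m]
    refine Nat.card_congr
      { toFun := fun x => ⟨x.1.1,
          ((isConj_blockGL_iff_of_irreducible (hκ m) (hκ x.1.1) e x.1.2).1 x.2).1⟩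
        invFun := fun x => ⟨(x.1, e),
          (isConj_blockGL_iff_of_irreducible (hκ m) (hκ x.1) e e).2 ⟨x.2, rfl⟩⟩
        left_inv := ?_
        right_inv := fun x => rfl }
    rintro ⟨⟨m', e'⟩, h⟩
    obtain ⟨-, rfl⟩ := (isConj_blockGL_iff_of_irreducible (hκ m) (hκ m') e e').1 h
    rfl

section NonSquare

/-- The fixed field of Frobenius is the prime field. Symmetric functions of conjugates descend to
`𝔽_p` in this way. -/
lemma eq_algebraMap_of_pow_eq {L : Type*} [Field L] [Algebra (ZMod p) L] {x : L} (hx : x ^ p = x) :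
    ∃ a : ZMod p, algebraMap (ZMod p) L a = x := by
  have : CharP L p := charP_of_injective_algebraMap (algebraMap (ZMod p) L).injective p
  have h := (Subfield.mem_bot_iff_pow_eq_self L p).2 hx
  rw [← ZMod.fieldRange_castHom_eq_bot p] at h
  obtain ⟨a, ha⟩ := h
  exact ⟨a, by rw [← ha]; exact congrArg (fun g : ZMod p →+* L => g a) (Subsingleton.elim _ _)⟩

/-- In characteristic 2 every element of a finite field is a square. -/
lemma two_ne_zero_of_not_isSquare {ξ : ZMod p} (hξ : ¬ IsSquare ξ) : (2 : ZMod p) ≠ 0 := by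
  intro h
  refine hξ (FiniteField.isSquare_of_char_two ?_ ξ)
  refine CharP.ringChar_of_prime_eq_zero Nat.prime_two ?_
  exact_mod_cast h

lemma isSquare_mul_of_not_isSquare {a b : ZMod p} (ha : ¬ IsSquare a) (hb : ¬ IsSquare b) :
    IsSquare (a * b) := by
  have h0 : a * b ≠ 0 := mul_ne_zero (fun h => ha (h ▸ IsSquare.zero))
    (fun h => hb (h ▸ IsSquare.zero))
  rw [← quadraticChar_one_iff_isSquare h0, map_mul,
    quadraticChar_neg_one_iff_not_isSquare.2 ha, quadraticChar_neg_one_iff_not_isSquare.2 hb]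
  norm_num

omit [DecidableEq F] in
/-- A nonsquare of `𝔽_p` remains one in an extension of odd degree. -/
lemma not_isSquare_algebraMap {n : ℕ} (hcard : Fintype.card F = p ^ n) (hn : Odd n) {ξ : ZMod p}
    (hξ : ¬ IsSquare ξ) (x : F) : x ^ 2 ≠ algebraMap (ZMod p) F ξ := by
  intro hx
  have h2 : (2 : F) ≠ 0 := by
    have := (map_ne_zero (algebraMap (ZMod p) F)).2 (two_ne_zero_of_not_isSquare hξ)
    rwa [map_ofNat] at this
  have hp : Odd p := (Fact.out : p.Prime).odd_of_ne_two (by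
    rintro rfl
    exact two_ne_zero_of_not_isSquare hξ (CharP.cast_eq_zero (ZMod 2) 2))
  -- A square root `x` of `ξ` satisfies `xᵖ = ±x`. The plus sign puts `x` in `𝔽_p`; the minus sign,
  -- iterated an odd number of times, contradicts `x^q = x`.
  have h1 : (x ^ p) ^ 2 = x ^ 2 := by
    rw [← pow_mul, mul_comm, pow_mul, hx, ← map_pow, ZMod.pow_card]
  have hx0 : x ≠ 0 := by
    rintro rfl
    refine hξ ?_
    have : ξ = 0 := (map_eq_zero (algebraMap (ZMod p) F)).1 (by rw [← hx]; ring)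
    rw [this]; exact IsSquare.zero
  rcases sq_eq_sq_iff_eq_or_eq_neg.1 h1 with h3 | h3
  · obtain ⟨a, rfl⟩ := eq_algebraMap_of_pow_eq h3
    refine hξ ⟨a, (algebraMap (ZMod p) F).injective ?_⟩
    rw [← hx, ← map_pow, sq]
  · have h4 : ∀ k, x ^ p ^ k = (-1) ^ k * x := by
      intro k
      induction k with
      | zero => simp
      | succ k ih =>
        rw [pow_succ, pow_mul, ih, mul_pow, h3, ← pow_mul, mul_comm k, pow_mul, hp.neg_one_pow,
          pow_succ]
        ring
    have h5 := FiniteField.pow_card x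
    rw [hcard, h4, hn.neg_one_pow] at h5
    refine mul_ne_zero h2 hx0 ?_
    linear_combination -h5

/-- The matrix of multiplication by `s + t √ξ`. -/
def anisotropicMat {K : Type*} [Field K] (ξ s t : K) : Matrix (Fin 2) (Fin 2) K :=
  !![s, t * ξ; t, s]

lemma irreducible_charpoly_anisotropicMat {K : Type*} [Field K] {ξ s t : K} (ht : t ≠ 0)
    (hξ : ∀ x, x ^ 2 ≠ ξ) : Irreducible (anisotropicMat ξ s t).charpoly := by
  rw [irreducible_charpoly_two_iff]
  intro z hz
  rw [anisotropicMat, Matrix.trace_fin_two_of, Matrix.det_fin_two_of] at hz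
  refine hξ ((z - s) / t) ?_
  field_simp
  linear_combination hz

lemma geometricSum_elliptic2_odd {n : ℕ} (hcard : Fintype.card F = p ^ n) (hn : Odd n)
    {ξ : ZMod p} (hξ : ¬ IsSquare ξ) {f : GL (Fin 3) F → ℂ} (hf : BiInvariant δ f) :
    geometricSum (embed F p) IsElliptic2 f = ellipticTerm2Odd p δ f ξ := by
  have hsq : ∀ x, x ^ 2 ≠ ξ := fun x hx => hξ ⟨x, by rw [← hx, sq]⟩
  have h2 := two_ne_zero_of_not_isSquare hξ
  have hirr : ∀ (s : ZMod p) (t : (ZMod p)ˣ), Irreducible (anisotropicMat ξ s t).charpoly :=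
    fun s t => irreducible_charpoly_anisotropicMat t.ne_zero hsq
  have hdet : ∀ (s : ZMod p) (t : (ZMod p)ˣ), (anisotropicMat ξ s t).det ≠ 0 := fun s t h0 =>
    (irreducible_charpoly_two_iff _).1 (hirr s t) 0 (by rw [h0]; ring)
  let κ : ZMod p × (ZMod p)ˣ → GL (Fin 2) (ZMod p) := fun m =>
    Matrix.GeneralLinearGroup.mkOfDetNeZero _ (hdet m.1 m.2)
  have hκ : ∀ m, (κ m).1 = !![m.1, m.2 * ξ; (m.2 : ZMod p), m.1] := fun m => rfl
  have hemb : ∀ m, (embed₂ F (κ m)).1 = anisotropicMat (algebraMap (ZMod p) F ξ)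
      (algebraMap (ZMod p) F m.1) (algebraMap (ZMod p) F m.2) := by
    intro m
    rw [embed₂_val, hκ, anisotropicMat]
    ext i j
    fin_cases i <;> fin_cases j <;> simp
  rw [geometricSum_elliptic2_of_param κ (fun m => hirr m.1 m.2) ?_ ?_
    ((Fintype.card F : ℂ) ^ 2 - 1) (fun m => card_centralizer_anisotropic (by
      rw [hemb]
      exact irreducible_charpoly_anisotropicMat
        ((map_ne_zero (algebraMap (ZMod p) F)).2 m.2.ne_zero)
        (not_isSquare_algebraMap hcard hn hξ))) hf]
  · rw [ellipticTerm2Odd, Fintype.sum_prod_type]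
    refine congrArg₂ (· * ·) ?_ ?_
    · have := p_pow_sub_one_ne_zero (p := p) two_ne_zero
      field_simp
    · refine Finset.sum_congr rfl fun s _ => Finset.sum_congr rfl fun t _ => ?_
      rw [hemb, anisotropicMat, map_mul]
  · intro B hB
    rw [irreducible_charpoly_two_iff] at hB
    -- A quarter of the discriminant is a nonsquare because the block is irreducible, so its product
    -- with `ξ` is a square `r²`. Then `s = tr / 2` and `t = r / ξ` give the required trace and
    -- determinant.
    obtain ⟨r, hr⟩ : IsSquare (((B.1.trace / 2) ^ 2 - B.1.det) * ξ) := by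
      refine isSquare_mul_of_not_isSquare ?_ hξ
      rintro ⟨w, hw⟩
      refine hB (B.1.trace / 2 + w) ?_
      field_simp at hw ⊢
      linear_combination -hw
    have hξ0 : ξ ≠ 0 := fun h => hξ (h ▸ IsSquare.zero)
    have hr0 : r ≠ 0 := by
      rintro rfl
      rw [mul_zero] at hr
      have h3 := (mul_eq_zero.1 hr).resolve_right hξ0
      refine hB (B.1.trace / 2) ?_
      field_simp at h3 ⊢
      linear_combination -h3
    refine ⟨(B.1.trace / 2, Units.mk0 (r / ξ) (div_ne_zero hr0 hξ0)), ?_⟩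
    rw [hκ, Matrix.trace_fin_two_of, Matrix.det_fin_two_of]
    refine ⟨by field_simp; ring, ?_⟩
    simp only [Units.val_mk0]
    field_simp at hr ⊢
    linear_combination hr
  · rintro ⟨s, t⟩
    -- Trace and determinant fix `s` and `t²`; the sign of `t` is the two-fold ambiguity.
    have hiff : ∀ s' : ZMod p, ∀ t' : (ZMod p)ˣ, ((κ (s, t)).1.trace = (κ (s', t')).1.trace ∧
        (κ (s, t)).1.det = (κ (s', t')).1.det) ↔ s' = s ∧ (t' = t ∨ t' = -t) := by
      intro s' t'
      simp only [hκ, Matrix.trace_fin_two_of, Matrix.det_fin_two_of]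
      have hξ0 : ξ ≠ 0 := fun h => hξ (h ▸ IsSquare.zero)
      constructor
      · rintro ⟨h3, h4⟩
        have h5 : s' = s := mul_left_cancel₀ h2 (by linear_combination -h3)
        subst h5
        have h6 : (t' : ZMod p) ^ 2 = (t : ZMod p) ^ 2 :=
          mul_left_cancel₀ hξ0 (by linear_combination h4)
        refine ⟨rfl, ?_⟩
        rcases sq_eq_sq_iff_eq_or_eq_neg.1 h6 with h7 | h7
        · exact Or.inl (Units.ext h7)
        · exact Or.inr (Units.ext h7)
      · rintro ⟨rfl, rfl | rfl⟩
        · exact ⟨rfl, rfl⟩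
        · refine ⟨rfl, ?_⟩
          push_cast
          ring
    rw [Nat.card_eq_two_iff]
    refine ⟨⟨(s, t), (hiff s t).2 ⟨rfl, Or.inl rfl⟩⟩, ⟨(s, -t), (hiff s (-t)).2 ⟨rfl, Or.inr rfl⟩⟩,
      ?_, ?_⟩
    · intro h
      have h3 : t = -t := congrArg (fun x => x.1.2) h
      have h4 : (t : ZMod p) = -t := congrArg Units.val h3
      exact mul_ne_zero h2 t.ne_zero (by linear_combination h4)
    · rw [Set.eq_univ_iff_forall]
      rintro ⟨⟨s', t'⟩, h⟩
      obtain ⟨rfl, rfl | rfl⟩ := (hiff s' t').1 h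
      · exact Or.inl rfl
      · exact Or.inr rfl

end NonSquare

end ConjugacyClasses

/-! ### Frobenius orbits, and elliptic elements of the second kind in even degree. -/

namespace ConjugacyClasses

open Matrix GeometricSide UpperHalfSpace SpectralSide

section Frobenius

variable {p : ℕ} [Fact p.Prime] {L : Type*} [Field L] [Algebra (ZMod p) L]

/-- The field `𝔽_p[X]/(P)` embeds in every finite field whose degree is a multiple of its own. -/
lemma exists_root_of_irreducible [Finite L] {n : ℕ} (hcard : Nat.card L = p ^ n)
    {P : (ZMod p)[X]} (hP : Irreducible P) (hd : P.natDegree ∣ n) : ∃ x : L, aeval x P = 0 := by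
  have : Fact (Irreducible P) := ⟨hP⟩
  have h1 : Module.finrank (ZMod p) (AdjoinRoot P) = P.natDegree := by
    rw [(AdjoinRoot.powerBasis hP.ne_zero).finrank, AdjoinRoot.powerBasis_dim]
  have h2 : Module.finrank (ZMod p) L = n := by
    have := FiniteField.pow_finrank_eq_natCard p L
    rw [hcard] at this
    exact Nat.pow_right_injective (Fact.out : p.Prime).two_le this
  obtain ⟨φ⟩ := FiniteField.nonempty_algHom_of_finrank_dvd (F := ZMod p) (K := AdjoinRoot P)
    (L := L) (by rw [h1, h2]; exact hd)
  refine ⟨φ (AdjoinRoot.root P), ?_⟩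
  rw [Polynomial.aeval_algHom_apply, AdjoinRoot.aeval_eq, AdjoinRoot.mk_self, map_zero]

/-- Frobenius is an `𝔽_p`-algebra map; in particular it permutes the roots of a polynomial over
`𝔽_p`. -/
lemma aeval_pow_p (x : L) (P : (ZMod p)[X]) : aeval (x ^ p) P = (aeval x P) ^ p := by
  have h := Polynomial.aeval_algHom_apply (FiniteField.frobeniusAlgHom (ZMod p) L) x P
  simpa using h

lemma add_pow_p (x y : L) : (x + y) ^ p = x ^ p + y ^ p := by
  have h := map_add (FiniteField.frobeniusAlgHom (ZMod p) L) x y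
  simpa using h

lemma pow_p_injective {x y : L} (h : x ^ p = y ^ p) : x = y := by
  refine (FiniteField.frobeniusAlgHom (ZMod p) L).toRingHom.injective ?_
  simpa using h

lemma algebraMap_pow_p (a : ZMod p) : (algebraMap (ZMod p) L a) ^ p = algebraMap (ZMod p) L a := by
  rw [← map_pow, ZMod.pow_card]

end Frobenius

variable {p : ℕ} [Fact p.Prime] {F : Type*} [Field F] [Fintype F] [DecidableEq F]
  [Algebra (ZMod p) F] {δ : F} [hδ : Fact (∀ x : F, x ^ 3 ≠ δ)]

lemma horocycle_eq_of_isConj (f : GL (Fin 3) F → ℂ) {B B' : Matrix (Fin 2) (Fin 2) F}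
    (h : IsConj B B') : horocycle δ f B = horocycle δ f B' := by
  have h1 : ∀ ξ : GL (Fin 2) F, IsConj B ξ.1 ↔ IsConj B' ξ.1 := fun ξ =>
    ⟨h.symm.trans, h.trans⟩
  simp only [horocycle, h1]

omit [Fintype F] [DecidableEq F] in
/-- A conjugate pair `η, ηᵖ` is the set of eigenvalues of a matrix over `𝔽_p`. -/
lemma exists_trace_det {η : F} (h2 : η ^ p ^ 2 = η) (h1 : η ^ p ≠ η) :
    ∃ B : GL (Fin 2) (ZMod p), algebraMap (ZMod p) F B.1.trace = η + η ^ p ∧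
      algebraMap (ZMod p) F B.1.det = η * η ^ p := by
  have h2' : (η ^ p) ^ p = η := by rw [← pow_mul, ← sq, h2]
  -- Frobenius exchanges `η` and `ηᵖ`, so their sum and product lie in `𝔽_p`.
  obtain ⟨τ, hτ⟩ := eq_algebraMap_of_pow_eq (p := p) (x := η + η ^ p) (by
    rw [add_pow_p, h2', add_comm])
  obtain ⟨D, hD⟩ := eq_algebraMap_of_pow_eq (p := p) (x := η * η ^ p) (by
    rw [mul_pow, h2', mul_comm])
  have hη : η ≠ 0 := by
    rintro rfl
    exact h1 (zero_pow (Fact.out : p.Prime).ne_zero)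
  have hD0 : D ≠ 0 := by
    rintro rfl
    rw [map_zero] at hD
    exact mul_ne_zero hη (pow_ne_zero _ hη) hD.symm
  have hdet : (!![0, -D; 1, τ] : Matrix (Fin 2) (Fin 2) (ZMod p)).det ≠ 0 := by
    rw [Matrix.det_fin_two_of]; simpa using hD0
  refine ⟨Matrix.GeneralLinearGroup.mkOfDetNeZero _ hdet, ?_, ?_⟩
  · change algebraMap (ZMod p) F (!![0, -D; 1, τ] : Matrix (Fin 2) (Fin 2) (ZMod p)).trace = _
    rw [Matrix.trace_fin_two_of, zero_add, hτ]
  · change algebraMap (ZMod p) F (!![0, -D; 1, τ] : Matrix (Fin 2) (Fin 2) (ZMod p)).det = _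
    rw [Matrix.det_fin_two_of, ← hD]
    congr 1
    ring

lemma geometricSum_elliptic2_even {n : ℕ} (hcard : Fintype.card F = p ^ n) (hn : Even n)
    {f : GL (Fin 3) F → ℂ} (hf : BiInvariant δ f) :
    geometricSum (embed F p) IsElliptic2 f = ellipticTerm2Even p δ f := by
  classical
  choose κ hκt hκd using fun m : {η : F // η ^ p ^ 2 = η ∧ η ^ p ≠ η} =>
    exists_trace_det (p := p) m.2.1 m.2.2
  have hpp : ∀ {η : F}, η ^ p ^ 2 = η → (η ^ p) ^ p = η := fun h => by rw [← pow_mul, ← sq, h]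
  have hirr : ∀ m, Irreducible (κ m).1.charpoly := by
    intro m
    rw [irreducible_charpoly_two_iff]
    intro z hz
    have h1 := congrArg (algebraMap (ZMod p) F) hz
    simp only [map_add, map_sub, map_mul, map_pow, map_zero, hκt, hκd] at h1
    have h2 : (algebraMap (ZMod p) F z - m.1) * (algebraMap (ZMod p) F z - m.1 ^ p) = 0 := by
      linear_combination h1
    have hz := algebraMap_pow_p (L := F) z
    rcases mul_eq_zero.1 h2 with h3 | h3
    · rw [sub_eq_zero.1 h3] at hz
      exact m.2.2 hz
    · rw [sub_eq_zero.1 h3, hpp m.2.1] at hz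
      exact m.2.2 hz.symm
  -- Over `F` the block acquires the distinct eigenvalues `η` and `ηᵖ`; its centralizer there is a
  -- split torus.
  have hemb : ∀ m, IsConj !![m.1, 0; 0, m.1 ^ p] (embed₂ F (κ m)).1 := by
    intro m
    refine isConj_diag (Ne.symm m.2.2) (charpoly_of_trace_det ?_ ?_)
    · rw [embed₂_val, ← hκt, Matrix.trace_fin_two, Matrix.trace_fin_two, map_add]; rfl
    · rw [embed₂_val, ← hκd, RingHom.map_det]; rfl
  have hiff : ∀ m m', ((κ m).1.trace = (κ m').1.trace ∧ (κ m).1.det = (κ m').1.det) ↔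
      m'.1 = m.1 ∨ m'.1 = m.1 ^ p := by
    intro m m'
    have inj := (algebraMap (ZMod p) F).injective
    rw [← inj.eq_iff, ← inj.eq_iff (a := (κ m).1.det), hκt, hκt, hκd, hκd]
    constructor
    · rintro ⟨h1, h2⟩
      have h3 : (m'.1 - m.1) * (m'.1 - m.1 ^ p) = 0 := by linear_combination -m'.1 * h1 + h2
      rcases mul_eq_zero.1 h3 with h3 | h3
      · exact Or.inl (sub_eq_zero.1 h3)
      · exact Or.inr (sub_eq_zero.1 h3)
    · rintro (h | h)
      · rw [h]; exact ⟨rfl, rfl⟩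
      · rw [h, hpp m.2.1]
        exact ⟨add_comm _ _, mul_comm _ _⟩
  rw [geometricSum_elliptic2_of_param κ hirr ?_ ?_ (((Fintype.card F : ℂ) - 1) ^ 2) ?_ hf]
  · rw [ellipticTerm2Even, Finset.sum_subtype (p := fun η : F => η ^ p ^ 2 = η ∧ η ^ p ≠ η) _
      (fun a => by simp)]
    refine congrArg₂ (· * ·) ?_ (Finset.sum_congr rfl fun m _ =>
      horocycle_eq_of_isConj f (hemb m).symm)
    have := p_pow_sub_one_ne_zero (p := p) two_ne_zero
    have hq : (Fintype.card F : ℂ) - 1 ≠ 0 := by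
      rw [sub_ne_zero]
      exact_mod_cast (Fintype.one_lt_card (α := F)).ne'
    field_simp
  · intro B hB
    obtain ⟨η, hη⟩ := exists_root_of_irreducible (L := F) (n := n)
      (by rw [Nat.card_eq_fintype_card, hcard]) hB (by
        rw [Matrix.charpoly_natDegree_eq_dim, Fintype.card_fin]; exact hn.two_dvd)
    have hpow := aeval_pow_p η B.1.charpoly
    have hpow2 := aeval_pow_p (η ^ p) B.1.charpoly
    rw [hpow, hη, zero_pow (Fact.out : p.Prime).ne_zero,
      zero_pow (Fact.out : p.Prime).ne_zero] at hpow2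
    rw [hη, zero_pow (Fact.out : p.Prime).ne_zero] at hpow
    rw [Matrix.charpoly_fin_two] at hη hpow hpow2
    simp only [map_add, map_sub, map_mul, map_pow, aeval_X, aeval_C] at hη hpow hpow2
    have hne : η ^ p ≠ η := by
      intro h
      obtain ⟨a, rfl⟩ := eq_algebraMap_of_pow_eq h
      refine (irreducible_charpoly_two_iff _).1 hB a ((algebraMap (ZMod p) F).injective ?_)
      simpa using hη
    -- Both `η` and `ηᵖ` satisfy the characteristic equation; subtracting and dividing by their
    -- difference gives the trace.
    have ht : η + η ^ p = algebraMap (ZMod p) F B.1.trace :=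
      mul_left_cancel₀ (sub_ne_zero.2 hne) (by linear_combination hpow - hη)
    have hd : η * η ^ p = algebraMap (ZMod p) F B.1.det := by
      linear_combination η * ht - hη
    have h2 : η ^ p ^ 2 = η := by
      rw [sq, pow_mul]
      -- The next Frobenius image is again a root, hence `η` or `ηᵖ`; the latter is excluded by
      -- injectivity.
      have h3 : ((η ^ p) ^ p - η) * ((η ^ p) ^ p - η ^ p) = 0 := by
        linear_combination hpow2 - (η ^ p) ^ p * ht + hd
      rcases mul_eq_zero.1 h3 with h3 | h3
      · exact sub_eq_zero.1 h3
      · exact absurd (pow_p_injective (sub_eq_zero.1 h3)) hne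
    refine ⟨⟨η, h2, hne⟩, (algebraMap (ZMod p) F).injective ?_,
      (algebraMap (ZMod p) F).injective ?_⟩
    · rw [hκt, ht]
    · rw [hκd, hd]
  · intro m
    have hm : (m.1 ^ p) ^ p ^ 2 = m.1 ^ p ∧ (m.1 ^ p) ^ p ≠ m.1 ^ p := by
      refine ⟨by rw [← pow_mul, mul_comm, pow_mul, m.2.1], ?_⟩
      rw [hpp m.2.1]
      exact Ne.symm m.2.2
    rw [Nat.card_eq_two_iff]
    refine ⟨⟨m, rfl, rfl⟩, ⟨⟨m.1 ^ p, hm⟩, (hiff _ _).2 (Or.inr rfl)⟩, ?_, ?_⟩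
    · intro h
      exact m.2.2 (congrArg (fun x => x.1.1) h).symm
    · rw [Set.eq_univ_iff_forall]
      rintro ⟨m', h⟩
      rcases (hiff _ _).1 h with h1 | h1
      · exact Or.inl (Subtype.ext (Subtype.ext h1))
      · exact Or.inr (Subtype.ext (Subtype.ext h1))
  · intro m
    have hη : m.1 ≠ 0 := by
      intro h
      exact m.2.2 (by rw [h]; exact zero_pow (Fact.out : p.Prime).ne_zero)
    have h1 := (isConj_units_iff (upperGL (Units.mk0 _ hη) (Units.mk0 _ (pow_ne_zero p hη)) 0)
      (embed₂ F (κ m))).2 (by rw [upperGL_val]; exact hemb m)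
    rw [← card_centralizer_eq_of_isConj h1, card_centralizer_diag]
    intro h
    exact m.2.2 (congrArg Units.val h).symm

end ConjugacyClasses

/-! ### Elliptic elements of the first kind. -/

namespace ConjugacyClasses

open Matrix GeometricSide UpperHalfSpace SpectralSide

section Cubic

variable {p : ℕ} [Fact p.Prime] {L : Type*} [Field L] [Algebra (ZMod p) L]

/-- The Frobenius equation holds for the generator of the finite field `𝔽_p[X]/(P)` and is carried
to `L` by sending the generator to `x`. -/
lemma exists_root_pow_of_irreducible [Finite L] {n : ℕ} (hcard : Nat.card L = p ^ n)
    {P : (ZMod p)[X]} (hP : Irreducible P) (hd : P.natDegree ∣ n) :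
    ∃ x : L, aeval x P = 0 ∧ x ^ p ^ P.natDegree = x := by
  have : Fact (Irreducible P) := ⟨hP⟩
  have h1 : Module.finrank (ZMod p) (AdjoinRoot P) = P.natDegree := by
    rw [(AdjoinRoot.powerBasis hP.ne_zero).finrank, AdjoinRoot.powerBasis_dim]
  obtain ⟨x, hx⟩ := exists_root_of_irreducible hcard hP hd
  have : Module.Finite (ZMod p) (AdjoinRoot P) := (AdjoinRoot.powerBasis hP.ne_zero).finite
  have : Finite (AdjoinRoot P) := Module.finite_of_finite (ZMod p)
  have := Fintype.ofFinite (AdjoinRoot P)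
  have h2 := FiniteField.pow_card (AdjoinRoot.root P)
  rw [Fintype.card_eq_nat_card, ← FiniteField.pow_finrank_eq_natCard p, h1] at h2
  refine ⟨x, hx, ?_⟩
  have h3 := congrArg (AdjoinRoot.liftAlgHom P (Algebra.ofId (ZMod p) L) x (by
    simpa [aeval_def] using hx)) h2
  simpa using h3

/-- The conjugates `ξ, ξᵖ, ξ^{p²}` are the roots of an irreducible cubic over `𝔽_p`. -/
lemma exists_cubic {ξ : L} (h3 : ξ ^ p ^ 3 = ξ) (h1 : ξ ^ p ≠ ξ) :
    ∃ P : (ZMod p)[X], P.Monic ∧ P.natDegree = 3 ∧ Irreducible P ∧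
      P.map (algebraMap (ZMod p) L) = (X - C ξ) * ((X - C (ξ ^ p)) * (X - C (ξ ^ p ^ 2))) := by
  have e2 : (ξ ^ p) ^ p = ξ ^ p ^ 2 := by rw [← pow_mul, ← sq]
  have e3 : (ξ ^ p ^ 2) ^ p = ξ := by rw [← pow_mul, ← pow_succ, h3]
  -- Frobenius permutes the three conjugates cyclically and fixes their elementary symmetric
  -- functions, which become the coefficients.
  obtain ⟨a, ha⟩ := eq_algebraMap_of_pow_eq (p := p) (x := ξ + ξ ^ p + ξ ^ p ^ 2) (by
    rw [add_pow_p, add_pow_p, e2, e3]; ring)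
  obtain ⟨b, hb⟩ := eq_algebraMap_of_pow_eq (p := p)
    (x := ξ * ξ ^ p + ξ * ξ ^ p ^ 2 + ξ ^ p * ξ ^ p ^ 2) (by
    rw [add_pow_p, add_pow_p, mul_pow, mul_pow, mul_pow, e2, e3]; ring)
  obtain ⟨c, hc⟩ := eq_algebraMap_of_pow_eq (p := p) (x := ξ * ξ ^ p * ξ ^ p ^ 2) (by
    rw [mul_pow, mul_pow, e2, e3]; ring)
  have hd : (X ^ 3 - C a * X ^ 2 + C b * X - C c : (ZMod p)[X]).natDegree = 3 := by
    compute_degree!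
  have hm : (X ^ 3 - C a * X ^ 2 + C b * X - C c : (ZMod p)[X]).Monic := by monicity!
  have hmap : (X ^ 3 - C a * X ^ 2 + C b * X - C c : (ZMod p)[X]).map (algebraMap (ZMod p) L) =
      (X - C ξ) * ((X - C (ξ ^ p)) * (X - C (ξ ^ p ^ 2))) := by
    simp only [Polynomial.map_sub, Polynomial.map_add, Polynomial.map_mul, Polynomial.map_pow,
      map_X, map_C, ha, hb, hc, C_add, C_mul]
    ring
  refine ⟨_, hm, hd, ?_, hmap⟩
  rw [hm.irreducible_iff_roots_eq_zero_of_degree_le_three (by omega) (by omega),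
    Multiset.eq_zero_iff_forall_notMem]
  intro z hz
  have h4 : (Polynomial.map (algebraMap (ZMod p) L)
      (X ^ 3 - C a * X ^ 2 + C b * X - C c)).eval (algebraMap (ZMod p) L z) = 0 := by
    rw [eval_map_apply, (mem_roots hm.ne_zero).1 hz, map_zero]
  rw [hmap] at h4
  simp only [eval_mul, eval_sub, eval_X, eval_C, mul_eq_zero, sub_eq_zero] at h4
  have hz := algebraMap_pow_p (L := L) z
  -- A root in `𝔽_p` would make one of the conjugates Frobenius-fixed, and then all of them.
  rcases h4 with h4 | h4 | h4 <;> rw [h4] at hz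
  · exact h1 hz
  · exact h1 (pow_p_injective hz)
  · rw [e3] at hz
    exact h1 ((congrArg (· ^ p) hz).trans e3)

/-- Both polynomials are the minimal polynomial of `x`. -/
lemma eq_of_aeval_eq_zero {P Q : (ZMod p)[X]} (hP : Irreducible P) (hPm : P.Monic)
    (hQ : Irreducible Q) (hQm : Q.Monic) {x : L} (h : aeval x P = 0) (h' : aeval x Q = 0) :
    P = Q :=
  (minpoly.eq_of_irreducible_of_monic hP h hPm).trans
    (minpoly.eq_of_irreducible_of_monic hQ h' hQm).symm

lemma companion_map {K K' : Type*} [Field K] [Field K'] (φ : K →+* K') (P : K[X]) :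
    (companion P).map φ = companion (P.map φ) := by
  ext i j
  fin_cases i <;> fin_cases j <;> simp [companion]

lemma exists_GL_companion {K : Type*} [Field K] {P : K[X]} (hP : Irreducible P) (hm : P.Monic)
    (h3 : P.natDegree = 3) : ∃ γ : GL (Fin 3) K, γ.1 = companion P := by
  refine ⟨Matrix.GeneralLinearGroup.mkOfDetNeZero (companion P) ?_, rfl⟩
  intro h0
  have h1 : P.IsRoot 0 := by
    rw [← charpoly_companion hm h3, IsRoot, Matrix.eval_charpoly, map_zero, zero_sub,
      Matrix.det_neg, h0, mul_zero]
  have := degree_eq_one_of_irreducible_of_root hP h1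
  rw [degree_eq_natDegree hP.ne_zero, h3] at this
  norm_num at this

variable {F : Type*} [Field F] [Fintype F] [DecidableEq F] [Algebra (ZMod p) F]

/-- The auxiliary field `L` only has to contain `𝔽_{p³}`: it is `F` when `3 ∣ n` and the cubic
extension otherwise. Classes correspond to irreducible cubics, and these to Frobenius orbits of
three elements, whence the factor `1/3`. The orbital sum `S` is left open because it differs in the
two cases. -/
lemma geometricSum_elliptic1_of_param [Finite L] {n : ℕ} (hcard : Nat.card L = p ^ n)
    (hn : 3 ∣ n) [Fintype {ξ : L // ξ ^ p ^ 3 = ξ ∧ ξ ^ p ≠ ξ}] (f : GL (Fin 3) F → ℂ)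
    (S : {ξ : L // ξ ^ p ^ 3 = ξ ∧ ξ ^ p ≠ ξ} → ℂ)
    (hS : ∀ (ξ : {ξ : L // ξ ^ p ^ 3 = ξ ∧ ξ ^ p ≠ ξ}) (P : (ZMod p)[X]) (γ : GL (Fin 3) (ZMod p)),
      P.Monic → P.natDegree = 3 → Irreducible P → P.map (algebraMap (ZMod p) L) =
        (X - C ξ.1) * ((X - C (ξ.1 ^ p)) * (X - C (ξ.1 ^ p ^ 2))) → γ.1 = companion P →
      conjSum f (embed F p γ) = S ξ) :
    geometricSum (embed F p) IsElliptic1 f = 1 / (3 * ((p : ℂ) ^ 3 - 1)) * ∑ ξ, S ξ := by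
  choose P hm hd hirr hmap using fun m : {ξ : L // ξ ^ p ^ 3 = ξ ∧ ξ ^ p ≠ ξ} =>
    exists_cubic (p := p) m.2.1 m.2.2
  choose r hr using fun m => exists_GL_companion (hirr m) (hm m) (hd m)
  have hroot : ∀ m, aeval m.1 (P m) = 0 := by
    intro m
    rw [aeval_def, ← eval_map, hmap]
    simp
  have hPeq : ∀ m (Q : (ZMod p)[X]), Q.Monic → Irreducible Q → aeval m.1 Q = 0 → Q = P m :=
    fun m Q hQm hQ h => eq_of_aeval_eq_zero hQ hQm (hirr m) (hm m) h (hroot m)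
  have hchar : ∀ m, (r m).1.charpoly = P m := fun m => by
    rw [hr, charpoly_companion (hm m) (hd m)]
  have hconj : ∀ m γ, IsConj (r m) γ ↔ γ.1.charpoly = P m := by
    intro m γ
    rw [isConj_units_iff]
    constructor
    · intro h
      rw [← charpoly_eq_of_isConj h, hchar]
    · intro h
      rw [hr]
      exact isConj_companion_of_irreducible (hirr m) (hm m) (hd m) (by
        rw [← h]; exact Matrix.aeval_self_charpoly _)
  rw [geometricSum_of_param (embed F p) r IsElliptic1 3 ((p : ℂ) ^ 3 - 1) three_ne_zero ?_ ?_ ?_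
    (fun m => by rw [card_centralizer_companion (hirr m) (hm m) (hd m) (hr m), ZMod.card]) f]
  · rw [Finset.sum_congr rfl fun m _ => hS m (P m) (r m) (hm m) (hd m) (hirr m) (hmap m) (hr m)]
    norm_num
  · intro γ hγ
    have hγm := Matrix.charpoly_monic γ.1
    have hγd : γ.1.charpoly.natDegree = 3 := by rw [Matrix.charpoly_natDegree_eq_dim]; simp
    obtain ⟨x, hx, hx3⟩ := exists_root_pow_of_irreducible hcard hγ (by rwa [hγd])
    rw [hγd] at hx3
    have hx1 : x ^ p ≠ x := by
      intro h
      obtain ⟨a, rfl⟩ := eq_algebraMap_of_pow_eq h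
      rw [aeval_algebraMap_apply, map_eq_zero] at hx
      have := degree_eq_one_of_irreducible_of_root hγ (by simpa [IsRoot] using hx)
      rw [degree_eq_natDegree hγ.ne_zero, hγd] at this
      norm_num at this
    exact ⟨⟨x, hx3, hx1⟩, (hconj _ _).2 (hPeq _ _ hγm hγ hx)⟩
  · intro m γ h
    change Irreducible _
    rw [(hconj m γ).1 h]
    exact hirr m
  · intro m
    have e2 : (m.1 ^ p) ^ p = m.1 ^ p ^ 2 := by rw [← pow_mul, ← sq]
    have e3 : (m.1 ^ p ^ 2) ^ p = m.1 := by rw [← pow_mul, ← pow_succ, m.2.1]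
    have hstep : ∀ x : L, x ^ p ^ 3 = x ∧ x ^ p ≠ x → (x ^ p) ^ p ^ 3 = x ^ p ∧ (x ^ p) ^ p ≠ x ^ p :=
      fun x hx => ⟨by rw [← pow_mul, mul_comm, pow_mul, hx.1], fun h => hx.2 (pow_p_injective h)⟩
    let m₁ : {ξ : L // ξ ^ p ^ 3 = ξ ∧ ξ ^ p ≠ ξ} := ⟨m.1 ^ p, hstep _ m.2⟩
    let m₂ : {ξ : L // ξ ^ p ^ 3 = ξ ∧ ξ ^ p ≠ ξ} := ⟨m.1 ^ p ^ 2, e2 ▸ hstep _ (hstep _ m.2)⟩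
    have hP1 : P m = P m₁ := hPeq _ _ (hm m) (hirr m) (by
      rw [aeval_pow_p, hroot, zero_pow (Fact.out : p.Prime).ne_zero])
    have hP2 : P m = P m₂ := hPeq _ _ (hm m) (hirr m) (by
      change aeval (m.1 ^ p ^ 2) (P m) = 0
      rw [← e2, aeval_pow_p, aeval_pow_p, hroot, zero_pow (Fact.out : p.Prime).ne_zero,
        zero_pow (Fact.out : p.Prime).ne_zero])
    -- The parameters of one class are the roots of its cubic, which form a single Frobenius orbit.
    have hset : {m' | IsConj (r m) (r m')} = {m, m₁, m₂} := by
      ext m'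
      rw [Set.mem_ofPred_eq, hconj, hchar]
      simp only [Set.mem_insert_iff, Set.mem_singleton_iff]
      constructor
      · intro h
        have h1 := hroot m'
        rw [h, aeval_def, ← eval_map, hmap] at h1
        simp only [eval_mul, eval_sub, eval_X, eval_C, mul_eq_zero, sub_eq_zero] at h1
        exact h1.imp Subtype.ext (Or.imp Subtype.ext Subtype.ext)
      · rintro (rfl | rfl | rfl)
        exacts [rfl, hP1.symm, hP2.symm]
    have h01 : m ≠ m₁ := fun h => m.2.2 (congrArg Subtype.val h).symm
    have h12 : m₁ ≠ m₂ := fun h => m₁.2.2 (e2.trans (congrArg Subtype.val h).symm)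
    have h02 : m ≠ m₂ := fun h => m₂.2.2 (e3.trans (congrArg Subtype.val h))
    have := Set.ncard_eq_three.2 ⟨m, m₁, m₂, h01, h02, h12, hset⟩
    exact this

end Cubic

variable {p : ℕ} [Fact p.Prime] {F : Type*} [Field F] [Fintype F] [DecidableEq F]
  [Algebra (ZMod p) F] {δ : F} [hδ : Fact (∀ x : F, x ^ 3 ≠ δ)]

omit [DecidableEq F] in
lemma card_sub_one_ne_zero : (Fintype.card F : ℂ) - 1 ≠ 0 := by
  rw [sub_ne_zero]
  exact_mod_cast (Fintype.one_lt_card (α := F)).ne'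

lemma geometricSum_elliptic1_split {n : ℕ} (hcard : Fintype.card F = p ^ n) (hn : 3 ∣ n)
    {f : GL (Fin 3) F → ℂ} (hf : BiInvariant δ f) :
    geometricSum (embed F p) IsElliptic1 f = ellipticTerm1Split p δ f := by
  classical
  have hp : 0 < p := (Fact.out : p.Prime).pos
  rw [geometricSum_elliptic1_of_param (L := F) (by rw [Nat.card_eq_fintype_card, hcard]) hn f
    (fun ξ => ((Fintype.card F : ℂ) ^ 3 - 1) * (((Fintype.card F : ℂ) - 1) ^ 2 *
      horocycle δ f !![ξ.1 ^ (p - 1), 0; 0, ξ.1 ^ (p ^ 2 - 1)]))]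
  · rw [ellipticTerm1Split, Finset.sum_subtype (p := fun η : F => η ^ p ^ 3 = η ∧ η ^ p ≠ η) _
      (fun a => by simp), ← Finset.mul_sum, ← Finset.mul_sum, ← mul_assoc, ← mul_assoc]
    refine congrArg₂ (· * ·) ?_ rfl
    have := p_pow_sub_one_ne_zero (p := p) three_ne_zero
    have hq := card_sub_one_ne_zero (F := F)
    field_simp
  · rintro ⟨ξ, h3, h1⟩ P γ hm hd hP hmap hγ
    have hξ : ξ ≠ 0 := by
      rintro rfl
      exact h1 (zero_pow hp.ne')
    have e2 : (ξ ^ p) ^ p = ξ ^ p ^ 2 := by rw [← pow_mul, ← sq]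
    have e3 : (ξ ^ p ^ 2) ^ p = ξ := by rw [← pow_mul, ← pow_succ, h3]
    have h12 : ξ ^ p ≠ ξ ^ p ^ 2 := fun h => h1 (pow_p_injective (by rw [e2, ← h]))
    have h02 : ξ ^ p ^ 2 ≠ ξ := fun h => h1 (by rw [h] at e3; exact e3)
    have hs1 : ξ * ξ ^ (p - 1) = ξ ^ p := by
      rw [← pow_succ', Nat.sub_add_cancel hp]
    have hs2 : ξ * ξ ^ (p ^ 2 - 1) = ξ ^ p ^ 2 := by
      rw [← pow_succ', Nat.sub_add_cancel (Nat.pow_pos hp)]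
    have hu1 : ξ ^ (p - 1) ≠ 1 := fun h => h1 (by rw [← hs1, h, mul_one])
    have hu2 : ξ ^ (p ^ 2 - 1) ≠ 1 := fun h => h02 (by rw [← hs2, h, mul_one])
    have hu12 : ξ ^ (p - 1) ≠ ξ ^ (p ^ 2 - 1) := fun h => h12 (by rw [← hs1, ← hs2, h])
    -- Dividing the eigenvalues `ξ`, `ξᵖ`, `ξ^{p²}` by `ξ` leaves 1 and the two entries of `κ`.
    let κ : GL (Fin 2) F := upperGL (Units.mk0 _ (pow_ne_zero (p - 1) hξ))
      (Units.mk0 _ (pow_ne_zero (p ^ 2 - 1) hξ)) 0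
    have hκ : κ.1 = !![ξ ^ (p - 1), 0; 0, ξ ^ (p ^ 2 - 1)] := rfl
    have hconj : IsConj (blockGL κ (Units.mk0 ξ hξ)) (embed F p γ) := by
      rw [isConj_blockGL_iff]
      have h4 : (embed F p γ).1.charpoly = (X - C ξ) * ((X - C (ξ ^ p)) * (X - C (ξ ^ p ^ 2))) := by
        rw [embed_val, hγ, companion_map, charpoly_companion (hm.map _) (by rw [hm.natDegree_map, hd]),
          hmap]
      convert isConj_diag_three h12 h1 h02 h4 using 1
      rw [hκ]
      ext i j
      fin_cases i <;> fin_cases j <;> simp [blockMat, hs1, hs2]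
    rw [← conjSum_of_isConj f hconj, blockGL, conjSum_scalar_mul hf, conjSum_affineMat hf κ
      (noFixed_of_charpoly (upperGL_charpoly _ _ _) hu1 hu2), card_centralizer_diag, hκ]
    exact fun h => hu12 (congrArg Units.val h)

lemma geometricSum_elliptic1_nonsplit {n : ℕ} (hcard : Fintype.card F = p ^ n) (hn : ¬ 3 ∣ n)
    {f : GL (Fin 3) F → ℂ} (hf : BiInvariant δ f) :
    geometricSum (embed F p) IsElliptic1 f = ellipticTerm1Nonsplit p δ f := by
  classical
  -- The cubic extension has degree `3n` over `𝔽_p`, divisible by 3, so it contains `𝔽_{p³}`.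
  have hcardL : Nat.card (CubicExt δ) = p ^ (3 * n) := by
    rw [card_cubicExt, hcard, ← pow_mul, mul_comm]
  have := Fintype.ofFinite (CubicExt δ)
  have hp : 0 < p := (Fact.out : p.Prime).pos
  have hne : ∀ ξ : {ξ : CubicExt δ // ξ ^ p ^ 3 = ξ ∧ ξ ^ p ≠ ξ}, ξ.1 ≠ 0 := by
    rintro ⟨ξ, h3, h1⟩ rfl
    exact h1 (zero_pow hp.ne')
  let k : {ξ : CubicExt δ // ξ ^ p ^ 3 = ξ ∧ ξ ^ p ≠ ξ} → GL (Fin 3) F := fun ξ =>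
    (unitsEquivK δ (Units.mk0 ξ.1 (hne ξ))).1
  have hk : ∀ ξ, (k ξ).1 = mulMat δ ξ.1 := fun ξ => unitsEquivK_val _
  rw [geometricSum_elliptic1_of_param (L := CubicExt δ) hcardL (dvd_mul_right 3 n) f
    (fun ξ => ((Fintype.card F : ℂ) ^ 3 - 1) * ∑ η : GL (Fin 2) F, ∑ c : F, ∑ d : F,
        onHq f (((affineMat η c d)⁻¹ * k ξ * affineMat η c d) • basePoint δ))]
  · rw [ellipticTerm1Nonsplit, ← Finset.mul_sum, ← mul_assoc]
    refine congrArg₂ (· * ·) ?_ ?_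
    · have := p_pow_sub_one_ne_zero (p := p) three_ne_zero
      field_simp
    · refine Finset.sum_bij (fun ξ _ => k ξ) ?_ ?_ ?_ (fun _ _ => rfl)
      · intro ξ _
        rw [Finset.mem_filter]
        refine ⟨Finset.mem_univ _, (unitsEquivK δ _).2, Units.ext ?_, fun h => ξ.2.2 ?_⟩
        · rw [Units.val_pow_eq_pow_val, hk, ← map_pow, ξ.2.1]
        · have h1 := congrArg Units.val h
          rw [Units.val_pow_eq_pow_val, hk, ← map_pow] at h1
          exact mulMat_injective δ h1
      · intro ξ _ ξ' _ h
        have h1 := congrArg Units.val h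
        rw [hk, hk] at h1
        exact Subtype.ext (mulMat_injective δ h1)
      · intro g hg
        rw [Finset.mem_filter] at hg
        obtain ⟨-, hgK, hg3, hg1⟩ := hg
        obtain ⟨α, hα⟩ := (mem_K_iff_mulMat g).1 hgK
        refine ⟨⟨α, mulMat_injective δ ?_, fun h => hg1 (Units.ext ?_)⟩, Finset.mem_univ _,
          Units.ext ?_⟩
        · rw [map_pow, ← hα, ← Units.val_pow_eq_pow_val, hg3]
        · rw [Units.val_pow_eq_pow_val, hα, ← map_pow, h]
        · exact (hk _).trans hα.symm
  · intro ξ P γ hm hd hP hmap hγ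
    have hroot : aeval ξ.1 P = 0 := by
      rw [aeval_def, ← eval_map, hmap]
      simp
    have hfin : Module.finrank (ZMod p) F = n := by
      have := FiniteField.pow_finrank_eq_natCard p F
      rw [Nat.card_eq_fintype_card, hcard] at this
      exact Nat.pow_right_injective (Fact.out : p.Prime).two_le this
    have hdF : (P.map (algebraMap (ZMod p) F)).natDegree = 3 := by rw [hm.natDegree_map, hd]
    have hmF : (P.map (algebraMap (ZMod p) F)).Monic := hm.map _
    -- The cubic stays irreducible over `F`: the minimal polynomial of a root in `F` would have
    -- degree 3, which would divide `n`.
    have hirr : Irreducible (P.map (algebraMap (ZMod p) F)) := by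
      rw [hmF.irreducible_iff_roots_eq_zero_of_degree_le_three (by omega) (by omega),
        Multiset.eq_zero_iff_forall_notMem]
      intro z hz
      have h1 : aeval z P = 0 := by
        rw [aeval_def, ← eval_map]
        exact (mem_roots hmF.ne_zero).1 hz
      have h2 := minpoly.eq_of_irreducible_of_monic hP h1 hm
      have h3 := minpoly.degree_dvd (Algebra.IsIntegral.isIntegral (R := ZMod p) z)
      rw [← h2, hd, hfin] at h3
      exact hn h3
    -- The multiplication matrix of `ξ` is annihilated by this irreducible cubic, so it is conjugate
    -- to its companion matrix. The orbital sum can therefore be taken at an element of `K`.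
    have hconj : IsConj (embed F p γ) (k ξ) := by
      rw [isConj_units_iff, embed_val, hγ, companion_map, hk]
      refine isConj_companion_of_irreducible hirr hmF hdF ?_
      rw [Polynomial.aeval_algHom_apply, aeval_map_algebraMap, hroot, map_zero]
    rw [conjSum_of_isConj f hconj, conjSum_eq_affine hf]
    simp_rw [onHq_smul hf]

end ConjugacyClasses

end

theorem mainTheorem1 (p n : ℕ) [Fact p.Prime] {F : Type*} [Field F] [Fintype F] [DecidableEq F]
    [Algebra (ZMod p) F] (hcard : Fintype.card F = p ^ n)
    (δ : F) [Fact (∀ x : F, x ^ 3 ≠ δ)]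
    (ξ : ZMod p) (hξ : Odd n → ¬ IsSquare ξ)
    (f : GL (Fin 3) F → ℂ) (hf : UpperHalfSpace.BiInvariant δ f) :
    Finite (SpectralSide.Irrep (GL (Fin 3) F)) ∧
    SpectralSide.spectralSide (GeometricSide.embed F p) f =
      SpectralSide.geometricSum (GeometricSide.embed F p) (fun _ => True) f ∧
    SpectralSide.geometricSum (GeometricSide.embed F p) GeometricSide.IsCentral f =
      GeometricSide.centralTerm p δ f ∧
    SpectralSide.geometricSum (GeometricSide.embed F p) GeometricSide.IsHyperbolic1 f =
      GeometricSide.hyperbolicTerm1 p δ f ∧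
    SpectralSide.geometricSum (GeometricSide.embed F p) GeometricSide.IsHyperbolic2 f =
      GeometricSide.hyperbolicTerm2 p δ f ∧
    SpectralSide.geometricSum (GeometricSide.embed F p) GeometricSide.IsParabolic1 f =
      GeometricSide.parabolicTerm1 p δ f ∧
    SpectralSide.geometricSum (GeometricSide.embed F p) GeometricSide.IsParabolic2 f =
      GeometricSide.parabolicTerm2 p δ f ∧
    SpectralSide.geometricSum (GeometricSide.embed F p) GeometricSide.IsParabolic3 f =
      GeometricSide.parabolicTerm3 p δ f ∧
    SpectralSide.geometricSum (GeometricSide.embed F p) GeometricSide.IsElliptic1 f =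
      GeometricSide.ellipticTerm1 p δ f n ∧
    SpectralSide.geometricSum (GeometricSide.embed F p) GeometricSide.IsElliptic2 f =
      GeometricSide.ellipticTerm2 p δ f n ξ ∧
    SpectralSide.spectralSide (GeometricSide.embed F p) f =
      GeometricSide.centralTerm p δ f +
      (GeometricSide.hyperbolicTerm1 p δ f + GeometricSide.hyperbolicTerm2 p δ f) +
      (GeometricSide.parabolicTerm1 p δ f + GeometricSide.parabolicTerm2 p δ f +
        GeometricSide.parabolicTerm3 p δ f) +
      (GeometricSide.ellipticTerm1 p δ f n + GeometricSide.ellipticTerm2 p δ f n ξ) := by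
  have hZ := ConjugacyClasses.geometricSum_central (p := p) hf
  have hH1 := ConjugacyClasses.geometricSum_hyperbolic1 (p := p) hf
  have hH2 := ConjugacyClasses.geometricSum_hyperbolic2 (p := p) hf
  have hP1 := ConjugacyClasses.geometricSum_parabolic1 (p := p) hf
  have hP2 := ConjugacyClasses.geometricSum_parabolic2 (p := p) hf
  have hP3 := ConjugacyClasses.geometricSum_parabolic3 (p := p) hf
  have hE1 : SpectralSide.geometricSum (GeometricSide.embed F p) GeometricSide.IsElliptic1 f =
      GeometricSide.ellipticTerm1 p δ f n := by
    rw [GeometricSide.ellipticTerm1]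
    split_ifs with h
    · exact ConjugacyClasses.geometricSum_elliptic1_split hcard h hf
    · exact ConjugacyClasses.geometricSum_elliptic1_nonsplit hcard h hf
  have hE2 : SpectralSide.geometricSum (GeometricSide.embed F p) GeometricSide.IsElliptic2 f =
      GeometricSide.ellipticTerm2 p δ f n ξ := by
    rw [GeometricSide.ellipticTerm2]
    split_ifs with h
    · exact ConjugacyClasses.geometricSum_elliptic2_even hcard h hf
    · rw [Nat.not_even_iff_odd] at h
      exact ConjugacyClasses.geometricSum_elliptic2_odd hcard h (hξ h) hf
  have htrace : SpectralSide.spectralSide (GeometricSide.embed F p) f =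
      SpectralSide.geometricSum (GeometricSide.embed F p) (fun _ => True) f := by
    rw [SpectralSide.spectralSide_eq, SpectralSide.geometricSum_true]
  refine ⟨SpectralSide.finite_irrep, htrace, hZ, hH1, hH2, hP1, hP2, hP3, hE1, hE2, ?_⟩
  -- Since every class has exactly one type, the total splits into the eight contributions.
  rw [htrace, SpectralSide.geometricSum_partition _ ConjugacyClasses.classType
    ConjugacyClasses.existsUnique_classType, Fin.sum_univ_eight, ← hZ, ← hH1, ← hH2, ← hP1, ← hP2,
    ← hP3, ← hE1, ← hE2]
  simp only [ConjugacyClasses.classType, Matrix.cons_val]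
  ring
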